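/- Let $\mathbb B^n\subset\mathbb R^n$ be the closed Euclidean unit ball, $d\ge 1$, $n_d=\sum_{i=0}^d n^i$, and let $\psi_d:\mathbb B^n\to\mathbb R^{n_d}$ be the feature map with components $[\psi_d(\mathbf x)]_{(k_1,\dots,k_i)}=\frac1{\sqrt{d+1}}\prod_{j=1}^i x_{k_j}$, $0\le i\le d$, $(k_1,\dots,k_i)\in\{1,\dots,n\}^i$. Let $\mathcal K_d(\mathbf x,\mathbf y)=\langle\psi_d(\mathbf x),\psi_d(\mathbf y)\rangle=\frac1{d+1}\sum_{k=0}^d(\mathbf x\cdot\mathbf y)^k$. **Setting.** Let $B,L,\zeta,\epsilon>0$, let $u:\mathbb R\to[0,1]$ be non-decreasing and $L$-Lipschitz, and let $\mathcal D$ be a probability distribution on $\mathbb B^n\times[0,1]$ for which there are $\mathbf v\in\mathbb R^{n_d}$ with $\|\mathbf v\|_2\le B$ and a measurable $\xi:\mathbb R^n\to[-\zeta,\zeta]$ with $\mathbb E[\xi(\mathbf x)^2]\le\epsilon$ such that $\mathbb E[y\mid\mathbf x]=u(\langle\mathbf v,\psi_d(\mathbf x)\rangle+\xi(\mathbf x))$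 almost surely. For $h:\mathbb B^n\to[0,1]$ put $\varepsilon(h)=\mathbb E_{(\mathbf x,y)\sim\mathcal D}\big[(h(\mathbf x)-\mathbb E[y\mid\mathbf x])^2\big]$. **Parameters.** Let $m_1\ge1$ be an integer, $0<\delta<1$, $\epsilon_K>0$, $\lambda=1/L$, and for constants $C,C'>0$ let $T=\big\lceil CBL\sqrt{m_1/\log(1/\delta)}\,\big\rceil$ and $m_2=\lceil C'm_1\log(T/\delta)\rceil$. Put $$A_2=L\sqrt\epsilon+L\zeta\sqrt[4]{\tfrac{\log(1/\delta)}{m_1}}+BL\sqrt{\tfrac{\log(1/\delta)}{m_1}}.$$ **Algorithm (Alphatron with approximate pre-computation).** Draw training data $(\mathbf x_i,y_i)_{i=1}^{m_1}$ and validation data $(\mathbf a_i,b_i)_{i=1}^{m_2}$, all independent with law $\mathcal D$. Given the data, compute independently estimates $z_{ij}$ of $\mathbf x_i\cdot\mathbf x_j$ $(i,j\le m_1)$ and $z'_{ij}$ of $\mathbf a_i\cdot\mathbf x_j$ $(i\le m_2,\ j\le m_1)$ to additive error $e=\epsilon_K/(3d)$ with failure probability at most $p=\delta_K/(m_1^2+m_1m_2)$,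 where $\delta_K=\delta$. An estimate of $\mathbf s\cdot\mathbf w$ is made by $\ell_2$-sampling: it is the median of $\lceil 6\log(1/p)\rceil$ independent means of $\lceil 9\|\mathbf s\|_2^2\|\mathbf w\|_2^2/(2e^2)\rceil$ independent samples each, where a sample draws an index $j$ with probability $s_j^2/\|\mathbf s\|_2^2$ and returns $\|\mathbf s\|_2^2w_j/s_j$ (the estimate is $0$ if $\mathbf s=0$ or $\mathbf w=0$; the median is the lower one if the number of means is even). Put $\widetilde K_{ij}=\frac1{d+1}\sum_{k=0}^d z_{ij}^k$ and $\widetilde K'_{ij}=\frac1{d+1}\sum_{k=0}^d (z'_{ij})^k$. Starting from $\alpha^0=0\in\mathbb R^{m_1}$, iterate $$\alpha_i^{t+1}=\alpha_i^t+\frac{\lambda}{m_1}\Big(y_i-u\Big(\sum_{j=1}^{m_1}\alpha_j^t\widetilde K_{ij}\Big)\Big),$$ and output $\alpha^{t_{\rm out}}$, where $t_{\rm out}$ minimizes $\frac1{m_2}\sum_{i=1}^{m_2}\big(u\big(\sum_{j}\alpha_j^t\widetilde K'_{ij}\big)-b_i\big)^2$ over $t\in\{0,\dots,T-1\}$. The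 output describes the hypothesis $h^{t_{\rm out}}(\mathbf x)=u\big(\sum_{i=1}^{m_1}\alpha_i^{t_{\rm out}}\mathcal K_d(\mathbf x,\mathbf x_i)\big)$. **Theorem.** There are universal constants $C_0,C_0'>0$ such that for all $C\ge C_0$ and $C'\ge C_0'$ there is a constant $C''>0$, depending only on $C$ and $C'$, such that in the above setting, for all values of $n,d,m_1,B,L,\zeta,\epsilon,\delta,\epsilon_K$ and all $u,\mathcal D$ as above, with probability at least $1-3\delta$ over the data and the estimates, for every way of breaking ties in the choice of $t_{\rm out}$, $$\varepsilon(h^{t_{\rm out}})\le C''\big(A_2+\epsilon_K^2T^2+\epsilon_KT\big).$$ The same holds if the inner products are estimated by any other randomized subroutine whose output law depends measurably on the two input vectors and which, for every pair of vectors in $\mathbb B^n$, has additive error at most $e$ with probability at least $1-p$. -/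

import Mathlib

open MeasureTheory ProbabilityTheory
open scoped ENNReal

namespace Alphatron

noncomputable section

/-- The input space `ℝⁿ` with the Euclidean norm. -/
abbrev Vec (n : ℕ) : Type := EuclideanSpace ℝ (Fin n)

/-- Tuples `(k₁, …, kᵢ) ∈ [n]ⁱ` with `0 ≤ i ≤ d`, indexing the monomials of degree at most `d`. -/
abbrev MonoIdx (n d : ℕ) : Type := Σ i : Fin (d + 1), (Fin (i : ℕ) → Fin n)

/-- The feature space `ℝ^{n_d}`, `n_d = ∑_{i ≤ d} nⁱ`, with the Euclidean norm. -/
abbrev Feat (n d : ℕ) : Type := EuclideanSpace ℝ (MonoIdx n d)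

/-- The normalized feature map `ψ_d`. -/
def feature {n : ℕ} (d : ℕ) (x : Vec n) : Feat n d :=
  WithLp.toLp 2 fun k : MonoIdx n d => (1 / Real.sqrt ((d : ℝ) + 1)) * ∏ j, x (k.2 j)

/-- The normalized multinomial kernel `𝒦_d(x, y) = ⟨ψ_d(x), ψ_d(y)⟩`. -/
def mkernel {n : ℕ} (d : ℕ) (x y : Vec n) : ℝ := inner ℝ (feature d x) (feature d y)

/-- `z ↦ (1 / (d + 1)) ∑_{k ≤ d} zᵏ`. -/
def kernelPoly (d : ℕ) (z : ℝ) : ℝ := (1 / ((d : ℝ) + 1)) * ∑ k ∈ Finset.range (d + 1), z ^ k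

theorem mkernel_eq {n : ℕ} (d : ℕ) (x y : Vec n) :
    mkernel d x y = kernelPoly d (inner ℝ x y) := by
  have hs : (Real.sqrt ((d : ℝ) + 1))⁻¹ * (Real.sqrt ((d : ℝ) + 1))⁻¹ = ((d : ℝ) + 1)⁻¹ := by
    rw [← mul_inv, Real.mul_self_sqrt (by positivity)]
  have h1 : ∀ i : ℕ, (∑ f : Fin i → Fin n, ∏ j, (x (f j) * y (f j))) = (inner ℝ x y) ^ i := by
    intro i
    have h2 := Finset.prod_univ_sum (fun _ : Fin i => (Finset.univ : Finset (Fin n)))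
      (fun _ k => x k * y k)
    rw [Fintype.piFinset_univ] at h2
    rw [← h2, Finset.prod_const, Finset.card_univ, Fintype.card_fin]
    congr 1
    simp [PiLp.inner_apply, mul_comm]
  unfold mkernel kernelPoly feature
  rw [PiLp.inner_apply, Fintype.sum_sigma, Finset.sum_range, Finset.mul_sum]
  refine Finset.sum_congr rfl fun i _ => ?_
  rw [← h1, Finset.mul_sum]
  refine Finset.sum_congr rfl fun f _ => ?_
  simp only [Finset.prod_mul_distrib, one_div, RCLike.inner_apply, conj_trivial]
  rw [← hs]
  ring

/-! ### The learning setting -/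

/-- The regression function `E[y | x]` of a distribution `D` of pairs `(x, y)`, as a function of the
pair. -/
def regression {n : ℕ} (D : Measure (Vec n × ℝ)) : Vec n × ℝ → ℝ :=
  D[(fun p : Vec n × ℝ => p.2) |
    MeasurableSpace.comap (Prod.fst : Vec n × ℝ → Vec n) inferInstance]

/-- The generalization error `ε(h) = E_{(x,y) ∼ D} [(h(x) - E[y | x])²]`. -/
def genError {n : ℕ} (D : Measure (Vec n × ℝ)) (h : Vec n → ℝ) : ℝ :=
  ∫ p, (h p.1 - regression D p) ^ 2 ∂D

/-- `D` is a probability distribution on `𝔹ⁿ × [0, 1]`, `u : ℝ → [0, 1]` is non-decreasing and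
`L`-Lipschitz, and `E[y | x] = u(⟨v, ψ_d(x)⟩ + ξ(x))` for some vector `v` with `‖v‖₂ ≤ B` and some
noise function `ξ : ℝⁿ → [-ζ, ζ]` with `E[ξ(x)²] ≤ ε`. -/
structure LearningSetting {n : ℕ} (d : ℕ) (B L ζ ε : ℝ) (u : ℝ → ℝ)
    (D : Measure (Vec n × ℝ)) : Prop where
  isProbability : IsProbabilityMeasure D
  support : ∀ᵐ p ∂D, ‖p.1‖ ≤ 1 ∧ p.2 ∈ Set.Icc (0 : ℝ) 1
  u_range : ∀ s, u s ∈ Set.Icc (0 : ℝ) 1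
  u_mono : Monotone u
  u_lipschitz : LipschitzWith L.toNNReal u
  concept : ∃ (v : Feat n d) (ξ : Vec n → ℝ),
    ‖v‖ ≤ B ∧ Measurable ξ ∧ (∀ x, ξ x ∈ Set.Icc (-ζ) ζ) ∧
    ∫ p, ξ p.1 ^ 2 ∂D ≤ ε ∧
    regression D =ᵐ[D] fun p => u (inner ℝ v (feature d p.1) + ξ p.1)

/-! ### Parameters -/

/-- `T = C B L √(m₁ / log(1/δ))`, rounded up. -/
def numIter (C B L δ : ℝ) (m₁ : ℕ) : ℕ :=
  ⌈C * B * L * Real.sqrt ((m₁ : ℝ) / Real.log (1 / δ))⌉₊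

/-- `m₂ = C' m₁ log(T/δ)`, rounded up. -/
def numVal (C' δ : ℝ) (m₁ T : ℕ) : ℕ := ⌈C' * (m₁ : ℝ) * Real.log ((T : ℝ) / δ)⌉₊

/-- `A₂ = L √ε + L ζ (log(1/δ)/m₁)^{1/4} + B L √(log(1/δ)/m₁)`. -/
def errA2 (B L ζ ε δ : ℝ) (m₁ : ℕ) : ℝ :=
  L * Real.sqrt ε + L * ζ * (Real.log (1 / δ) / (m₁ : ℝ)) ^ (1 / 4 : ℝ) +
    B * L * Real.sqrt (Real.log (1 / δ) / (m₁ : ℝ))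

/-! ### Alphatron with a given kernel matrix -/

/-- The iterates `α⁰ = 0`, `αᵢᵗ⁺¹ = αᵢᵗ + (lam / m₁) (yᵢ - u(∑ⱼ αⱼᵗ Kᵢⱼ))`. -/
def iterate {m₁ : ℕ} (u : ℝ → ℝ) (lam : ℝ) (y : Fin m₁ → ℝ) (K : Fin m₁ → Fin m₁ → ℝ) :
    ℕ → Fin m₁ → ℝ
  | 0 => 0
  | t + 1 => fun i => iterate u lam y K t i +
      (lam / (m₁ : ℝ)) * (y i - u (∑ j, iterate u lam y K t j * K i j))

/-- The validation loss `(1 / m₂) ∑ᵢ (u(∑ⱼ αⱼ K'ᵢⱼ) - bᵢ)²`. -/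
def valLoss {m₁ m₂ : ℕ} (u : ℝ → ℝ) (b : Fin m₂ → ℝ) (K' : Fin m₂ → Fin m₁ → ℝ)
    (α : Fin m₁ → ℝ) : ℝ :=
  (1 / (m₂ : ℝ)) * ∑ i, (u (∑ j, α j * K' i j) - b i) ^ 2

/-- `t` is an admissible output index: among the `T` iterates `α⁰, …, αᵀ⁻¹`, for which the algorithm
defines hypotheses, it minimizes the validation loss (ties may be broken in any way). -/
def IsOutputIndex {m₁ m₂ : ℕ} (u : ℝ → ℝ) (lam : ℝ) (T : ℕ) (y : Fin m₁ → ℝ) (b : Fin m₂ → ℝ)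
    (K : Fin m₁ → Fin m₁ → ℝ) (K' : Fin m₂ → Fin m₁ → ℝ) (t : ℕ) : Prop :=
  t < T ∧ ∀ s < T, valLoss u b K' (iterate u lam y K t) ≤ valLoss u b K' (iterate u lam y K s)

/-- The hypothesis `h(x) = u(∑ᵢ αᵢ 𝒦_d(x, xᵢ))` described by `α`; it uses the exact kernel. -/
def hypothesis {n m₁ : ℕ} (d : ℕ) (u : ℝ → ℝ) (x : Fin m₁ → Vec n) (α : Fin m₁ → ℝ) :
    Vec n → ℝ :=
  fun a => u (∑ i, α i * mkernel d a (x i))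

/-! ### Inner product estimation by `ℓ₂`-sampling -/

/-- The law of one sample: an index `j` is drawn with probability `uⱼ² / ‖u‖₂²` and
`‖u‖₂² vⱼ / uⱼ` is returned (for `u = 0`, the value `0` is returned). -/
def l2SampleLaw {n : ℕ} (u v : Vec n) : Measure ℝ :=
  open scoped Classical in
  if u = 0 then Measure.dirac 0
  else ∑ j, ENNReal.ofReal (u j ^ 2 / ‖u‖ ^ 2) • Measure.dirac (‖u‖ ^ 2 * v j / u j)

/-- The (lower) median: the least `t` such that at least half of the values are at most `t`. -/
def median {k : ℕ} (f : Fin k → ℝ) : ℝ :=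
  sInf {t : ℝ | k ≤ 2 * (Finset.univ.filter fun a => f a ≤ t).card}

theorem measurable_median {k : ℕ} : Measurable (median : (Fin k → ℝ) → ℝ) := by
  rcases Nat.eq_zero_or_pos k with rfl | hk
  · exact measurable_of_finite _
  have key : ∀ (f : Fin k → ℝ) (c : ℝ), median f < c ↔
      ∃ q : ℚ, (q : ℝ) < c ∧ k ≤ 2 * ∑ a, if f a ≤ (q : ℝ) then 1 else 0 := by
    intro f c
    have hne : {t : ℝ | k ≤ 2 * (Finset.univ.filter fun a => f a ≤ t).card}.Nonempty := by
      refine ⟨∑ a, |f a|, ?_⟩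
      have : (Finset.univ.filter fun a => f a ≤ ∑ a, |f a|) = Finset.univ := by
        refine Finset.filter_true_of_mem fun a _ => (le_abs_self _).trans ?_
        exact Finset.single_le_sum (f := fun a => |f a|) (fun _ _ => abs_nonneg _)
          (Finset.mem_univ a)
      simp only [Set.mem_ofPred_eq, this, Finset.card_univ, Fintype.card_fin]
      omega
    have hbd : BddBelow {t : ℝ | k ≤ 2 * (Finset.univ.filter fun a => f a ≤ t).card} := by
      refine ⟨-∑ a, |f a|, fun t ht => ?_⟩
      have hpos : 0 < (Finset.univ.filter fun a => f a ≤ t).card := by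
        simp only [Set.mem_ofPred_eq] at ht
        omega
      obtain ⟨a, ha⟩ := Finset.card_pos.mp hpos
      have h1 := (Finset.mem_filter.mp ha).2
      have h2 := Finset.single_le_sum (f := fun a => |f a|) (fun _ _ => abs_nonneg _)
        (Finset.mem_univ a)
      have h3 := neg_abs_le (f a)
      linarith
    unfold median
    rw [csInf_lt_iff hbd hne]
    simp only [Finset.card_filter, Set.mem_ofPred_eq]
    constructor
    · rintro ⟨t, ht, htc⟩
      obtain ⟨q, hq1, hq2⟩ := exists_rat_btwn htc
      refine ⟨q, hq2, ht.trans (Nat.mul_le_mul_left 2 (Finset.sum_le_sum fun a _ => ?_))⟩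
      split_ifs with h1 h2
      · exact le_rfl
      · exact absurd (h1.trans hq1.le) h2
      · exact Nat.zero_le _
      · exact le_rfl
    · rintro ⟨q, hq, hk'⟩
      exact ⟨q, hk', hq⟩
  refine measurable_of_Iio fun c => ?_
  have : (median : (Fin k → ℝ) → ℝ) ⁻¹' Set.Iio c =
      ⋃ q : ℚ, {f | (q : ℝ) < c ∧ k ≤ 2 * ∑ a, if f a ≤ (q : ℝ) then 1 else 0} := by
    ext f
    simp [key]
  rw [this]
  refine MeasurableSet.iUnion fun q => MeasurableSet.inter (MeasurableSet.const _) ?_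
  refine measurableSet_le measurable_const (Measurable.const_mul ?_ 2)
  refine Finset.measurable_sum _ fun a _ => ?_
  exact Measurable.ite (measurableSet_le (measurable_pi_apply a) measurable_const)
    measurable_const measurable_const

/-- The law of the estimate of `u ⬝ v` to additive error `e` with failure probability `p`: the median
of `6 log(1/p)` independent means of `9 ‖u‖₂² ‖v‖₂² / (2 e²)` independent samples each (numbers of
samples rounded up). -/
def l2Estimate {n : ℕ} (e p : ℝ) (u v : Vec n) : Measure ℝ :=
  (Measure.pi fun _ : Fin ⌈6 * Real.log (1 / p)⌉₊ =>
    Measure.pi fun _ : Fin ⌈9 * ‖u‖ ^ 2 * ‖v‖ ^ 2 / (2 * e ^ 2)⌉₊ => l2SampleLaw u v).map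
  fun w => median fun a =>
    (∑ b, w a b) / (⌈9 * ‖u‖ ^ 2 * ‖v‖ ^ 2 / (2 * e ^ 2)⌉₊ : ℝ)

instance l2SampleLaw_isProbability {n : ℕ} (u v : Vec n) :
    IsProbabilityMeasure (l2SampleLaw u v) := by
  classical
  unfold l2SampleLaw
  split_ifs with h
  · infer_instance
  · constructor
    have hu : ‖u‖ ^ 2 ≠ 0 := by simpa using h
    simp only [Measure.coe_finsetSum, Finset.sum_apply, Measure.smul_apply, measure_univ,
      smul_eq_mul, mul_one]
    rw [← ENNReal.ofReal_sum_of_nonneg (fun _ _ => by positivity), ← Finset.sum_div,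
      ← EuclideanSpace.real_norm_sq_eq, div_self hu, ENNReal.ofReal_one]

instance l2Estimate_isProbability {n : ℕ} (e p : ℝ) (u v : Vec n) :
    IsProbabilityMeasure (l2Estimate e p u v) := by
  unfold l2Estimate
  refine Measure.isProbabilityMeasure_map (Measurable.aemeasurable ?_)
  refine measurable_median.comp (measurable_pi_lambda _ fun a => ?_)
  refine Measurable.div_const (Finset.measurable_sum _ fun b _ => ?_) _
  exact (measurable_pi_apply b).comp (measurable_pi_apply a)

/-- A randomized subroutine (given by the law of its output on each pair of inputs) that determines
inner products of vectors in the unit ball to additive error `e` with probability at least `1 - p`. -/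
structure IsInnerProductEstimator {n : ℕ} (e p : ℝ) (est : Vec n → Vec n → Measure ℝ) : Prop where
  isProbability : ∀ x y, IsProbabilityMeasure (est x y)
  measurable : Measurable fun q : Vec n × Vec n => est q.1 q.2
  accurate : ∀ x y, ‖x‖ ≤ 1 → ‖y‖ ≤ 1 →
    est x y {z | e < |z - inner ℝ x y|} ≤ ENNReal.ofReal p

/-! ### Alphatron with approximate pre-computation -/

/-- The probability of the event `bad`, over a training set `S ∼ D^{m₁}`, a validation set
`V ∼ D^{m₂}` drawn independently of it, and, given these, independent estimates `zᵢⱼ` of `xᵢ ⬝ xⱼ` and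
`z'ᵢⱼ` of `aᵢ ⬝ xⱼ` made by the subroutine `est`. -/
def runProb {n : ℕ} (D : Measure (Vec n × ℝ)) (m₁ m₂ : ℕ) (est : Vec n → Vec n → Measure ℝ)
    (bad : (Fin m₁ → Vec n × ℝ) → (Fin m₂ → Vec n × ℝ) →
      (Fin m₁ × Fin m₁ → ℝ) → (Fin m₂ × Fin m₁ → ℝ) → Prop) : ℝ≥0∞ :=
  ∫⁻ S, ∫⁻ V,
    ((Measure.pi fun q : Fin m₁ × Fin m₁ => est (S q.1).1 (S q.2).1).prod
      (Measure.pi fun q : Fin m₂ × Fin m₁ => est (V q.1).1 (S q.2).1))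
      {w | bad S V w.1 w.2}
    ∂(Measure.pi fun _ : Fin m₂ => D) ∂(Measure.pi fun _ : Fin m₁ => D)

/-- The event that the run with data `S`, `V` and inner product estimates `z`, `z'` has an admissible
output whose hypothesis has generalization error larger than `bound`. The matrices
`K̃ᵢⱼ = (1 / (d + 1)) ∑_{k ≤ d} zᵢⱼᵏ` and `K̃'ᵢⱼ = (1 / (d + 1)) ∑_{k ≤ d} (z'ᵢⱼ)ᵏ` are used in the
iteration and in the validation step. -/
def BadRun {n m₁ m₂ : ℕ} (D : Measure (Vec n × ℝ)) (d : ℕ) (u : ℝ → ℝ) (lam : ℝ) (T : ℕ)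
    (bound : ℝ) (S : Fin m₁ → Vec n × ℝ) (V : Fin m₂ → Vec n × ℝ)
    (z : Fin m₁ × Fin m₁ → ℝ) (z' : Fin m₂ × Fin m₁ → ℝ) : Prop :=
  ∃ t, IsOutputIndex u lam T (fun i => (S i).2) (fun i => (V i).2)
      (fun i j => kernelPoly d (z (i, j))) (fun i j => kernelPoly d (z' (i, j))) t ∧
    bound < genError D (hypothesis d u (fun i => (S i).1)
      (iterate u lam (fun i => (S i).2) (fun i j => kernelPoly d (z (i, j))) t))

end

end Alphatron

namespace Alphatron

/-! ### Uniform deviations of Lipschitz functions of linear functionals -/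

/-! Alphatron is a descent method for `w_t = ∑ᵢ αᵢᵗ ψ_d(xᵢ)` in feature space, with potential `‖w_t
- v‖²`. Write `f` for the regression function, `gᵢ` for the prediction actually computed at `xᵢ`,
and `E` for the average of `(f(xᵢ) - gᵢ)²`. The update splits into a signal `G` (average of `(f(xᵢ)
- gᵢ) ψ(xᵢ)`) and label noise `Δ` (average of `(yᵢ - f(xᵢ)) ψ(xᵢ)`). Since `u` is monotone and
`L`-Lipschitz, `L⟨w_t - v, G⟩ ≤ -E` up to error terms, while `‖G‖² ≤ E`; a step of length `1/L` thus
lowers the potential by `E / (2L²)` up to errors (`potential_step`). The potential starts at most at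
`B²` and cannot become negative, so one of the `T` iterates has small empirical error while still
within distance `B` of `v` (`exists_iterate_small_error`).

Kernel errors are treated as perturbations of the predictions, so the approximate run is never
compared with an exact run. Each `|αᵢᵗ|` is at most `tλ/m₁`, hence entrywise kernel error `εK` moves
a prediction by at most `εK T`.

Passing to the population error and bounding `Δ` both use `uniform_deviation`, a dimension-free
bound over a ball. Its uniformity permits weights that depend on the sample and on the estimates. It
is proved through exponential moments: symmetrization, contraction, and a Hilbert space `cosh`
inequality.

The average of `|ξ|` and the validation step need errors of order `log/m` rather than its square
root. These come from Bernstein-type bounds (`measure_avg_gt_le`,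
`measure_excess_loss_deviation_le`) in which the variance is controlled by the mean. Validation
hypotheses depend on the training data and the training estimates but not on the validation sample,
so Fubini and a union bound over `t < T` apply.

Training sample, validation sample and inner product estimates each contribute failure probability
`δ`. Parameter ranges where the claimed bound is at least `1`, or where `T = 1`, are settled
directly; elsewhere all lower-order terms are absorbed (`total_error_le`). -/

theorem pow_add_pow_le_of_add_eq {x y a b : ℝ} (hb : 0 ≤ b) (hxa : x ≤ a) (hya : y ≤ a)
    (h : x + y = a + b) (k : ℕ) : x ^ k + y ^ k ≤ a ^ k + b ^ k := by
  rcases eq_or_lt_of_le (show b ≤ a by linarith) with hab | hab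
  · obtain rfl : x = a := by linarith
    obtain rfl : y = b := by linarith
    rfl
  · have hconv := (convexOn_pow (𝕜 := ℝ) k).2
    have hd : 0 < a - b := sub_pos.2 hab
    have hs : (x - b) / (a - b) + (a - x) / (a - b) = 1 := by field_simp; ring
    have h1 := hconv (x := a) (y := b) (by simp; linarith) (by simpa using hb)
      (a := (x - b) / (a - b)) (b := (a - x) / (a - b))
      (div_nonneg (by linarith) hd.le) (div_nonneg (by linarith) hd.le) hs
    have h2 := hconv (x := a) (y := b) (by simp; linarith) (by simpa using hb)
      (a := (a - x) / (a - b)) (b := (x - b) / (a - b))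
      (div_nonneg (by linarith) hd.le) (div_nonneg (by linarith) hd.le) (by rw [add_comm, hs])
    have e1 : (x - b) / (a - b) * a + (a - x) / (a - b) * b = x := by
      field_simp; ring
    have e2 : (a - x) / (a - b) * a + (x - b) / (a - b) * b = y := by
      have : y = a + b - x := by linarith
      rw [this]; field_simp; ring
    simp only [smul_eq_mul] at h1 h2
    rw [e1] at h1
    rw [e2] at h2
    have e3 : ((x - b) / (a - b) * a ^ k + (a - x) / (a - b) * b ^ k) +
        ((a - x) / (a - b) * a ^ k + (x - b) / (a - b) * b ^ k) = a ^ k + b ^ k := by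
      have : ((x - b) / (a - b) * a ^ k + (a - x) / (a - b) * b ^ k) +
        ((a - x) / (a - b) * a ^ k + (x - b) / (a - b) * b ^ k) =
        ((x - b) / (a - b) + (a - x) / (a - b)) * (a ^ k + b ^ k) := by ring
      rw [this, hs, one_mul]
    linarith

/-- As a power series in the square of its argument, `cosh` has nonnegative coefficients, so
majorization of the squares can be used term by term. -/
theorem cosh_add_cosh_le_of_sq {p q a b : ℝ} (hp : p ^ 2 ≤ a ^ 2) (hq : q ^ 2 ≤ a ^ 2)
    (h : p ^ 2 + q ^ 2 = a ^ 2 + b ^ 2) :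
    Real.cosh p + Real.cosh q ≤ Real.cosh a + Real.cosh b := by
  refine hasSum_le (fun n => ?_) ((Real.hasSum_cosh p).add (Real.hasSum_cosh q))
    ((Real.hasSum_cosh a).add (Real.hasSum_cosh b))
  rw [← add_div, ← add_div, pow_mul, pow_mul, pow_mul, pow_mul]
  exact div_le_div_of_nonneg_right (pow_add_pow_le_of_add_eq (sq_nonneg b) hp hq h n)
    (Nat.cast_nonneg _)

/-- By the parallelogram law `‖a ± b‖²` have the same sum as `(‖a‖ ± ‖b‖)²`, and the latter pair is
more spread out. This replaces the addition formula for `cosh` on the line, and is what makes the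
deviation bound independent of dimension. -/
theorem cosh_norm_add_add_cosh_norm_sub_le {H : Type*} [NormedAddCommGroup H]
    [InnerProductSpace ℝ H] (r : ℝ) (a b : H) :
    Real.cosh (r * ‖a + b‖) + Real.cosh (r * ‖a - b‖) ≤
      2 * (Real.cosh (r * ‖a‖) * Real.cosh (r * ‖b‖)) := by
  have h1 : Real.cosh (r * (‖a‖ + ‖b‖)) + Real.cosh (r * (‖a‖ - ‖b‖)) =
      2 * (Real.cosh (r * ‖a‖) * Real.cosh (r * ‖b‖)) := by
    rw [mul_add, mul_sub, Real.cosh_add, Real.cosh_sub]; ring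
  rw [← h1]
  refine cosh_add_cosh_le_of_sq ?_ ?_ ?_
  · rw [mul_pow, mul_pow]
    gcongr
    exact norm_add_le a b
  · rw [mul_pow, mul_pow]
    gcongr
    exact norm_sub_le a b
  · have := parallelogram_law_with_norm ℝ a b
    simp only [mul_pow]
    nlinarith

/-! ### Contraction and symmetrization for exponential moments -/

theorem exp_add_exp_le_of_majorized {p q a b : ℝ} (ha : a ≤ max p q) (hb : b ≤ max p q)
    (h : a + b ≤ p + q) : Real.exp a + Real.exp b ≤ Real.exp p + Real.exp q := by
  wlog hpq : q ≤ p generalizing p q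
  · rw [add_comm (Real.exp p)]
    exact this (by rwa [max_comm]) (by rwa [max_comm]) (by linarith) (by linarith)
  rw [max_eq_left hpq] at ha hb
  rcases le_or_gt b q with hbq | hbq
  · exact add_le_add (Real.exp_le_exp.2 ha) (Real.exp_le_exp.2 hbq)
  have h1 : Real.exp a ≤ Real.exp (p + q - b) := Real.exp_le_exp.2 (by linarith)
  have h2 : Real.exp (p + q - b) = Real.exp p * Real.exp (q - b) := by
    rw [← Real.exp_add]; ring_nf
  have h3 : Real.exp q = Real.exp b * Real.exp (q - b) := by
    rw [← Real.exp_add]; ring_nf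
  have h4 : Real.exp (q - b) ≤ 1 := Real.exp_le_one_iff.2 (by linarith)
  have h5 : Real.exp b ≤ Real.exp p := Real.exp_le_exp.2 hb
  nlinarith

/-- The contraction principle for one random sign: `φ` is a contraction of `t` vanishing at `0`, and
`1`, `2` stand for the near-maximizers at the two signs. The exponents on the left are weakly
majorized by the two maxima on the right. -/
theorem exp_contraction {a₁ a₂ φ₁ φ₂ t₁ t₂ : ℝ} (h₁ : |φ₁| ≤ |t₁|) (h₂ : |φ₂| ≤ |t₂|)
    (h : |φ₁ - φ₂| ≤ |t₁ - t₂|) :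
    Real.exp (a₁ + φ₁) + Real.exp (a₂ - φ₂) ≤
      max (Real.exp (a₁ + t₁)) (Real.exp (a₂ + t₂)) +
        max (Real.exp (a₁ - t₁)) (Real.exp (a₂ - t₂)) := by
  rw [← Real.exp_monotone.map_max, ← Real.exp_monotone.map_max]
  have p1 := le_max_left (a₁ + t₁) (a₂ + t₂)
  have p2 := le_max_right (a₁ + t₁) (a₂ + t₂)
  have q1 := le_max_left (a₁ - t₁) (a₂ - t₂)
  have q2 := le_max_right (a₁ - t₁) (a₂ - t₂)
  set P := max (a₁ + t₁) (a₂ + t₂)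
  set Q := max (a₁ - t₁) (a₂ - t₂)
  have m1 := le_max_left P Q
  have m2 := le_max_right P Q
  rw [abs_le] at h₁ h₂ h
  refine exp_add_exp_le_of_majorized ?_ ?_ ?_
  · rcases abs_cases t₁ with ⟨e, _⟩ | ⟨e, _⟩ <;> rw [e] at h₁ <;> linarith
  · rcases abs_cases t₂ with ⟨e, _⟩ | ⟨e, _⟩ <;> rw [e] at h₂ <;> linarith
  · rcases abs_cases (t₁ - t₂) with ⟨e, _⟩ | ⟨e, _⟩ <;> rw [e] at h <;> linarith

theorem iSup_exp_contraction {ι : Type*} (a φ t : ι → ℝ) (h₁ : ∀ w, |φ w| ≤ |t w|)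
    (h₂ : ∀ w w', |φ w - φ w'| ≤ |t w - t w'|) :
    (⨆ w, ENNReal.ofReal (Real.exp (a w + φ w))) + (⨆ w, ENNReal.ofReal (Real.exp (a w - φ w))) ≤
      (⨆ w, ENNReal.ofReal (Real.exp (a w + t w))) +
        (⨆ w, ENNReal.ofReal (Real.exp (a w - t w))) := by
  rcases isEmpty_or_nonempty ι with hι | hι
  · simp
  refine ENNReal.iSup_add_iSup_le fun w w' => ?_
  rw [← ENNReal.ofReal_add (Real.exp_pos _).le (Real.exp_pos _).le]
  refine (ENNReal.ofReal_le_ofReal (exp_contraction (h₁ w) (h₁ w') (h₂ w w'))).trans ?_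
  rw [ENNReal.ofReal_add (by positivity) (by positivity)]
  refine add_le_add ?_ ?_
  · rw [ENNReal.ofReal_max]
    exact max_le (le_iSup (fun w => ENNReal.ofReal (Real.exp (a w + t w))) w)
      (le_iSup (fun w => ENNReal.ofReal (Real.exp (a w + t w))) w')
  · rw [ENNReal.ofReal_max]
    exact max_le (le_iSup (fun w => ENNReal.ofReal (Real.exp (a w - t w))) w)
      (le_iSup (fun w => ENNReal.ofReal (Real.exp (a w - t w))) w')

/-- Jensen's inequality, stated with `lintegral` so that integrability of `exp ∘ g` need not be
known. -/
theorem ofReal_exp_integral_le {X : Type*} [MeasurableSpace X] (μ : Measure X)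
    [IsProbabilityMeasure μ] {g : X → ℝ} (hg : Integrable g μ) :
    ENNReal.ofReal (Real.exp (∫ x, g x ∂μ)) ≤ ∫⁻ x, ENNReal.ofReal (Real.exp (g x)) ∂μ := by
  by_cases hi : Integrable (fun x => Real.exp (g x)) μ
  · rw [← ofReal_integral_eq_lintegral_ofReal hi (ae_of_all _ fun _ => (Real.exp_pos _).le)]
    refine ENNReal.ofReal_le_ofReal ?_
    exact convexOn_exp.map_integral_le Real.continuous_exp.continuousOn isClosed_univ
      (ae_of_all _ fun _ => Set.mem_univ _) hg hi
  · have : ∫⁻ x, ENNReal.ofReal (Real.exp (g x)) ∂μ = ∞ := by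
      by_contra h
      refine hi ⟨Real.continuous_exp.comp_aestronglyMeasurable hg.1, ?_⟩
      rw [hasFiniteIntegral_iff_ofReal (ae_of_all _ fun _ => (Real.exp_pos _).le)]
      exact lt_top_iff_ne_top.2 h
    rw [this]; exact le_top

/-- Jensen introduces an independent copy `y` of `x`. Convexity of `exp` then separates `F w y` from
`F w x` at the price of a factor `2`; since `x` and `y` have the same law, the two halves act as the
two values of a random sign, and contraction replaces `F` by `t` pointwise. -/
theorem lintegral_iSup_exp_symmetrization {X ι : Type*} [MeasurableSpace X] [Countable ι]
    (μ : Measure X) [IsProbabilityMeasure μ] (a : ι → ℝ) (F t : ι → X → ℝ)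
    (hF : ∀ w, Measurable (F w)) (hFi : ∀ w, Integrable (F w) μ)
    (h : ∀ᵐ x ∂μ, (∀ w, |F w x| ≤ |t w x|) ∧ ∀ w w', |F w x - F w' x| ≤ |t w x - t w' x|) :
    ∫⁻ x, ⨆ w, ENNReal.ofReal (Real.exp (a w + (∫ y, F w y ∂μ - F w x))) ∂μ ≤
      ∫⁻ x, (2⁻¹ * (⨆ w, ENNReal.ofReal (Real.exp (a w + 2 * t w x))) +
        2⁻¹ * (⨆ w, ENNReal.ofReal (Real.exp (a w - 2 * t w x)))) ∂μ := by
  have mp : ∀ G : ι → X → ℝ, (∀ w, Measurable (G w)) →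
      Measurable fun x => ⨆ w, ENNReal.ofReal (Real.exp (a w + 2 * G w x)) := fun G hG =>
    Measurable.iSup fun w => (Real.measurable_exp.comp
      (((hG w).const_mul 2).const_add (a w))).ennreal_ofReal
  calc ∫⁻ x, ⨆ w, ENNReal.ofReal (Real.exp (a w + (∫ y, F w y ∂μ - F w x))) ∂μ
      ≤ ∫⁻ x, ∫⁻ y, ⨆ w, ENNReal.ofReal (Real.exp (a w + (F w y - F w x))) ∂μ ∂μ := by
        refine lintegral_mono fun x => iSup_le fun w => ?_
        have e : a w + (∫ y, F w y ∂μ - F w x) = ∫ y, (a w + (F w y - F w x)) ∂μ := by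
          have e1 := integral_add (integrable_const (μ := μ) (a w))
            ((hFi w).sub (integrable_const (F w x)))
          have e2 := integral_sub (hFi w) (integrable_const (μ := μ) (F w x))
          simp only [Pi.sub_apply, integral_const, probReal_univ, smul_eq_mul, one_mul] at e1 e2
          rw [e1, e2]
        rw [e]
        refine (ofReal_exp_integral_le μ
          ((integrable_const _).add ((hFi w).sub (integrable_const _)))).trans ?_
        exact lintegral_mono fun y =>
          le_iSup (fun w => ENNReal.ofReal (Real.exp (a w + (F w y - F w x)))) w
    _ ≤ ∫⁻ x, ∫⁻ y, (2⁻¹ * (⨆ w, ENNReal.ofReal (Real.exp (a w + 2 * F w y))) +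
          2⁻¹ * (⨆ w, ENNReal.ofReal (Real.exp (a w - 2 * F w x)))) ∂μ ∂μ := by
        refine lintegral_mono fun x => lintegral_mono fun y => iSup_le fun w => ?_
        have hr : Real.exp (a w + (F w y - F w x)) ≤ 2⁻¹ * Real.exp (a w + 2 * F w y) +
            2⁻¹ * Real.exp (a w - 2 * F w x) := by
          have hc := convexOn_exp.2
          have := hc (Set.mem_univ (a w + 2 * F w y))
            (Set.mem_univ (a w - 2 * F w x)) (a := (2⁻¹ : ℝ)) (b := (2⁻¹ : ℝ))
            (by norm_num) (by norm_num) (by norm_num)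
          simp only [smul_eq_mul] at this
          refine le_trans (le_of_eq ?_) this
          congr 1; ring
        refine (ENNReal.ofReal_le_ofReal hr).trans ?_
        rw [ENNReal.ofReal_add (by positivity) (by positivity),
          ENNReal.ofReal_mul (by norm_num), ENNReal.ofReal_mul (by norm_num)]
        have e2 : ENNReal.ofReal (2⁻¹ : ℝ) = 2⁻¹ := by
          rw [ENNReal.ofReal_inv_of_pos (by norm_num)]; simp
        rw [e2]
        gcongr
        · exact le_iSup (fun w => ENNReal.ofReal (Real.exp (a w + 2 * F w y))) w
        · exact le_iSup (fun w => ENNReal.ofReal (Real.exp (a w - 2 * F w x))) w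
    _ = ∫⁻ x, 2⁻¹ * ((⨆ w, ENNReal.ofReal (Real.exp (a w + 2 * F w x))) +
          (⨆ w, ENNReal.ofReal (Real.exp (a w - 2 * F w x)))) ∂μ := by
        simp_rw [lintegral_add_right _ measurable_const, lintegral_const, measure_univ, mul_one,
          mul_add]
        rw [lintegral_add_left measurable_const, lintegral_const, measure_univ, mul_one,
          lintegral_add_left ((mp F hF).const_mul _)]
    _ ≤ ∫⁻ x, (2⁻¹ * (⨆ w, ENNReal.ofReal (Real.exp (a w + 2 * t w x))) +
        2⁻¹ * (⨆ w, ENNReal.ofReal (Real.exp (a w - 2 * t w x)))) ∂μ := by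
        refine lintegral_mono_ae ?_
        filter_upwards [h] with x hx
        rw [← mul_add]
        gcongr 2⁻¹ * ?_
        refine iSup_exp_contraction a (fun w => 2 * F w x) (fun w => 2 * t w x) (fun w => ?_)
          fun w w' => ?_
        · rw [abs_mul, abs_mul]
          exact mul_le_mul_of_nonneg_left (hx.1 w) (abs_nonneg _)
        · rw [← mul_sub, ← mul_sub, abs_mul, abs_mul]
          exact mul_le_mul_of_nonneg_left (hx.2 w w') (abs_nonneg _)

theorem avg_cosh_le {H : Type*} [NormedAddCommGroup H] [InnerProductSpace ℝ H] {R β : ℝ} {v : H}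
    (hv : ‖v‖ ≤ β) (b : H) (m : ℕ) (hR : 0 ≤ R) :
    2⁻¹ * ENNReal.ofReal (2 * Real.cosh (R * ‖b + (2 : ℝ) • v‖) * Real.cosh (2 * R * β) ^ m) +
      2⁻¹ * ENNReal.ofReal (2 * Real.cosh (R * ‖b + (-2 : ℝ) • v‖) * Real.cosh (2 * R * β) ^ m) ≤
      ENNReal.ofReal (2 * Real.cosh (R * ‖b‖) * Real.cosh (2 * R * β) ^ (m + 1)) := by
  have e2 : (2⁻¹ : ℝ≥0∞) = ENNReal.ofReal (2⁻¹ : ℝ) := by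
    rw [ENNReal.ofReal_inv_of_pos (by norm_num)]; simp
  have hc := fun r => (Real.cosh_pos r).le
  have hc1 := Real.cosh_pos (2 * R * β)
  rw [e2, ← ENNReal.ofReal_mul (by norm_num), ← ENNReal.ofReal_mul (by norm_num),
    ← ENNReal.ofReal_add (by have := hc (R * ‖b + (2 : ℝ) • v‖); positivity)
      (by have := hc (R * ‖b + (-2 : ℝ) • v‖); positivity)]
  refine ENNReal.ofReal_le_ofReal ?_
  have h1 := cosh_norm_add_add_cosh_norm_sub_le R b ((2 : ℝ) • v)
  have h2 : Real.cosh (R * ‖(2 : ℝ) • v‖) ≤ Real.cosh (2 * R * β) := by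
    refine Real.cosh_le_cosh.2 ?_
    rw [norm_smul, Real.norm_ofNat, abs_of_nonneg (by positivity)]
    refine le_trans ?_ (le_abs_self _)
    nlinarith [norm_nonneg (v)]
  have h3 : b + (-2 : ℝ) • v = b - (2 : ℝ) • v := by rw [neg_smul, sub_eq_add_neg]
  rw [h3]
  have h4 : Real.cosh (R * ‖b‖) * Real.cosh (R * ‖(2 : ℝ) • v‖) ≤
    Real.cosh (R * ‖b‖) * Real.cosh (2 * R * β) := mul_le_mul_of_nonneg_left h2 (hc _)
  have h5 := mul_le_mul_of_nonneg_right (h1.trans (mul_le_mul_of_nonneg_left h4 zero_le_two))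
    (pow_nonneg hc1.le m)
  rw [pow_succ]
  linarith


/-- Induction on the sample size, symmetrizing one point at a time. The offset `b` makes this
possible: once a point has been symmetrized and contracted it contributes the linear term `±2⟨W w, ψ
x⟩`, which is absorbed into `b`; `avg_cosh_le` averages over the sign. -/
theorem lintegral_iSup_exp_deviation_le {X H ι : Type*} [MeasurableSpace X]
    [NormedAddCommGroup H] [InnerProductSpace ℝ H] [MeasurableSpace H] [BorelSpace H]
    [SecondCountableTopology H] [Countable ι] (μ : Measure X) [IsProbabilityMeasure μ]
    {R β : ℝ} (W : ι → H) (hW : ∀ w, ‖W w‖ ≤ R) (hR : 0 ≤ R) (ψ : X → H) (hψ : Measurable ψ)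
    (hψβ : ∀ᵐ x ∂μ, ‖ψ x‖ ≤ β) (F : ι → X → ℝ) (hF : ∀ w, Measurable (F w))
    (hFi : ∀ w, Integrable (F w) μ)
    (h : ∀ᵐ x ∂μ, (∀ w, |F w x| ≤ |inner ℝ (W w) (ψ x)|) ∧
      ∀ w w', |F w x - F w' x| ≤ |inner ℝ (W w) (ψ x) - inner ℝ (W w') (ψ x)|)
    (m : ℕ) (b : H) :
    ∫⁻ S, ⨆ w, ENNReal.ofReal (Real.exp (inner ℝ (W w) b + ∑ i, (∫ y, F w y ∂μ - F w (S i))))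
        ∂(Measure.pi fun _ : Fin m => μ) ≤
      ENNReal.ofReal (2 * Real.cosh (R * ‖b‖) * Real.cosh (2 * R * β) ^ m) := by
  induction m generalizing b with
  | zero =>
    have hle : ∀ w, ENNReal.ofReal (Real.exp (inner ℝ (W w) b)) ≤
        ENNReal.ofReal (2 * Real.cosh (R * ‖b‖)) := fun w => by
      refine ENNReal.ofReal_le_ofReal ?_
      have h1 : inner ℝ (W w) b ≤ R * ‖b‖ :=
        (real_inner_le_norm _ _).trans (mul_le_mul_of_nonneg_right (hW w) (norm_nonneg _))
      have h2 := Real.exp_le_exp.2 h1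
      rw [Real.cosh_eq]
      have := Real.exp_pos (-(R * ‖b‖))
      linarith
    simp only [Finset.univ_eq_empty, Finset.sum_empty, add_zero, pow_zero, mul_one,
      lintegral_const, measure_univ]
    exact iSup_le hle
  | succ m ih =>
    have mS : ∀ w, Measurable fun S : Fin m → X => ∑ i, (∫ y, F w y ∂μ - F w (S i)) := fun w =>
      Finset.measurable_sum _ fun i _ => ((hF w).comp (measurable_pi_apply i)).const_sub _
    have mψ : ∀ (w : ι) (c : ℝ), Measurable fun p : (Fin m → X) × X =>
        (inner ℝ (W w) b + ∑ i, (∫ y, F w y ∂μ - F w (p.1 i))) + c * inner ℝ (W w) (ψ p.2) := by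
      intro w c
      refine (((mS w).comp measurable_fst).const_add _).add ?_
      exact (measurable_const.inner (hψ.comp measurable_snd)).const_mul c
    have mc : ∀ c : ℝ, Measurable fun p : (Fin m → X) × X => ⨆ w, ENNReal.ofReal (Real.exp
        ((inner ℝ (W w) b + ∑ i, (∫ y, F w y ∂μ - F w (p.1 i))) +
          c * inner ℝ (W w) (ψ p.2))) := fun c =>
      Measurable.iSup fun w => (Real.measurable_exp.comp (mψ w c)).ennreal_ofReal
    have m1 : ∀ (x : X) (c : ℝ), Measurable fun S : Fin m → X => ⨆ w, ENNReal.ofReal (Real.exp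
        ((inner ℝ (W w) b + ∑ i, (∫ y, F w y ∂μ - F w (S i))) +
          c * inner ℝ (W w) (ψ x))) := by
      intro x c
      refine Measurable.iSup fun w => (Real.measurable_exp.comp ?_).ennreal_ofReal
      exact ((mS w).const_add _).add_const _
    set P := Measure.pi fun _ : Fin m => μ with hP
    have key : ∀ x c, (∫⁻ S, ⨆ w, ENNReal.ofReal (Real.exp ((inner ℝ (W w) b +
          ∑ i, (∫ y, F w y ∂μ - F w (S i))) + c * inner ℝ (W w) (ψ x))) ∂P) ≤
        ENNReal.ofReal (2 * Real.cosh (R * ‖b + c • ψ x‖) * Real.cosh (2 * R * β) ^ m) := by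
      intro x c
      refine le_trans (le_of_eq ?_) (ih (b + c • ψ x))
      refine lintegral_congr fun S => iSup_congr fun w => ?_
      rw [inner_add_right, inner_smul_right]
      congr 2; ring
    have hmp := measurePreserving_piFinSuccAbove (fun _ : Fin (m + 1) => μ) 0
    calc ∫⁻ S, ⨆ w, ENNReal.ofReal (Real.exp (inner ℝ (W w) b +
            ∑ i, (∫ y, F w y ∂μ - F w (S i)))) ∂(Measure.pi fun _ : Fin (m + 1) => μ)
        = ∫⁻ p, ⨆ w, ENNReal.ofReal (Real.exp ((inner ℝ (W w) b +
            ∑ i, (∫ y, F w y ∂μ - F w (p.2 i))) + (∫ y, F w y ∂μ - F w p.1))) ∂(μ.prod P) := by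
          have hp : μ.prod P = (μ.prod (Measure.pi fun _ : Fin m => μ)) := rfl
          rw [hp, ← hmp.lintegral_comp_emb (MeasurableEquiv.measurableEmbedding _)]
          refine lintegral_congr fun S => iSup_congr fun w => ?_
          congr 2
          rw [Fin.sum_univ_succ]
          simp [MeasurableEquiv.piFinSuccAbove, Fin.insertNthEquiv, Fin.tail]
          ring
      _ = ∫⁻ S, ∫⁻ x, ⨆ w, ENNReal.ofReal (Real.exp ((inner ℝ (W w) b +
            ∑ i, (∫ y, F w y ∂μ - F w (S i))) + (∫ y, F w y ∂μ - F w x))) ∂μ ∂P := by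
          rw [lintegral_prod_symm]
          refine Measurable.aemeasurable (Measurable.iSup fun w =>
            (Real.measurable_exp.comp ?_).ennreal_ofReal)
          exact (((mS w).comp measurable_snd).const_add _).add
            (((hF w).comp measurable_fst).const_sub _)
      _ ≤ ∫⁻ S, ∫⁻ x, (2⁻¹ * (⨆ w, ENNReal.ofReal (Real.exp ((inner ℝ (W w) b +
            ∑ i, (∫ y, F w y ∂μ - F w (S i))) + 2 * inner ℝ (W w) (ψ x)))) +
          2⁻¹ * (⨆ w, ENNReal.ofReal (Real.exp ((inner ℝ (W w) b +
            ∑ i, (∫ y, F w y ∂μ - F w (S i))) - 2 * inner ℝ (W w) (ψ x))))) ∂μ ∂P :=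
          lintegral_mono fun S => lintegral_iSup_exp_symmetrization μ _ F
            (fun w x => inner ℝ (W w) (ψ x)) hF hFi h
      _ = ∫⁻ x, ∫⁻ S, (2⁻¹ * (⨆ w, ENNReal.ofReal (Real.exp ((inner ℝ (W w) b +
            ∑ i, (∫ y, F w y ∂μ - F w (S i))) + 2 * inner ℝ (W w) (ψ x)))) +
          2⁻¹ * (⨆ w, ENNReal.ofReal (Real.exp ((inner ℝ (W w) b +
            ∑ i, (∫ y, F w y ∂μ - F w (S i))) + (-2) * inner ℝ (W w) (ψ x))))) ∂P ∂μ := by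
          have e : ∀ (S : Fin m → X) (x : X) (w : ι), (inner ℝ (W w) b +
              ∑ i, (∫ y, F w y ∂μ - F w (S i))) - 2 * inner ℝ (W w) (ψ x) = (inner ℝ (W w) b +
              ∑ i, (∫ y, F w y ∂μ - F w (S i))) + (-2) * inner ℝ (W w) (ψ x) :=
            fun S x w => by ring
          simp only [e]
          have hm := ((mc 2).const_mul 2⁻¹).add ((mc (-2)).const_mul 2⁻¹)
          exact lintegral_lintegral_swap hm.aemeasurable
      _ ≤ ∫⁻ x, ENNReal.ofReal
            (2 * Real.cosh (R * ‖b‖) * Real.cosh (2 * R * β) ^ (m + 1)) ∂μ := by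
          refine lintegral_mono_ae ?_
          filter_upwards [hψβ] with x hx
          have e := lintegral_add_left (μ := P) ((m1 x 2).const_mul 2⁻¹) fun S => 2⁻¹ * ⨆ w,
            ENNReal.ofReal (Real.exp ((inner ℝ (W w) b + ∑ i, (∫ y, F w y ∂μ - F w (S i))) +
              (-2) * inner ℝ (W w) (ψ x)))
          rw [lintegral_const_mul _ (m1 x 2), lintegral_const_mul _ (m1 x (-2))] at e
          refine e.le.trans ?_
          refine le_trans ?_ (avg_cosh_le hx b m hR)
          exact add_le_add (mul_le_mul' le_rfl (key x 2)) (mul_le_mul' le_rfl (key x (-2)))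
      _ = ENNReal.ofReal (2 * Real.cosh (R * ‖b‖) * Real.cosh (2 * R * β) ^ (m + 1)) := by simp

theorem ae_pi_forall {X ι : Type*} [MeasurableSpace X] [Fintype ι] (μ : Measure X)
    [IsProbabilityMeasure μ] {p : X → Prop} (h : ∀ᵐ x ∂μ, p x) :
    ∀ᵐ S ∂(Measure.pi fun _ : ι => μ), ∀ i, p (S i) :=
  ae_all_iff.2 fun i => (Measure.quasiMeasurePreserving_eval (fun _ : ι => μ) i).ae h

theorem uniform_deviation {X H : Type*} [MeasurableSpace X]
    [NormedAddCommGroup H] [InnerProductSpace ℝ H] [MeasurableSpace H] [BorelSpace H]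
    [SecondCountableTopology H] (μ : Measure X) [IsProbabilityMeasure μ]
    {ψ : X → H} (hψ : Measurable ψ) (hψ1 : ∀ᵐ x ∂μ, ‖ψ x‖ ≤ 1) {φ : X → ℝ → ℝ}
    (hφ : ∀ w, Measurable fun x => φ x (inner ℝ w (ψ x))) {R K δ : ℝ} (hR : 0 < R) (hK : 0 < K)
    (hδ : 0 < δ) (hδ1 : δ ≤ 1)
    (hφK : ∀ᵐ x ∂μ, φ x 0 = 0 ∧ ∀ r r', |φ x r - φ x r'| ≤ K * |r - r'|) {m : ℕ} (hm : 1 ≤ m) :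
    (Measure.pi fun _ : Fin m => μ) {S | ∃ w : H, ‖w‖ ≤ R ∧
      R * K * √(8 * Real.log (2 / δ) / m) < ∫ x, φ x (inner ℝ w (ψ x)) ∂μ -
        (1 / (m : ℝ)) * ∑ i, φ (S i) (inner ℝ w (ψ (S i)))} ≤ ENNReal.ofReal δ := by
  have hm0 : (0 : ℝ) < m := by exact_mod_cast hm
  set ℓ := Real.log (2 / δ) with hℓ
  have hℓ0 : 0 < ℓ := Real.log_pos (by rw [lt_div_iff₀ hδ]; linarith)
  set τ := R * K * √(8 * ℓ / m) with hτ
  have hτ2 : τ ^ 2 = R ^ 2 * K ^ 2 * (8 * ℓ / m) := by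
    rw [hτ, mul_pow, mul_pow, Real.sq_sqrt (by positivity)]
  have hτ0 : 0 < τ := by positivity
  -- The minimizer of the Chernoff exponent `2 m R² K² s² - s m τ`, which arises from `cosh x ≤ exp
  -- (x² / 2)`.
  set s := τ / (4 * R ^ 2 * K ^ 2) with hs
  have hs0 : 0 < s := by positivity
  have hlip : ∀ᵐ x ∂μ, ∀ w w' : H,
      |φ x (inner ℝ w (ψ x)) - φ x (inner ℝ w' (ψ x))| ≤ K * ‖w - w'‖ := by
    filter_upwards [hψ1, hφK] with x h1 h2 w w'
    refine (h2.2 _ _).trans (mul_le_mul_of_nonneg_left ?_ hK.le)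
    rw [← inner_sub_left]
    refine (abs_real_inner_le_norm _ _).trans ?_
    exact mul_le_of_le_one_right (norm_nonneg _) h1
  have hint : ∀ w : H, Integrable (fun x => φ x (inner ℝ w (ψ x))) μ := by
    intro w
    refine Integrable.of_bound (hφ w).aestronglyMeasurable (K * ‖w‖) ?_
    filter_upwards [hlip, hφK] with x h1 h2
    have := h1 w 0
    rwa [inner_zero_left, h2.1, sub_zero, sub_zero] at this
  have : Nonempty (Metric.closedBall (0 : H) R) := ⟨⟨0, by simp [hR.le]⟩⟩
  -- A dense sequence in the ball makes the supremum countable, hence measurable. Deviations are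
  -- continuous in the weight, so any violation already occurs at some `W k`.
  set W : ℕ → H := fun k => (TopologicalSpace.denseSeq (Metric.closedBall (0 : H) R) k : H)
  have hW : ∀ k, ‖W k‖ ≤ R := fun k => by
    exact mem_closedBall_zero_iff.1 (TopologicalSpace.denseSeq (Metric.closedBall (0 : H) R) k).2
  set F : ℕ → X → ℝ := fun k x => s * φ x (inner ℝ (W k) (ψ x))
  have hF : ∀ k, Measurable (F k) := fun k => (hφ (W k)).const_mul s
  have main := lintegral_iSup_exp_deviation_le μ (β := s * K) W hW hR.le
    (fun x => (s * K) • ψ x) (hψ.const_smul _)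
    (by
      filter_upwards [hψ1] with x h1
      rw [norm_smul, Real.norm_of_nonneg (by positivity)]
      exact mul_le_of_le_one_right (by positivity) h1)
    F hF (fun k => (hint (W k)).const_mul s)
    (by
      filter_upwards [hφK] with x h2
      refine ⟨fun k => ?_, fun k k' => ?_⟩
      · have := h2.2 (inner ℝ (W k) (ψ x)) 0
        rw [h2.1, sub_zero, sub_zero] at this
        simp only [F]
        rw [inner_smul_right, abs_mul, abs_mul, abs_of_pos hs0, abs_of_pos (mul_pos hs0 hK),
          mul_assoc]
        exact mul_le_mul_of_nonneg_left this hs0.le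
      · have := h2.2 (inner ℝ (W k) (ψ x)) (inner ℝ (W k') (ψ x))
        simp only [F]
        rw [inner_smul_right, inner_smul_right, ← mul_sub, ← mul_sub, abs_mul, abs_mul,
          abs_of_pos hs0, abs_of_pos (mul_pos hs0 hK), mul_assoc]
        exact mul_le_mul_of_nonneg_left this hs0.le) m 0
  simp only [inner_zero_right, zero_add, norm_zero, mul_zero, Real.cosh_zero, mul_one] at main
  set G : (Fin m → X) → ℝ≥0∞ := fun S =>
    ⨆ k, ENNReal.ofReal (Real.exp (∑ i, (∫ y, F k y ∂μ - F k (S i)))) with hG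
  have hGm : Measurable G := Measurable.iSup fun k => (Real.measurable_exp.comp
    (Finset.measurable_sum _ fun i _ =>
      ((hF k).comp (measurable_pi_apply i)).const_sub _)).ennreal_ofReal
  have hsub : (Measure.pi fun _ : Fin m => μ) {S | ∃ w : H, ‖w‖ ≤ R ∧
      τ < ∫ x, φ x (inner ℝ w (ψ x)) ∂μ - (1 / (m : ℝ)) * ∑ i, φ (S i) (inner ℝ w (ψ (S i)))} ≤
      (Measure.pi fun _ : Fin m => μ) {S | ENNReal.ofReal (Real.exp (s * m * τ)) ≤ G S} := by
    refine measure_mono_ae ?_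
    filter_upwards [ae_pi_forall (ι := Fin m) μ hlip] with S hS
    rintro ⟨w, hw, hwτ⟩
    set g : H → ℝ := fun w =>
      ∫ x, φ x (inner ℝ w (ψ x)) ∂μ - (1 / (m : ℝ)) * ∑ i, φ (S i) (inner ℝ w (ψ (S i))) with hg
    have hg1 : Continuous fun w : H => ∫ x, φ x (inner ℝ w (ψ x)) ∂μ := by
      refine (LipschitzWith.of_dist_le_mul (K := ⟨K, hK.le⟩) fun w w' => ?_).continuous
      rw [Real.dist_eq, dist_eq_norm, ← integral_sub (hint w) (hint w')]
      have := norm_integral_le_of_norm_le_const (μ := μ)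
        (f := fun x => φ x (inner ℝ w (ψ x)) - φ x (inner ℝ w' (ψ x))) (C := K * ‖w - w'‖)
        (by filter_upwards [hlip] with x h1 using h1 w w')
      rw [probReal_univ, mul_one] at this
      exact this
    have hg2 : ∀ i, Continuous fun w : H => φ (S i) (inner ℝ w (ψ (S i))) := fun i => by
      refine (LipschitzWith.of_dist_le_mul (K := ⟨K, hK.le⟩) fun w w' => ?_).continuous
      rw [Real.dist_eq, dist_eq_norm]
      exact hS i w w'
    have hgc : Continuous g :=
      hg1.sub (continuous_const.mul (continuous_finsetSum _ fun i _ => hg2 i))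
    have hopen : IsOpen {w' : Metric.closedBall (0 : H) R | τ < g w'} :=
      isOpen_lt continuous_const (hgc.comp continuous_subtype_val)
    obtain ⟨k, hk⟩ := (TopologicalSpace.denseRange_denseSeq
      (Metric.closedBall (0 : H) R)).exists_mem_open hopen ⟨⟨w, by simpa using hw⟩, hwτ⟩
    change ENNReal.ofReal (Real.exp (s * m * τ)) ≤ G S
    refine le_trans (ENNReal.ofReal_le_ofReal (Real.exp_le_exp.2 ?_))
      (le_iSup (fun k => ENNReal.ofReal (Real.exp (∑ i, (∫ y, F k y ∂μ - F k (S i))))) k)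
    have e : ∑ i, (∫ y, F k y ∂μ - F k (S i)) = s * m * g (W k) := by
      rw [Finset.sum_sub_distrib, hg]
      simp only [F, integral_const_mul, Finset.sum_const, Finset.card_univ, Fintype.card_fin,
        nsmul_eq_mul, ← Finset.mul_sum]
      field_simp
    rw [e]
    exact mul_le_mul_of_nonneg_left (le_of_lt hk) (by positivity)
  refine hsub.trans ?_
  have hmk := mul_meas_ge_le_lintegral (μ := Measure.pi fun _ : Fin m => μ) hGm
    (ENNReal.ofReal (Real.exp (s * m * τ)))
  have hexp := Real.exp_pos (s * m * τ)
  have h1 : (Measure.pi fun _ : Fin m => μ) {S | ENNReal.ofReal (Real.exp (s * m * τ)) ≤ G S} ≤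
      ENNReal.ofReal (2 * Real.cosh (2 * R * (s * K)) ^ m) /
        ENNReal.ofReal (Real.exp (s * m * τ)) := by
    rw [ENNReal.le_div_iff_mul_le (Or.inl (by simpa using hexp)) (Or.inl ENNReal.ofReal_ne_top),
      mul_comm]
    exact hmk.trans main
  refine h1.trans ?_
  rw [← ENNReal.ofReal_div_of_pos hexp]
  refine ENNReal.ofReal_le_ofReal ?_
  rw [div_le_iff₀ hexp]
  have h2 : Real.cosh (2 * R * (s * K)) ^ m ≤ Real.exp (ℓ) := by
    refine (pow_le_pow_left₀ (Real.cosh_pos _).le (Real.cosh_le_exp_half_sq _) m).trans ?_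
    rw [← Real.exp_nat_mul]
    refine Real.exp_le_exp.2 (le_of_eq ?_)
    have : (m : ℝ) * ((2 * R * (s * K)) ^ 2 / 2) = m * τ ^ 2 / (8 * R ^ 2 * K ^ 2) := by
      rw [hs]; field_simp; ring
    rw [this, hτ2]; field_simp
  -- The moment costs `2 exp ℓ` and the threshold gains `exp (2ℓ)`; the quotient is `2 exp (-ℓ) =
  -- δ`.
  have h3 : s * m * τ = ℓ + ℓ := by
    have : s * m * τ = m * τ ^ 2 / (4 * R ^ 2 * K ^ 2) := by rw [hs]; field_simp
    rw [this, hτ2]; field_simp; ring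
  have h4 : Real.exp ℓ = 2 / δ := Real.exp_log (by positivity)
  rw [h3, Real.exp_add]
  have h5 : δ * (Real.exp ℓ * Real.exp ℓ) = 2 * Real.exp ℓ := by
    rw [h4]; field_simp
  rw [h5]
  linarith

/-! ### Relative deviations of averages -/

/-- From `exp x ≤ 1 + x + x²` on `[-1, 1]`. Keeping the second moment, instead of bounding it by
`1`, is what yields relative deviations. -/
theorem integral_exp_mul_le {Ω : Type*} [MeasurableSpace Ω] (μ : Measure Ω)
    [IsProbabilityMeasure μ] {Z : Ω → ℝ} (hZ : Measurable Z) (hZ1 : ∀ᵐ x ∂μ, |Z x| ≤ 1) {c : ℝ}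
    (hc : |c| ≤ 1) :
    Integrable (fun x => Real.exp (c * Z x)) μ ∧
      ∫ x, Real.exp (c * Z x) ∂μ ≤ Real.exp (c * ∫ x, Z x ∂μ + c ^ 2 * ∫ x, Z x ^ 2 ∂μ) := by
  have hcZ : ∀ᵐ x ∂μ, |c * Z x| ≤ 1 := by
    filter_upwards [hZ1] with x hx
    rw [abs_mul]
    exact mul_le_one₀ hc (abs_nonneg _) hx
  have i1 : Integrable (fun x => Real.exp (c * Z x)) μ := by
    refine Integrable.of_bound (Real.measurable_exp.comp (hZ.const_mul c)).aestronglyMeasurable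
      (Real.exp 1) ?_
    filter_upwards [hcZ] with x hx
    rw [Real.norm_of_nonneg (Real.exp_pos _).le]
    exact Real.exp_le_exp.2 ((le_abs_self _).trans hx)
  have i2 : Integrable Z μ := Integrable.of_bound hZ.aestronglyMeasurable 1 hZ1
  have i3 : Integrable (fun x => Z x ^ 2) μ := by
    refine Integrable.of_bound (hZ.pow_const 2).aestronglyMeasurable 1 ?_
    filter_upwards [hZ1] with x hx
    rw [norm_pow]
    exact pow_le_one₀ (norm_nonneg _) hx
  refine ⟨i1, ?_⟩
  have h1 : ∫ x, Real.exp (c * Z x) ∂μ ≤ ∫ x, (1 + (c * Z x + c ^ 2 * Z x ^ 2)) ∂μ := by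
    refine integral_mono_ae i1 ((integrable_const _).add ((i2.const_mul c).add
      (i3.const_mul (c ^ 2)))) ?_
    filter_upwards [hcZ] with x hx
    have := (abs_le.1 (Real.abs_exp_sub_one_sub_id_le hx)).2
    have e : (c * Z x) ^ 2 = c ^ 2 * Z x ^ 2 := by ring
    rw [e] at this
    linarith
  have e1 := integral_add (integrable_const (μ := μ) (1 : ℝ))
    ((i2.const_mul c).add (i3.const_mul (c ^ 2)))
  have e2 := integral_add (i2.const_mul c) (i3.const_mul (c ^ 2))
  simp only [Pi.add_apply, integral_const, probReal_univ, smul_eq_mul, one_mul,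
    integral_const_mul] at e1 e2
  rw [e1, e2] at h1
  have := Real.add_one_le_exp (c * ∫ x, Z x ∂μ + c ^ 2 * ∫ x, Z x ^ 2 ∂μ)
  linarith

theorem measure_sum_ge_le {Ω : Type*} [MeasurableSpace Ω] (μ : Measure Ω)
    [IsProbabilityMeasure μ] {Z : Ω → ℝ} (hZ : Measurable Z) (hZ1 : ∀ᵐ x ∂μ, |Z x| ≤ 1) {c δ : ℝ}
    (hc : |c| ≤ 1) (hδ : 0 < δ) (m : ℕ) :
    (Measure.pi fun _ : Fin m => μ) {S | m * (c * ∫ x, Z x ∂μ + c ^ 2 * ∫ x, Z x ^ 2 ∂μ) +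
      Real.log (1 / δ) ≤ c * ∑ i, Z (S i)} ≤ ENNReal.ofReal δ := by
  obtain ⟨i1, h1⟩ := integral_exp_mul_le μ hZ hZ1 hc
  set a := c * ∫ x, Z x ∂μ + c ^ 2 * ∫ x, Z x ^ 2 ∂μ
  set P := Measure.pi fun _ : Fin m => μ
  have e : ∀ S : Fin m → Ω, Real.exp (c * ∑ i, Z (S i)) = ∏ i, Real.exp (c * Z (S i)) := by
    intro S
    rw [Finset.mul_sum, Real.exp_sum]
  have i2 : Integrable (fun S : Fin m → Ω => Real.exp (c * ∑ i, Z (S i))) P := by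
    simp_rw [e]
    exact Integrable.fintype_prod (f := fun _ x => Real.exp (c * Z x)) fun _ => i1
  have h2 : ∫ S, Real.exp (c * ∑ i, Z (S i)) ∂P ≤ Real.exp (m * a) := by
    simp_rw [e]
    rw [integral_fintype_prod_eq_pow (ι := Fin m) (fun x => Real.exp (c * Z x)), Fintype.card_fin,
      Real.exp_nat_mul]
    exact pow_le_pow_left₀ (integral_nonneg fun _ => (Real.exp_pos _).le) h1 m
  have h3 := mul_meas_ge_le_integral_of_nonneg (ae_of_all _ fun _ => (Real.exp_pos _).le) i2
    (Real.exp (m * a + Real.log (1 / δ)))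
  rw [← ENNReal.ofReal_toReal (measure_ne_top P _)]
  refine ENNReal.ofReal_le_ofReal ?_
  have e3 : {S : Fin m → Ω | Real.exp (m * a + Real.log (1 / δ)) ≤
      Real.exp (c * ∑ i, Z (S i))} =
      {S | m * a + Real.log (1 / δ) ≤ c * ∑ i, Z (S i)} := by
    ext S; simp
  rw [e3, Real.exp_add, Real.exp_log (by positivity)] at h3
  have h4 := h3.trans h2
  have hp := Real.exp_pos (m * a)
  rw [mul_assoc] at h4
  have h5 : 1 / δ * P.real {S | m * a + Real.log (1 / δ) ≤ c * ∑ i, Z (S i)} ≤ 1 := by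
    by_contra hcon
    nlinarith [not_le.1 hcon]
  have h6 : ∀ q : ℝ, 1 / δ * q ≤ 1 → q ≤ δ := fun q hq => by
    rwa [one_div, inv_mul_le_iff₀ hδ, mul_one] at hq
  exact h6 _ h5

theorem measure_avg_gt_le {Ω : Type*} [MeasurableSpace Ω] (μ : Measure Ω)
    [IsProbabilityMeasure μ] {Z : Ω → ℝ} (hZ : Measurable Z)
    (hZ1 : ∀ᵐ x ∂μ, Z x ∈ Set.Icc (0 : ℝ) 1) {δ : ℝ} (hδ : 0 < δ) {m : ℕ} (hm : 1 ≤ m) :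
    (Measure.pi fun _ : Fin m => μ) {S | 2 * ∫ x, Z x ∂μ + Real.log (1 / δ) / m <
      (1 / (m : ℝ)) * ∑ i, Z (S i)} ≤ ENNReal.ofReal δ := by
  have hm0 : (0 : ℝ) < m := by exact_mod_cast hm
  have hZa : ∀ᵐ x ∂μ, |Z x| ≤ 1 := by
    filter_upwards [hZ1] with x hx
    rw [abs_of_nonneg hx.1]; exact hx.2
  refine le_trans (measure_mono fun S hS => ?_)
    (measure_sum_ge_le μ hZ hZa (c := 1) (by simp) hδ m)
  have h2 : ∫ x, Z x ^ 2 ∂μ ≤ ∫ x, Z x ∂μ := by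
    refine integral_mono_of_nonneg (ae_of_all _ fun _ => sq_nonneg _)
      (Integrable.of_bound hZ.aestronglyMeasurable 1 hZa) ?_
    filter_upwards [hZ1] with x hx
    have := hx.1; have := hx.2
    change Z x ^ 2 ≤ Z x
    nlinarith
  simp only [Set.mem_ofPred_eq, one_div, inv_mul_eq_div, lt_div_iff₀ hm0] at hS ⊢
  have e : (2 * ∫ x, Z x ∂μ + Real.log δ⁻¹ / m) * m = 2 * m * ∫ x, Z x ∂μ + Real.log δ⁻¹ := by
    field_simp
  rw [e] at hS
  nlinarith

/-- Two-sided relative deviation bounds for the excess square loss of `h` over the regression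
function `f`. -/
theorem measure_excess_loss_deviation_le {Ω : Type*} [MeasurableSpace Ω] (μ : Measure Ω)
    [IsProbabilityMeasure μ] {h f y : Ω → ℝ} (hh : Measurable h) (hf : Measurable f)
    (hy : Measurable y) (hh1 : ∀ᵐ x ∂μ, h x ∈ Set.Icc (0 : ℝ) 1)
    (hf1 : ∀ᵐ x ∂μ, f x ∈ Set.Icc (0 : ℝ) 1) (hy1 : ∀ᵐ x ∂μ, y x ∈ Set.Icc (0 : ℝ) 1)
    (horth : ∫ x, (h x - f x) * (y x - f x) ∂μ = 0) {δ : ℝ} (hδ : 0 < δ) {m : ℕ} (hm : 1 ≤ m) :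
    (Measure.pi fun _ : Fin m => μ) {S |
      2 * ((1 / (m : ℝ)) * ∑ i, ((h (S i) - y (S i)) ^ 2 - (f (S i) - y (S i)) ^ 2)) +
        16 * Real.log (1 / δ) / m < ∫ x, (h x - f x) ^ 2 ∂μ ∨
      2 * ∫ x, (h x - f x) ^ 2 ∂μ + 8 * Real.log (1 / δ) / m <
        (1 / (m : ℝ)) * ∑ i, ((h (S i) - y (S i)) ^ 2 - (f (S i) - y (S i)) ^ 2)} ≤
      ENNReal.ofReal (2 * δ) := by
  have hm0 : (0 : ℝ) < m := by exact_mod_cast hm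
  set Z : Ω → ℝ := fun x => (h x - y x) ^ 2 - (f x - y x) ^ 2 with hZdef
  have hZ : Measurable Z := ((hh.sub hy).pow_const 2).sub ((hf.sub hy).pow_const 2)
  have hZ1 : ∀ᵐ x ∂μ, |Z x| ≤ 1 := by
    filter_upwards [hh1, hf1, hy1] with x h1 h2 h3
    rw [abs_le]
    obtain ⟨a1, a2⟩ := h1
    obtain ⟨b1, b2⟩ := h2
    obtain ⟨c1, c2⟩ := h3
    constructor <;> simp only [Z] <;> nlinarith [sq_nonneg (h x - y x), sq_nonneg (f x - y x)]
  have hd : ∀ᵐ x ∂μ, |h x - f x| ≤ 1 := by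
    filter_upwards [hh1, hf1] with x h1 h2
    rw [abs_le]
    constructor <;> linarith [h1.1, h1.2, h2.1, h2.2]
  have i1 : Integrable (fun x => (h x - f x) ^ 2) μ := by
    refine Integrable.of_bound ((hh.sub hf).pow_const 2).aestronglyMeasurable 1 ?_
    filter_upwards [hd] with x hx
    rw [norm_pow]
    exact pow_le_one₀ (norm_nonneg _) hx
  have i2 : Integrable (fun x => (h x - f x) * (y x - f x)) μ := by
    refine Integrable.of_bound ((hh.sub hf).mul (hy.sub hf)).aestronglyMeasurable 1 ?_
    filter_upwards [hd, hf1, hy1] with x hx h2 h3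
    rw [norm_mul]
    refine mul_le_one₀ hx (norm_nonneg _) ?_
    rw [Real.norm_eq_abs, abs_le]
    constructor <;> linarith [h3.1, h3.2, h2.1, h2.2]
  -- Orthogonality removes the cross term. With the next bound this is the Bernstein condition: the
  -- second moment of the excess loss is at most four times its mean.
  have eZ : ∫ x, Z x ∂μ = ∫ x, (h x - f x) ^ 2 ∂μ := by
    have e : ∀ x, Z x = (h x - f x) ^ 2 - 2 * ((h x - f x) * (y x - f x)) := fun x => by
      simp only [Z]; ring
    simp_rw [e]
    rw [integral_sub i1 (i2.const_mul 2), integral_const_mul, horth, mul_zero, sub_zero]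
  have eZ2 : ∫ x, Z x ^ 2 ∂μ ≤ 4 * ∫ x, (h x - f x) ^ 2 ∂μ := by
    rw [← integral_const_mul]
    refine integral_mono_of_nonneg (ae_of_all _ fun _ => sq_nonneg _) (i1.const_mul 4) ?_
    filter_upwards [hh1, hf1, hy1] with x h1 h2 h3
    have e : Z x ^ 2 = (h x + f x - 2 * y x) ^ 2 * (h x - f x) ^ 2 := by simp only [Z]; ring
    change Z x ^ 2 ≤ 4 * (h x - f x) ^ 2
    rw [e]
    refine mul_le_mul_of_nonneg_right ?_ (sq_nonneg _)
    have : |h x + f x - 2 * y x| ≤ 2 := by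
      rw [abs_le]
      constructor <;> linarith [h1.1, h1.2, h3.1, h3.2, h2.1, h2.2]
    have := sq_le_sq' (abs_le.1 this).1 (abs_le.1 this).2
    linarith
  rw [Set.ofPred_or, two_mul δ, ENNReal.ofReal_add hδ.le hδ.le]
  refine (measure_union_le _ _).trans (add_le_add ?_ ?_)
  -- With `c = ±1/8` the quadratic term is at most `4V/64 = V/16`, half of the linear term `V/8`.
  -- The exponents become `-V/16` and `3V/16`, hence the factors `2` in the two bounds.
  · refine le_trans (measure_mono fun S hS => ?_)
      (measure_sum_ge_le μ hZ hZ1 (c := -1 / 8) (by rw [abs_le]; norm_num) hδ m)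
    simp only [Set.mem_ofPred_eq] at hS ⊢
    rw [eZ]
    set V := ∫ x, (h x - f x) ^ 2 ∂μ
    have e : (2 * (1 / (m : ℝ) * ∑ i, Z (S i)) + 16 * Real.log (1 / δ) / m) * m =
      2 * ∑ i, Z (S i) + 16 * Real.log (1 / δ) := by field_simp
    have h1 := mul_lt_mul_of_pos_right hS hm0
    rw [e] at h1
    nlinarith
  · refine le_trans (measure_mono fun S hS => ?_)
      (measure_sum_ge_le μ hZ hZ1 (c := 1 / 8) (by rw [abs_le]; norm_num) hδ m)
    simp only [Set.mem_ofPred_eq] at hS ⊢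
    rw [eZ]
    have hV : 0 ≤ ∫ x, (h x - f x) ^ 2 ∂μ := integral_nonneg fun _ => sq_nonneg _
    set V := ∫ x, (h x - f x) ^ 2 ∂μ
    have e : (2 * V + 8 * Real.log (1 / δ) / m) * m = 2 * V * m + 8 * Real.log (1 / δ) := by
      field_simp
    have e' : (1 / (m : ℝ) * ∑ i, Z (S i)) * m = ∑ i, Z (S i) := by field_simp
    have h1 := mul_lt_mul_of_pos_right hS hm0
    rw [e, e'] at h1
    nlinarith

/-! ### Accuracy of the `ℓ₂`-sampling estimator -/

theorem integral_l2SampleLaw {n : ℕ} {u : Vec n} (hu : u ≠ 0) (v : Vec n) (g : ℝ → ℝ) :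
    Integrable g (l2SampleLaw u v) ∧
      ∫ x, g x ∂(l2SampleLaw u v) = ∑ j, u j ^ 2 / ‖u‖ ^ 2 * g (‖u‖ ^ 2 * v j / u j) := by
  have hi : ∀ j, Integrable g (ENNReal.ofReal (u j ^ 2 / ‖u‖ ^ 2) •
      Measure.dirac (‖u‖ ^ 2 * v j / u j)) := fun j =>
    (integrable_dirac (by simp)).smul_measure ENNReal.ofReal_ne_top
  unfold l2SampleLaw
  rw [if_neg hu]
  refine ⟨integrable_finsetSum_measure.2 fun j _ => hi j, ?_⟩
  rw [integral_finsetSum_measure fun j _ => hi j]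
  refine Finset.sum_congr rfl fun j _ => ?_
  rw [integral_smul_measure, integral_dirac, ENNReal.toReal_ofReal (by positivity), smul_eq_mul]

theorem integral_id_l2SampleLaw {n : ℕ} {u : Vec n} (hu : u ≠ 0) (v : Vec n) :
    ∫ x, x ∂(l2SampleLaw u v) = inner ℝ u v := by
  have hu2 : ‖u‖ ^ 2 ≠ 0 := by simpa using hu
  rw [(integral_l2SampleLaw hu v fun x => x).2, PiLp.inner_apply]
  refine Finset.sum_congr rfl fun j _ => ?_
  by_cases hj : u j = 0
  · simp [hj]
  · simp only [RCLike.inner_apply, conj_trivial]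
    field_simp

/-- Each coordinate with `u j ≠ 0` contributes exactly `‖u‖² (v j)²`; those with `u j = 0` are never
drawn, whence only an inequality. -/
theorem integral_sq_l2SampleLaw_le {n : ℕ} {u : Vec n} (hu : u ≠ 0) (v : Vec n) :
    ∫ x, x ^ 2 ∂(l2SampleLaw u v) ≤ ‖u‖ ^ 2 * ‖v‖ ^ 2 := by
  have hu2 : ‖u‖ ^ 2 ≠ 0 := by simpa using hu
  rw [(integral_l2SampleLaw hu v fun x => x ^ 2).2, EuclideanSpace.real_norm_sq_eq v,
    Finset.mul_sum]
  refine Finset.sum_le_sum fun j _ => ?_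
  by_cases hj : u j = 0
  · simp only [hj, div_zero]
    simp only [ne_eq, OfNat.ofNat_ne_zero, not_false_eq_true, zero_pow, zero_div, mul_zero]
    positivity
  · refine le_of_eq ?_
    field_simp

theorem memLp_id_l2SampleLaw {n : ℕ} {u : Vec n} (hu : u ≠ 0) (v : Vec n) :
    MemLp (fun x : ℝ => x) 2 (l2SampleLaw u v) :=
  (memLp_two_iff_integrable_sq measurable_id.aestronglyMeasurable).2
    (integral_l2SampleLaw hu v fun x => x ^ 2).1

theorem measure_mean_deviation_le (Q : Measure ℝ) [IsProbabilityMeasure Q]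
    (hQ : MemLp (fun x : ℝ => x) 2 Q) {N : ℕ} (hN : 0 < N) {e : ℝ} (he : 0 < e) :
    (Measure.pi fun _ : Fin N => Q) {w | e < |(∑ b, w b) / (N : ℝ) - ∫ x, x ∂Q|} ≤
      ENNReal.ofReal (variance (fun x => x) Q / (N * e ^ 2)) := by
  have hN0 : (0 : ℝ) < N := by exact_mod_cast hN
  set P := Measure.pi fun _ : Fin N => Q
  have hev : ∀ b : Fin N, MemLp (fun w : Fin N → ℝ => w b) 2 P := fun b =>
    hQ.comp_measurePreserving (measurePreserving_eval (fun _ : Fin N => Q) b)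
  have hX : MemLp (∑ b : Fin N, fun w : Fin N → ℝ => w b) 2 P := memLp_finsetSum' _ fun b _ => hev b
  have hmean : ∫ w, (∑ b : Fin N, fun w : Fin N → ℝ => w b) w ∂P = N * ∫ x, x ∂Q := by
    simp only [Finset.sum_apply]
    rw [integral_finsetSum _ fun b _ => (hev b).integrable (by norm_num)]
    have : ∀ b : Fin N, ∫ w : Fin N → ℝ, w b ∂P = ∫ x, x ∂Q := fun b => by
      have h := measurePreserving_eval (fun _ : Fin N => Q) b
      conv_rhs => rw [← h.map_eq]
      exact (integral_map h.measurable.aemeasurable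
        (f := fun x : ℝ => x) measurable_id.aestronglyMeasurable).symm
    simp [this]
  have hvar := variance_sum_pi (μ := fun _ : Fin N => Q) (X := fun _ x => x) fun _ => hQ
  have hch := meas_ge_le_variance_div_sq hX (c := N * e) (by positivity)
  rw [hvar, hmean] at hch
  refine (measure_mono fun w hw => ?_).trans (hch.trans (ENNReal.ofReal_le_ofReal (le_of_eq ?_)))
  · simp only [Set.mem_ofPred_eq, Finset.sum_apply] at hw ⊢
    have : (∑ b, w b) - N * ∫ x, x ∂Q = N * ((∑ b, w b) / (N : ℝ) - ∫ x, x ∂Q) := by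
      field_simp
    rw [this, abs_mul, abs_of_pos hN0]
    exact mul_le_mul_of_nonneg_left hw.le hN0.le
  · simp
    field_simp

theorem abs_median_sub_le {k : ℕ} {f : Fin k → ℝ} {c e : ℝ}
    (h : 2 * (Finset.univ.filter fun a => e < |f a - c|).card < k) : |median f - c| ≤ e := by
  set A := Finset.univ.filter fun a => e < |f a - c| with hA
  have hlow : ∀ t ∈ {t : ℝ | k ≤ 2 * (Finset.univ.filter fun a => f a ≤ t).card}, c - e ≤ t := by
    intro t ht
    by_contra hlt
    have hsub : (Finset.univ.filter fun a => f a ≤ t) ⊆ A := by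
      intro a ha
      rw [Finset.mem_filter] at ha
      rw [hA, Finset.mem_filter]
      refine ⟨ha.1, lt_abs.2 (Or.inr ?_)⟩
      linarith [ha.2]
    have := Finset.card_le_card hsub
    simp only [Set.mem_ofPred_eq] at ht
    omega
  have hmem : c + e ∈ {t : ℝ | k ≤ 2 * (Finset.univ.filter fun a => f a ≤ t).card} := by
    have hsub : Aᶜ ⊆ Finset.univ.filter fun a => f a ≤ c + e := by
      intro a ha
      rw [hA, Finset.mem_compl, Finset.mem_filter, not_and, not_lt] at ha
      have := (abs_le.1 (ha (Finset.mem_univ a))).2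
      rw [Finset.mem_filter]
      exact ⟨Finset.mem_univ a, by linarith⟩
    have h1 := Finset.card_le_card hsub
    rw [Finset.card_compl, Fintype.card_fin] at h1
    simp only [Set.mem_ofPred_eq]
    omega
  have h1 : median f ≤ c + e := csInf_le ⟨c - e, hlow⟩ hmem
  have h2 : c - e ≤ median f := le_csInf ⟨_, hmem⟩ hlow
  rw [abs_le]
  constructor <;> linarith

/-- A Chernoff bound for the number of bad means: the median can fail only if at least half of the
means fail. -/
theorem measure_half_le_card_le {Y : Type*} [MeasurableSpace Y] (Q : Measure Y)
    [IsProbabilityMeasure Q] {E : Set Y} (hE : MeasurableSet E) (hQ : Q.real E ≤ 2 / 9) {p : ℝ}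
    (hp : 0 < p) {k : ℕ} (hk : 6 * Real.log (1 / p) ≤ k) :
    (Measure.pi fun _ : Fin k => Q)
      {w | k ≤ 2 * (open scoped Classical in Finset.univ.filter fun a => w a ∈ E).card} ≤
      ENNReal.ofReal p := by
  classical
  -- Each bad mean gets weight `r² = (7/9)/(2/9)`, the optimal choice for failure probability `2/9`.
  -- Its expected weight is `1 + (5/2)(2/9) = 14/9`, against a threshold of `r` per mean.
  set r : ℝ := √(7 / 2) with hr
  have hr0 : 0 < r := by positivity
  have hr2 : r ^ 2 = 7 / 2 := Real.sq_sqrt (by norm_num)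
  have hr1 : 1 ≤ r := by rw [hr, Real.one_le_sqrt]; norm_num
  set g : Y → ℝ := fun y => 1 + E.indicator (fun _ => (5 / 2 : ℝ)) y with hg
  have hi0 : Integrable (E.indicator fun _ => (5 / 2 : ℝ)) Q := (integrable_const _).indicator hE
  have hgi : Integrable g Q := (integrable_const _).add hi0
  have hgE : ∫ y, g y ∂Q ≤ 14 / 9 := by
    have := integral_add (integrable_const (μ := Q) (1 : ℝ)) hi0
    rw [integral_indicator_const _ hE] at this
    simp only [integral_const, probReal_univ, smul_eq_mul, one_mul] at this
    rw [hg, this]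
    linarith
  have hg0 : ∀ y, 0 ≤ g y := fun y =>
    add_nonneg zero_le_one (Set.indicator_nonneg (fun _ _ => by norm_num) y)
  have hg1 : ∀ y, g y = if y ∈ E then r ^ 2 else 1 := fun y => by
    by_cases hy : y ∈ E <;> simp [hg, hy, hr2]
    norm_num
  set P := Measure.pi fun _ : Fin k => Q
  have hPi : Integrable (fun w : Fin k → Y => ∏ a, g (w a)) P :=
    Integrable.fintype_prod (f := fun _ => g) fun _ => hgi
  have hPE : ∫ w, ∏ a, g (w a) ∂P ≤ (14 / 9) ^ k := by
    rw [integral_fintype_prod_eq_pow (ι := Fin k) g, Fintype.card_fin]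
    exact pow_le_pow_left₀ (integral_nonneg hg0) hgE k
  have hmk := mul_meas_ge_le_integral_of_nonneg
    (ae_of_all P fun w => Finset.prod_nonneg fun a _ => hg0 (w a)) hPi (r ^ k)
  have hsub : {w : Fin k → Y | k ≤ 2 * (Finset.univ.filter fun a => w a ∈ E).card} ⊆
      {w | r ^ k ≤ ∏ a, g (w a)} := by
    intro w hw
    simp only [Set.mem_ofPred_eq] at hw ⊢
    have : ∏ a, g (w a) = r ^ (2 * (Finset.univ.filter fun a => w a ∈ E).card) := by
      simp_rw [hg1]
      rw [Finset.prod_ite, Finset.prod_const, Finset.prod_const_one, mul_one, pow_mul]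
    rw [this]
    exact pow_le_pow_right₀ hr1 hw
  refine (measure_mono hsub).trans ?_
  rw [← ENNReal.ofReal_toReal (measure_ne_top P _)]
  refine ENNReal.ofReal_le_ofReal ?_
  change P.real _ ≤ p
  have h1 : P.real {w | r ^ k ≤ ∏ a, g (w a)} ≤ (14 / 9 / r) ^ k := by
    rw [div_pow (14 / 9 : ℝ), le_div_iff₀ (by positivity), mul_comm]
    exact hmk.trans hPE
  have h2 : 14 / 9 / r ≤ Real.exp (-(1 / 6)) := by
    refine le_of_pow_le_pow_left₀ (n := 6) (by norm_num) (Real.exp_pos _).le ?_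
    have e1 : (14 / 9 / r) ^ 6 = (56 / 81) ^ 3 := by
      have : (14 / 9 / r) ^ 6 = ((14 / 9) ^ 2 / r ^ 2) ^ 3 := by ring
      rw [this, hr2]; norm_num
    rw [e1, ← Real.exp_nat_mul]
    have e2 : ((6 : ℕ) : ℝ) * -(1 / 6) = -1 := by norm_num
    rw [e2, Real.exp_neg]
    have := Real.exp_one_lt_d9
    rw [le_inv_comm₀ (by norm_num) (Real.exp_pos _)]
    norm_num at this ⊢
    linarith
  refine h1.trans ((pow_le_pow_left₀ (by positivity) h2 k).trans ?_)
  rw [← Real.exp_nat_mul, ← Real.le_log_iff_exp_le hp]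
  rw [one_div, Real.log_inv] at hk
  linarith

theorem l2Estimate_accurate {n : ℕ} {e p : ℝ} (he : 0 < e) (hp : 0 < p) (hp1 : p < 1)
    (u v : Vec n) : l2Estimate e p u v {z | e < |z - inner ℝ u v|} ≤ ENNReal.ofReal p := by
  classical
  set N := ⌈9 * ‖u‖ ^ 2 * ‖v‖ ^ 2 / (2 * e ^ 2)⌉₊ with hN
  set k := ⌈6 * Real.log (1 / p)⌉₊ with hk
  have hlog : 0 < Real.log (1 / p) := Real.log_pos (by rw [lt_div_iff₀ hp]; linarith)
  have hk0 : 0 < k := Nat.ceil_pos.2 (by positivity)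
  set Q := Measure.pi fun _ : Fin N => l2SampleLaw u v
  set E : Set (Fin N → ℝ) := {w | e < |(∑ b, w b) / (N : ℝ) - inner ℝ u v|} with hE
  have hmean : Measurable fun w : Fin N → ℝ => (∑ b, w b) / (N : ℝ) :=
    (Finset.measurable_sum _ fun b _ => measurable_pi_apply b).div_const _
  have hEm : MeasurableSet E :=
    measurableSet_lt measurable_const (hmean.sub_const _).abs
  have hQE : Q E ≤ ENNReal.ofReal (2 / 9) := by
    -- If either vector vanishes there are no samples; the mean is then `0 / 0 = 0`, which is the
    -- exact inner product.
    rcases eq_or_ne (‖u‖ ^ 2 * ‖v‖ ^ 2) 0 with h0 | h0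
    · have hi : inner ℝ u v = 0 := by
        rcases mul_eq_zero.1 h0 with h | h
        · have : u = 0 := by simpa using h
          rw [this, inner_zero_left]
        · have : v = 0 := by simpa using h
          rw [this, inner_zero_right]
      have hN0 : N = 0 := by rw [hN, mul_assoc, h0]; simp
      have : E = ∅ := by
        ext w
        simp [hE, hi, hN0, he.le]
      rw [this, measure_empty]; exact zero_le
    · have hpos : 0 < ‖u‖ ^ 2 * ‖v‖ ^ 2 := lt_of_le_of_ne (by positivity) h0.symm
      have hu : u ≠ 0 := by rintro rfl; simp at h0
      have hN0 : 0 < N := Nat.ceil_pos.2 (by rw [mul_assoc]; positivity)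
      have hm := measure_mean_deviation_le (l2SampleLaw u v) (memLp_id_l2SampleLaw hu v) hN0 he
      rw [integral_id_l2SampleLaw hu v] at hm
      refine hm.trans (ENNReal.ofReal_le_ofReal ?_)
      have hN' : (0 : ℝ) < N := by exact_mod_cast hN0
      have hv : variance (fun x => x) (l2SampleLaw u v) ≤ ‖u‖ ^ 2 * ‖v‖ ^ 2 :=
        (variance_le_expectation_sq measurable_id.aestronglyMeasurable).trans
          (integral_sq_l2SampleLaw_le hu v)
      have hNge : 9 * ‖u‖ ^ 2 * ‖v‖ ^ 2 / (2 * e ^ 2) ≤ N := Nat.le_ceil _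
      rw [div_le_iff₀ (by positivity)] at hNge
      rw [div_le_iff₀ (by positivity)]
      linarith
  have hQr : Q.real E ≤ 2 / 9 := ENNReal.toReal_le_of_le_ofReal (by norm_num) hQE
  have hmed : Measurable fun w : Fin k → Fin N → ℝ => median fun a => (∑ b, w a b) / (N : ℝ) :=
    measurable_median.comp (measurable_pi_lambda _ fun a => hmean.comp (measurable_pi_apply a))
  have hset : MeasurableSet {z : ℝ | e < |z - inner ℝ u v|} :=
    measurableSet_lt measurable_const (measurable_id.sub_const _).abs
  unfold l2Estimate
  rw [Measure.map_apply hmed hset]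
  refine (measure_mono fun w hw => ?_).trans
    (measure_half_le_card_le Q hEm hQr hp (k := k) (Nat.le_ceil _))
  simp only [Set.mem_ofPred_eq]
  by_contra hcon
  rw [not_le] at hcon
  have : |median (fun a => (∑ b, w a b) / (N : ℝ)) - inner ℝ u v| ≤ e := by
    refine abs_median_sub_le ?_
    refine lt_of_eq_of_lt ?_ hcon
    congr!
  exact absurd hw (not_lt.2 this)

/-! ### Features, kernels and iterates -/

theorem measurable_feature {n : ℕ} (d : ℕ) : Measurable (feature d : Vec n → Feat n d) := by
  have : Continuous (feature d : Vec n → Feat n d) := by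
    unfold feature
    refine (PiLp.continuous_toLp 2 _).comp (continuous_pi fun k => ?_)
    fun_prop
  exact this.measurable

theorem norm_feature_le {n : ℕ} (d : ℕ) {x : Vec n} (hx : ‖x‖ ≤ 1) : ‖feature d x‖ ≤ 1 := by
  have h1 : ‖feature d x‖ ^ 2 = kernelPoly d (‖x‖ ^ 2) := by
    rw [← real_inner_self_eq_norm_sq, ← real_inner_self_eq_norm_sq]
    exact mkernel_eq d x x
  have h2 : kernelPoly d (‖x‖ ^ 2) ≤ 1 := by
    unfold kernelPoly
    have : ∑ k ∈ Finset.range (d + 1), (‖x‖ ^ 2) ^ k ≤ ∑ k ∈ Finset.range (d + 1), (1 : ℝ) :=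
      Finset.sum_le_sum fun k _ => pow_le_one₀ (by positivity) (pow_le_one₀ (norm_nonneg x) hx)
    simp only [Finset.sum_const, Finset.card_range, nsmul_eq_mul, mul_one] at this
    push_cast at this
    rw [one_div, inv_mul_le_iff₀ (by positivity), mul_one]
    exact this
  rw [← h1] at h2
  exact (sq_le_one_iff₀ (norm_nonneg _)).1 h2

theorem abs_kernelPoly_sub_le {d : ℕ} (hd : 1 ≤ d) {εK z w : ℝ} (hε : 0 < εK) (hε1 : εK ≤ 1)
    (hw : |w| ≤ 1) (h : |z - w| ≤ εK / (3 * d)) : |kernelPoly d z - kernelPoly d w| ≤ εK := by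
  have hd0 : (0 : ℝ) < d := by exact_mod_cast hd
  set e := εK / (3 * d) with he
  have he0 : 0 < e := by positivity
  have hde : d * e = εK / 3 := by rw [he]; field_simp
  have hz : |z| ≤ 1 + e := by
    have := abs_add_le (z - w) w
    rw [sub_add_cancel] at this
    linarith
  have hpow : ∀ k ∈ Finset.range (d + 1), |z ^ k - w ^ k| ≤ εK := by
    intro k hk
    rw [Finset.mem_range, Nat.lt_succ_iff] at hk
    have hkd : (k : ℝ) ≤ d := by exact_mod_cast hk
    have h1 := abs_pow_sub_pow_le z w k
    -- Since `1 + e ≤ exp e` and `d e = εK / 3`, powers up to `d` stay below `exp 1`; this `3`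
    -- cancels the one in `e = εK / (3d)`.
    have h2 : max |z| |w| ^ (k - 1) ≤ 3 := by
      have hmx : max |z| |w| ≤ Real.exp e := by
        have := Real.add_one_le_exp e
        refine max_le (by linarith) (by linarith)
      calc max |z| |w| ^ (k - 1) ≤ Real.exp e ^ (k - 1) :=
            pow_le_pow_left₀ (le_max_of_le_left (abs_nonneg _)) hmx _
        _ ≤ Real.exp e ^ d := pow_le_pow_right₀ (Real.one_le_exp he0.le) (by omega)
        _ = Real.exp (εK / 3) := by rw [← Real.exp_nat_mul, hde]
        _ ≤ Real.exp 1 := Real.exp_le_exp.2 (by linarith)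
        _ ≤ 3 := by linarith [Real.exp_one_lt_d9]
    have h3 : |z - w| * k ≤ εK / 3 := by
      rw [← hde, mul_comm (d : ℝ)]
      exact mul_le_mul h hkd (Nat.cast_nonneg _) he0.le
    have h4 : |z - w| * k * max |z| |w| ^ (k - 1) ≤ εK / 3 * 3 :=
      mul_le_mul h3 h2 (by positivity) (by positivity)
    linarith
  unfold kernelPoly
  rw [← mul_sub, ← Finset.sum_sub_distrib, abs_mul, abs_of_pos (by positivity), one_div,
    inv_mul_le_iff₀ (by positivity)]
  refine (Finset.abs_sum_le_sum_abs _ _).trans ((Finset.sum_le_sum hpow).trans (le_of_eq ?_))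
  simp

/-- Labels and predictions lie in `[0, 1]`, so a step moves each coordinate by at most `lam / m`,
whatever matrix `K` is used. -/
theorem abs_iterate_le {m : ℕ} {u : ℝ → ℝ} (hu : ∀ s, u s ∈ Set.Icc (0 : ℝ) 1) {lam : ℝ}
    (hlam : 0 ≤ lam) {y : Fin m → ℝ} (hy : ∀ i, y i ∈ Set.Icc (0 : ℝ) 1)
    (K : Fin m → Fin m → ℝ) (t : ℕ) (i : Fin m) :
    |iterate u lam y K t i| ≤ t * (lam / m) := by
  induction t with
  | zero => simp [iterate]
  | succ t ih =>
    simp only [iterate]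
    refine (abs_add_le _ _).trans ?_
    have h1 : |y i - u (∑ j, iterate u lam y K t j * K i j)| ≤ 1 := by
      have h2 := hu (∑ j, iterate u lam y K t j * K i j)
      have h3 := hy i
      rw [abs_le]
      constructor <;> linarith [h2.1, h2.2, h3.1, h3.2]
    have h0 : 0 ≤ lam / (m : ℝ) := by positivity
    rw [abs_mul, abs_of_nonneg h0]
    push_cast
    nlinarith

/-- The weight vector `∑ᵢ αᵢ ψ_d(xᵢ)`. -/
noncomputable def weight {n m : ℕ} (d : ℕ) (x : Fin m → Vec n) (α : Fin m → ℝ) : Feat n d :=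
  ∑ i, α i • feature d (x i)

theorem inner_weight {n m : ℕ} (d : ℕ) (x : Fin m → Vec n) (α : Fin m → ℝ) (a : Vec n) :
    inner ℝ (weight d x α) (feature d a) = ∑ i, α i * mkernel d a (x i) := by
  unfold weight mkernel
  rw [sum_inner]
  refine Finset.sum_congr rfl fun i _ => ?_
  rw [real_inner_smul_left, real_inner_comm]

theorem abs_sum_iterate_sub_inner_le {n m : ℕ} {d : ℕ} (hm : 1 ≤ m) {u : ℝ → ℝ}
    (hu : ∀ s, u s ∈ Set.Icc (0 : ℝ) 1)
    {lam : ℝ} (hlam : 0 ≤ lam) {y : Fin m → ℝ} (hy : ∀ i, y i ∈ Set.Icc (0 : ℝ) 1)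
    (x : Fin m → Vec n) (K : Fin m → Fin m → ℝ) (t : ℕ) {κ : Fin m → ℝ} {a : Vec n} {εK : ℝ}
    (hκ : ∀ j, |κ j - mkernel d a (x j)| ≤ εK) :
    |∑ j, iterate u lam y K t j * κ j -
      inner ℝ (weight d x (iterate u lam y K t)) (feature d a)| ≤ lam * (t * εK) := by
  have hm0 : (m : ℝ) ≠ 0 := by positivity
  rw [inner_weight, ← Finset.sum_sub_distrib]
  have h1 : ∀ j ∈ Finset.univ, |iterate u lam y K t j * κ j -
      iterate u lam y K t j * mkernel d a (x j)| ≤ t * (lam / m) * εK := by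
    intro j _
    rw [← mul_sub, abs_mul]
    exact mul_le_mul (abs_iterate_le hu hlam hy K t j) (hκ j) (abs_nonneg _) (by positivity)
  refine (Finset.abs_sum_le_sum_abs _ _).trans ((Finset.sum_le_sum h1).trans (le_of_eq ?_))
  simp only [Finset.sum_const, Finset.card_univ, Fintype.card_fin, nsmul_eq_mul]
  field_simp

theorem weight_iterate_succ {n m : ℕ} (d : ℕ) (u : ℝ → ℝ) (lam : ℝ) (y : Fin m → ℝ)
    (x : Fin m → Vec n) (K : Fin m → Fin m → ℝ) (t : ℕ) :
    weight d x (iterate u lam y K (t + 1)) = weight d x (iterate u lam y K t) +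
      lam • ((1 / (m : ℝ)) • ∑ i,
        (y i - u (∑ j, iterate u lam y K t j * K i j)) • feature d (x i)) := by
  unfold weight
  rw [Finset.smul_sum, Finset.smul_sum, ← Finset.sum_add_distrib]
  refine Finset.sum_congr rfl fun i _ => ?_
  rw [iterate, add_smul, smul_smul, smul_smul]
  congr 2
  ring

/-! ### The potential argument -/

theorem abs_sub_le_of_lipschitz {u : ℝ → ℝ} {L : ℝ} (hL : 0 < L)
    (hlip : LipschitzWith L.toNNReal u) (a b : ℝ) : |u a - u b| ≤ L * |a - b| := by
  have := hlip.dist_le_mul a b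
  rwa [Real.dist_eq, Real.dist_eq, Real.coe_toNNReal _ hL.le] at this

theorem sq_sub_le_mul_of_monotone_lipschitz {u : ℝ → ℝ} {L : ℝ} (hL : 0 < L) (hmono : Monotone u)
    (hlip : LipschitzWith L.toNNReal u) (a b : ℝ) :
    (u a - u b) ^ 2 ≤ L * ((u a - u b) * (a - b)) := by
  have h := abs_sub_le_of_lipschitz hL hlip a b
  rcases le_total a b with hab | hab
  · have h1 := hmono hab
    rw [abs_of_nonpos (by linarith), abs_of_nonpos (by linarith)] at h
    nlinarith
  · have h1 := hmono hab
    rw [abs_of_nonneg (by linarith), abs_of_nonneg (by linarith)] at h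
    nlinarith

theorem norm_sq_avg_smul_le {H : Type*} [NormedAddCommGroup H] [InnerProductSpace ℝ H] {m : ℕ}
    (hm : 1 ≤ m) {ψ : Fin m → H} (hψ : ∀ i, ‖ψ i‖ ≤ 1) (c : Fin m → ℝ) :
    ‖(1 / (m : ℝ)) • ∑ i, c i • ψ i‖ ^ 2 ≤ (1 / (m : ℝ)) * ∑ i, c i ^ 2 := by
  have hm0 : (0 : ℝ) < m := by exact_mod_cast hm
  have h1 : ‖∑ i, c i • ψ i‖ ≤ ∑ i, |c i| := by
    refine (norm_sum_le _ _).trans (Finset.sum_le_sum fun i _ => ?_)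
    rw [norm_smul]
    exact mul_le_of_le_one_right (norm_nonneg _) (hψ i)
  have h2 := sq_sum_le_card_mul_sum_sq (s := (Finset.univ : Finset (Fin m))) (f := fun i => |c i|)
  simp only [Finset.card_univ, Fintype.card_fin, sq_abs] at h2
  have h3 := pow_le_pow_left₀ (norm_nonneg _) h1 2
  rw [norm_smul, mul_pow, Real.norm_of_nonneg (by positivity)]
  have h4 : (1 / (m : ℝ)) ^ 2 * ‖∑ i, c i • ψ i‖ ^ 2 ≤ (1 / (m : ℝ)) ^ 2 * (m * ∑ i, c i ^ 2) :=
    mul_le_mul_of_nonneg_left (h3.trans h2) (by positivity)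
  refine h4.trans (le_of_eq ?_)
  field_simp

/-- Expansion of `‖(w - v) + (Δ + G) / L‖²`. The perturbations `s` of the predictions carry the
kernel errors, and `τ` bounds the label noise tested against the ball of radius `B`. -/
theorem potential_step {H : Type*} [NormedAddCommGroup H] [InnerProductSpace ℝ H] {m : ℕ}
    (hm : 1 ≤ m) {ψ : Fin m → H} (hψ : ∀ i, ‖ψ i‖ ≤ 1) {u : ℝ → ℝ} {L B τ κ : ℝ} (hL : 0 < L)
    (hB : 0 < B) (hu : ∀ s, u s ∈ Set.Icc (0 : ℝ) 1) (hmono : Monotone u)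
    (hlip : LipschitzWith L.toNNReal u) {v w : H} (hwv : ‖w - v‖ ≤ B) {ξ s y f g : Fin m → ℝ}
    (hf : ∀ i, f i = u (inner ℝ v (ψ i) + ξ i)) (hg : ∀ i, g i = u (inner ℝ w (ψ i) + s i))
    (hs : ∀ i, |s i| ≤ κ / L)
    (hτ : ∀ w' : H, ‖w'‖ ≤ B → -τ ≤ (1 / (m : ℝ)) * ∑ i, (y i - f i) * inner ℝ w' (ψ i)) :
    ‖w + (1 / L) • ((1 / (m : ℝ)) • ∑ i, (y i - g i) • ψ i) - v‖ ^ 2 ≤ ‖w - v‖ ^ 2 -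
      (1 / L ^ 2) * ((1 / (m : ℝ)) * (∑ i, (f i - g i) ^ 2) / 2 -
        2 * L * ((1 / (m : ℝ)) * ∑ i, |ξ i|) - 2 * κ - 2 * L * τ - 3 * (τ / B) ^ 2) := by
  have hm0 : (0 : ℝ) < m := by exact_mod_cast hm
  set Δ := (1 / (m : ℝ)) • ∑ i, (y i - f i) • ψ i with hΔ
  set G := (1 / (m : ℝ)) • ∑ i, (f i - g i) • ψ i with hG
  set E := (1 / (m : ℝ)) * ∑ i, (f i - g i) ^ 2 with hE
  set A := (1 / (m : ℝ)) * ∑ i, |ξ i| with hA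
  have hsum : (1 / (m : ℝ)) • ∑ i, (y i - g i) • ψ i = Δ + G := by
    rw [hΔ, hG, ← smul_add, ← Finset.sum_add_distrib]
    congr 1
    refine Finset.sum_congr rfl fun i _ => ?_
    rw [← add_smul]; congr 1; ring
  have hinner : ∀ (w' : H) (c : Fin m → ℝ), inner ℝ w' ((1 / (m : ℝ)) • ∑ i, c i • ψ i) =
      (1 / (m : ℝ)) * ∑ i, c i * inner ℝ w' (ψ i) := by
    intro w' c
    rw [inner_smul_right, inner_sum]
    simp_rw [inner_smul_right]
  have hΔ1 : ∀ w' : H, ‖w'‖ ≤ B → -τ ≤ inner ℝ w' Δ := fun w' hw' => by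
    rw [hΔ, hinner]; exact hτ w' hw'
  have hΔ2 : ‖Δ‖ ≤ τ / B := by
    rw [le_div_iff₀ hB]
    by_cases h0 : ‖Δ‖ = 0
    · have := hΔ1 0 (by simpa using hB.le)
      rw [inner_zero_left] at this
      rw [h0]; linarith
    -- The norm of `Δ` is read off by duality, testing with the vector of norm `B` opposite to `Δ`.
    · have := hΔ1 (-(B / ‖Δ‖) • Δ) (by
        rw [norm_smul, norm_neg, Real.norm_of_nonneg (by positivity)]
        field_simp; exact le_rfl)
      rw [real_inner_smul_left, real_inner_self_eq_norm_sq] at this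
      have e : -(B / ‖Δ‖) * ‖Δ‖ ^ 2 = -(‖Δ‖ * B) := by field_simp
      rw [e] at this
      linarith
  have hΔ3 : inner ℝ (w - v) Δ ≤ τ := by
    have := hΔ1 (-(w - v)) (by rwa [norm_neg])
    rw [inner_neg_left] at this
    linarith
  have hG1 : ‖G‖ ^ 2 ≤ E := norm_sq_avg_smul_le hm hψ _
  -- Pointwise, monotonicity and the Lipschitz bound compare the full arguments of `u`; `ξ` and `s`
  -- are then split off using `|f - g| ≤ 1`.
  have hG2 : L * inner ℝ (w - v) G ≤ -E + L * A + κ := by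
    rw [hG, hinner]
    have hpt : ∀ i ∈ Finset.univ, L * ((f i - g i) * inner ℝ (w - v) (ψ i)) ≤
        -(f i - g i) ^ 2 + L * |ξ i| + κ := by
      intro i _
      have h1 := sq_sub_le_mul_of_monotone_lipschitz hL hmono hlip
        (inner ℝ v (ψ i) + ξ i) (inner ℝ w (ψ i) + s i)
      rw [← hf, ← hg] at h1
      rw [inner_sub_left]
      have h2 : |f i - g i| ≤ 1 := by
        have a1 := hu (inner ℝ v (ψ i) + ξ i)
        have a2 := hu (inner ℝ w (ψ i) + s i)
        rw [← hf] at a1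
        rw [← hg] at a2
        rw [abs_le]
        constructor <;> linarith [a1.1, a1.2, a2.1, a2.2]
      have h3 : (f i - g i) * (ξ i - s i) ≤ |ξ i| + |s i| := by
        refine (le_abs_self _).trans ?_
        rw [abs_mul]
        refine (mul_le_of_le_one_left (abs_nonneg _) h2).trans (abs_sub _ _)
      have h4 : L * |s i| ≤ κ := by
        have := hs i
        rwa [le_div_iff₀ hL, mul_comm] at this
      have h5 := mul_le_mul_of_nonneg_left h3 hL.le
      nlinarith
    have h6 := Finset.sum_le_sum hpt
    rw [← Finset.mul_sum, Finset.sum_add_distrib, Finset.sum_add_distrib, ← Finset.mul_sum,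
      Finset.sum_neg_distrib] at h6
    simp only [Finset.sum_const, Finset.card_univ, Fintype.card_fin, nsmul_eq_mul] at h6
    have h7 := mul_le_mul_of_nonneg_left h6 (by positivity : 0 ≤ 1 / (m : ℝ))
    have e : 1 / (m : ℝ) * (-∑ i, (f i - g i) ^ 2 + L * ∑ i, |ξ i| + m * κ) =
        -E + L * A + κ := by
      rw [hE, hA]; field_simp
    rw [e] at h7
    linarith
  have hE0 : 0 ≤ E := by positivity
  -- Young's inequality weighted so that the coefficient of `E` stays below the gain `2E` of the
  -- inner product; `E / 2` survives.
  have hDG : ‖Δ + G‖ ^ 2 ≤ 3 / 2 * E + 3 * (τ / B) ^ 2 := by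
    have h1 := pow_le_pow_left₀ (norm_nonneg _) (norm_add_le Δ G) 2
    have h2 := pow_le_pow_left₀ (norm_nonneg _) hΔ2 2
    nlinarith [sq_nonneg (2 * ‖Δ‖ - ‖G‖)]
  rw [hsum]
  have e1 : w + (1 / L) • (Δ + G) - v = (w - v) + (1 / L) • (Δ + G) := by abel
  rw [e1, norm_add_sq_real, inner_smul_right, norm_smul, mul_pow,
    Real.norm_of_nonneg (by positivity), inner_add_right]
  have e2 : 2 * (1 / L * (inner ℝ (w - v) Δ + inner ℝ (w - v) G)) =
    (1 / L ^ 2) * (2 * (L * inner ℝ (w - v) Δ + L * inner ℝ (w - v) G)) := by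
    field_simp
  rw [e2, div_pow, one_pow]
  have h8 : 2 * (L * inner ℝ (w - v) Δ + L * inner ℝ (w - v) G) + ‖Δ + G‖ ^ 2 ≤
      -(E / 2 - 2 * L * A - 2 * κ - 2 * L * τ - 3 * (τ / B) ^ 2) := by
    have := mul_le_mul_of_nonneg_left hΔ3 hL.le
    linarith
  have h9 := mul_le_mul_of_nonneg_left h8 (by positivity : 0 ≤ 1 / L ^ 2)
  have h10 : 1 / (m : ℝ) * (∑ i, (f i - g i) ^ 2) / 2 = E / 2 := rfl
  linarith

theorem exists_iterate_small_error {n m d : ℕ} (hm : 1 ≤ m) {u : ℝ → ℝ} {L B τ εK : ℝ}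
    (hL : 0 < L) (hB : 0 < B) (hεK : 0 ≤ εK) (hu : ∀ s, u s ∈ Set.Icc (0 : ℝ) 1)
    (hmono : Monotone u) (hlip : LipschitzWith L.toNNReal u) {v : Feat n d} (hv : ‖v‖ ≤ B)
    {x : Fin m → Vec n} (hx : ∀ i, ‖x i‖ ≤ 1) {y ξ f : Fin m → ℝ}
    (hy : ∀ i, y i ∈ Set.Icc (0 : ℝ) 1)
    (hf : ∀ i, f i = u (inner ℝ v (feature d (x i)) + ξ i)) {K : Fin m → Fin m → ℝ}
    (hK : ∀ i j, |K i j - mkernel d (x i) (x j)| ≤ εK)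
    (hτ : ∀ w : Feat n d, ‖w‖ ≤ B →
      -τ ≤ (1 / (m : ℝ)) * ∑ i, (y i - f i) * inner ℝ w (feature d (x i))) {T : ℕ} (hT : 1 ≤ T) :
    ∃ t < T, ‖weight d x (iterate u (1 / L) y K t) - v‖ ≤ B ∧
      (1 / (m : ℝ)) * ∑ i, (f i - u (∑ j, iterate u (1 / L) y K t j * K i j)) ^ 2 ≤
        4 * L * ((1 / (m : ℝ)) * ∑ i, |ξ i|) + 4 * (εK * T) + 4 * L * τ + 6 * (τ / B) ^ 2 +
          2 * L ^ 2 * B ^ 2 / T := by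
  -- If no iterate is good, the potential drops by more than `B² / T` in each of the `T` steps. By
  -- induction every iterate stays in the ball where `potential_step` applies, and the last, strict
  -- drop makes a square negative.
  by_contra! hcon
  have hT0 : (0 : ℝ) < T := by exact_mod_cast hT
  set W : ℕ → Feat n d := fun t => weight d x (iterate u (1 / L) y K t) with hW
  have hstep : ∀ t < T, ‖W t - v‖ ≤ B → ‖W (t + 1) - v‖ ^ 2 < ‖W t - v‖ ^ 2 - B ^ 2 / T := by
    intro t ht hWt
    have h1 := hcon t ht hWt
    have h2 := potential_step (s := fun i => ∑ j, iterate u (1 / L) y K t j * K i j -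
        inner ℝ (W t) (feature d (x i))) (κ := εK * T) hm (fun i => norm_feature_le d (hx i)) hL hB
      hu hmono hlip hWt hf
      (g := fun i => u (∑ j, iterate u (1 / L) y K t j * K i j)) (fun i => by
        congr 1; ring) (fun i => ?_) hτ
    · rw [hW]
      simp only
      rw [weight_iterate_succ]
      refine h2.trans_lt ?_
      have h3 : L ^ 2 * B ^ 2 / T < (1 / (m : ℝ)) * (∑ i, (f i -
          u (∑ j, iterate u (1 / L) y K t j * K i j)) ^ 2) / 2 -
        2 * L * ((1 / (m : ℝ)) * ∑ i, |ξ i|) - 2 * (εK * T) - 2 * L * τ - 3 * (τ / B) ^ 2 := by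
        have : 2 * L ^ 2 * B ^ 2 / T = 2 * (L ^ 2 * B ^ 2 / T) := by ring
        linarith
      have h4 := mul_lt_mul_of_pos_left h3 (by positivity : 0 < 1 / L ^ 2)
      have e : 1 / L ^ 2 * (L ^ 2 * B ^ 2 / T) = B ^ 2 / T := by field_simp
      rw [e] at h4
      simp only [hW] at h4 ⊢
      linarith
    · refine (abs_sum_iterate_sub_inner_le hm hu (by positivity) hy x K t (hK i)).trans ?_
      rw [one_div, inv_mul_eq_div, mul_comm]
      have : (t : ℝ) ≤ T := by exact_mod_cast ht.le
      gcongr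
  have hD : ∀ t ≤ T, ‖W t - v‖ ^ 2 ≤ B ^ 2 - t * (B ^ 2 / T) := by
    intro t
    induction t with
    | zero =>
      intro _
      have : W 0 = 0 := by simp [hW, weight, iterate]
      rw [this, zero_sub, norm_neg]
      simpa using pow_le_pow_left₀ (norm_nonneg _) hv 2
    | succ t ih =>
      intro ht
      have h1 := ih (by omega)
      have h2 : 0 ≤ t * (B ^ 2 / T) := by positivity
      have h3 := hstep t (by omega) (le_of_sq_le_sq (by linarith) hB.le)
      push_cast
      linarith
  have h1 := hD (T - 1) (by omega)
  have h2 : 0 ≤ ((T - 1 : ℕ) : ℝ) * (B ^ 2 / T) := by positivity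
  have h3 := hstep (T - 1) (by omega) (le_of_sq_le_sq (by linarith) hB.le)
  have h4 : ((T - 1 : ℕ) : ℝ) = T - 1 := by rw [Nat.cast_sub hT, Nat.cast_one]
  have h5 : ((T : ℝ) - 1) * (B ^ 2 / T) = B ^ 2 - B ^ 2 / T := by field_simp
  rw [h4, h5] at h1
  have := sq_nonneg ‖W (T - 1 + 1) - v‖
  linarith

/-! ### The regression function and the training sample -/

/-- The pull-out property of conditional expectation: `φ` depends on `x` only, and `f` is a
pointwise version of `E[y | x]`. -/
theorem integral_mul_sub_regression_eq_zero {n : ℕ} (D : Measure (Vec n × ℝ))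
    [IsProbabilityMeasure D] (hy : ∀ᵐ p ∂D, p.2 ∈ Set.Icc (0 : ℝ) 1) {f : Vec n → ℝ}
    (hf1 : ∀ x, f x ∈ Set.Icc (0 : ℝ) 1) (hf : Measurable f)
    (hreg : regression D =ᵐ[D] fun p => f p.1) {φ : Vec n → ℝ} (hφ : Measurable φ) {M : ℝ}
    (hM : ∀ᵐ p ∂D, |φ p.1| ≤ M) : ∫ p, φ p.1 * (p.2 - f p.1) ∂D = 0 := by
  have iy : Integrable (fun p : Vec n × ℝ => p.2) D := by
    refine Integrable.of_bound measurable_snd.aestronglyMeasurable 1 ?_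
    filter_upwards [hy] with p hp
    rw [Real.norm_of_nonneg hp.1]; exact hp.2
  have mφ : Measurable fun p : Vec n × ℝ => φ p.1 := hφ.comp measurable_fst
  have iφy : Integrable ((fun p : Vec n × ℝ => φ p.1) * fun p : Vec n × ℝ => p.2) D := by
    refine Integrable.of_bound (mφ.mul measurable_snd).aestronglyMeasurable M ?_
    filter_upwards [hy, hM] with p hp hpM
    rw [Pi.mul_apply, norm_mul, Real.norm_of_nonneg hp.1]
    exact (mul_le_of_le_one_right (norm_nonneg _) hp.2).trans hpM
  have iφf : Integrable (fun p : Vec n × ℝ => φ p.1 * f p.1) D := by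
    refine Integrable.of_bound (mφ.mul (hf.comp measurable_fst)).aestronglyMeasurable M ?_
    filter_upwards [hM] with p hpM
    rw [norm_mul, Real.norm_of_nonneg (hf1 p.1).1]
    exact (mul_le_of_le_one_right (norm_nonneg _) (hf1 p.1).2).trans hpM
  set m0 := MeasurableSpace.comap (Prod.fst : Vec n × ℝ → Vec n) inferInstance with hm0
  have hm : m0 ≤ Prod.instMeasurableSpace := measurable_fst.comap_le
  have sφ : StronglyMeasurable[m0] fun p : Vec n × ℝ => φ p.1 :=
    (hφ.comp (comap_measurable _)).stronglyMeasurable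
  have h1 := condExp_mul_of_stronglyMeasurable_left sφ iφy iy
  have h2 : ∫ p, φ p.1 * p.2 ∂D = ∫ p, φ p.1 * f p.1 ∂D := by
    have h3 := integral_condExp (μ := D) hm
      (f := (fun p : Vec n × ℝ => φ p.1) * fun p : Vec n × ℝ => p.2)
    simp only [Pi.mul_apply] at h3
    rw [← h3]
    refine integral_congr_ae ?_
    filter_upwards [h1, hreg] with p hp1 hp2
    rw [hp1, Pi.mul_apply]
    change φ p.1 * regression D p = _
    rw [hp2]
  simp_rw [mul_sub]
  have h5 := integral_sub iφy iφf
  simp only [Pi.mul_apply] at h5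
  rw [h5, h2, sub_self]

theorem genError_eq {n : ℕ} (D : Measure (Vec n × ℝ)) {f : Vec n → ℝ}
    (hreg : regression D =ᵐ[D] fun p => f p.1) (h : Vec n → ℝ) :
    genError D h = ∫ p, (h p.1 - f p.1) ^ 2 ∂D := by
  refine integral_congr_ae ?_
  filter_upwards [hreg] with p hp
  rw [hp]

theorem abs_sub_le_one_of_mem {a b : ℝ} (ha : a ∈ Set.Icc (0 : ℝ) 1)
    (hb : b ∈ Set.Icc (0 : ℝ) 1) : |a - b| ≤ 1 := by
  rw [abs_le]
  constructor <;> linarith [ha.1, ha.2, hb.1, hb.2]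

theorem sq_sub_le_one_of_mem {a b : ℝ} (ha : a ∈ Set.Icc (0 : ℝ) 1)
    (hb : b ∈ Set.Icc (0 : ℝ) 1) : (a - b) ^ 2 ≤ 1 := by
  rw [← sq_abs]
  exact pow_le_one₀ (abs_nonneg _) (abs_sub_le_one_of_mem ha hb)

theorem genError_le_one {n : ℕ} (D : Measure (Vec n × ℝ)) [IsProbabilityMeasure D]
    {f : Vec n → ℝ} (hf1 : ∀ x, f x ∈ Set.Icc (0 : ℝ) 1)
    (hreg : regression D =ᵐ[D] fun p => f p.1) {h : Vec n → ℝ}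
    (hh : ∀ x, h x ∈ Set.Icc (0 : ℝ) 1) : genError D h ≤ 1 := by
  rw [genError_eq D hreg]
  have := integral_mono_of_nonneg (μ := D) (f := fun p => (h p.1 - f p.1) ^ 2) (g := fun _ => 1)
    (ae_of_all _ fun _ => sq_nonneg _) (integrable_const _)
    (ae_of_all _ fun p => sq_sub_le_one_of_mem (hh p.1) (hf1 p.1))
  simpa using this

theorem integral_abs_le_sqrt {Ω : Type*} [MeasurableSpace Ω] (μ : Measure Ω)
    [IsProbabilityMeasure μ] {X : Ω → ℝ} (hX : Measurable X) {M ε : ℝ} (hM : ∀ x, |X x| ≤ M)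
    (hε : ∫ x, X x ^ 2 ∂μ ≤ ε) : ∫ x, |X x| ∂μ ≤ √ε := by
  have hL : MemLp (fun x => |X x|) 2 μ := MemLp.of_bound hX.abs.aestronglyMeasurable M
    (ae_of_all _ fun x => by simpa using hM x)
  -- Nonnegativity of the variance of `|X|` is the Cauchy–Schwarz inequality needed.
  have h1 := variance_nonneg (fun x => |X x|) μ
  rw [variance_eq_sub hL] at h1
  simp only [Pi.pow_apply, sq_abs] at h1
  exact Real.le_sqrt_of_sq_le (by linarith)

theorem sq_le_mul_of_abs_le_one {a c : ℝ} (h1 : |a| ≤ 1) (h : |a| ≤ c) : a ^ 2 ≤ c := by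
  rw [← sq_abs]
  nlinarith [abs_nonneg a]

/-- The exceptional training samples: outside this event the sample is supported in the unit ball
and the empirical averages used by the analysis are close to the expectations. -/
theorem exists_training_event {n d : ℕ} (D : Measure (Vec n × ℝ)) [IsProbabilityMeasure D]
    (hsupp : ∀ᵐ p ∂D, ‖p.1‖ ≤ 1 ∧ p.2 ∈ Set.Icc (0 : ℝ) 1) {u : ℝ → ℝ} {L B ζ ε δ : ℝ}
    (hL : 0 < L) (hB : 0 < B) (hζ : 0 < ζ) (hδ : 0 < δ) (hδ1 : δ ≤ 1)
    (hu : ∀ s, u s ∈ Set.Icc (0 : ℝ) 1) (hlip : LipschitzWith L.toNNReal u)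
    {v : Feat n d} {ξ : Vec n → ℝ} (hξ : Measurable ξ) (hξζ : ∀ x, ξ x ∈ Set.Icc (-ζ) ζ)
    (hξε : ∫ p, ξ p.1 ^ 2 ∂D ≤ ε) {f : Vec n → ℝ}
    (hf : ∀ x, f x = u (inner ℝ v (feature d x) + ξ x))
    (hreg : regression D =ᵐ[D] fun p => f p.1) {m : ℕ} (hm : 1 ≤ m) :
    ∃ A : Set (Fin m → Vec n × ℝ), (Measure.pi fun _ : Fin m => D) A ≤ ENNReal.ofReal δ ∧
      ∀ S ∉ A, (∀ i, ‖(S i).1‖ ≤ 1 ∧ (S i).2 ∈ Set.Icc (0 : ℝ) 1) ∧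
        (∀ w : Feat n d, ‖w‖ ≤ B →
          ∫ p, (u (inner ℝ (v + w) (feature d p.1)) - u (inner ℝ v (feature d p.1))) ^ 2 ∂D ≤
          (1 / (m : ℝ)) * ∑ i, (u (inner ℝ (v + w) (feature d (S i).1)) -
            u (inner ℝ v (feature d (S i).1))) ^ 2 +
          B * (2 * L) * √(8 * Real.log (2 / (δ / 3)) / m)) ∧
        (∀ w : Feat n d, ‖w‖ ≤ B → -(B * √(8 * Real.log (2 / (δ / 3)) / m)) ≤
          (1 / (m : ℝ)) * ∑ i, ((S i).2 - f (S i).1) * inner ℝ w (feature d (S i).1)) ∧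
        (1 / (m : ℝ)) * ∑ i, |ξ (S i).1| ≤ 2 * √ε + ζ * (Real.log (1 / (δ / 3)) / m) := by
  have hm0 : (0 : ℝ) < m := by exact_mod_cast hm
  have hum : Measurable u := hlip.continuous.measurable
  have hψ : Measurable fun p : Vec n × ℝ => feature d p.1 :=
    (measurable_feature d).comp measurable_fst
  have hψ1 : ∀ᵐ p ∂D, ‖feature d p.1‖ ≤ 1 := by
    filter_upwards [hsupp] with p hp using norm_feature_le d hp.1
  have hfm : Measurable f := by
    rw [funext hf]
    exact hum.comp ((measurable_const.inner (measurable_feature d)).add hξ)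
  have hf1 : ∀ x, f x ∈ Set.Icc (0 : ℝ) 1 := fun x => by rw [hf]; exact hu _
  set P := Measure.pi fun _ : Fin m => D
  -- The class is centred at `v`: the square vanishes at `r = 0` and is `2L`-Lipschitz in `r`, as
  -- `u` takes values in `[0, 1]`.
  have A1 := uniform_deviation D hψ hψ1
    (φ := fun p r => (u (inner ℝ v (feature d p.1) + r) - u (inner ℝ v (feature d p.1))) ^ 2)
    (fun w => (((hum.comp ((measurable_const.inner hψ).add (measurable_const.inner hψ))).sub
      (hum.comp (measurable_const.inner hψ))).pow_const 2))
    hB (K := 2 * L) (by positivity) (δ := δ / 3) (by positivity) (by linarith)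
    (ae_of_all _ fun p => by
      refine ⟨by simp, fun r r' => ?_⟩
      set q := inner ℝ v (feature d p.1)
      have e : (u (q + r) - u q) ^ 2 - (u (q + r') - u q) ^ 2 =
        (u (q + r) - u (q + r')) * ((u (q + r) - u q) + (u (q + r') - u q)) := by ring
      rw [e, abs_mul]
      have h1 := abs_sub_le_of_lipschitz hL hlip (q + r) (q + r')
      rw [add_sub_add_left_eq_sub] at h1
      have h2 : |(u (q + r) - u q) + (u (q + r') - u q)| ≤ 2 := by
        refine (abs_add_le _ _).trans ?_
        have := abs_sub_le_one_of_mem (hu (q + r)) (hu q)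
        have := abs_sub_le_one_of_mem (hu (q + r')) (hu q)
        linarith
      calc _ ≤ L * |r - r'| * 2 := mul_le_mul h1 h2 (abs_nonneg _) (by positivity)
        _ = 2 * L * |r - r'| := by ring) hm
  -- Label noise tested against all `w` of norm at most `B`; the expectation vanishes by
  -- orthogonality.
  have A2 := uniform_deviation D hψ hψ1 (φ := fun p r => (p.2 - f p.1) * r)
    (fun w => (measurable_snd.sub (hfm.comp measurable_fst)).mul (measurable_const.inner hψ))
    hB (K := 1) one_pos (δ := δ / 3) (by positivity) (by linarith)
    (by
      filter_upwards [hsupp] with p hp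
      refine ⟨by simp, fun r r' => ?_⟩
      rw [← mul_sub, abs_mul]
      exact mul_le_mul_of_nonneg_right (abs_sub_le_one_of_mem hp.2 (hf1 _)) (abs_nonneg _)) hm
  -- Normalizing by `ζ` gives a variable in `[0, 1]`, so the deviation is `ζ log(1/δ) / m` up to
  -- constants, plus a multiple of the mean.
  have A3 := measure_avg_gt_le D (Z := fun p => |ξ p.1| / ζ)
    ((hξ.comp measurable_fst).abs.div_const ζ)
    (ae_of_all _ fun p => ⟨by positivity, by
      rw [div_le_one hζ]; exact abs_le.2 (hξζ p.1)⟩) (δ := δ / 3) (by positivity) hm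
  have A0 : P {S | ¬ ∀ i, ‖(S i).1‖ ≤ 1 ∧ (S i).2 ∈ Set.Icc (0 : ℝ) 1} = 0 :=
    ae_pi_forall D hsupp
  refine ⟨_ ∪ (_ ∪ (_ ∪ _)), ((measure_union_le _ _).trans (add_le_add A0.le
    ((measure_union_le _ _).trans (add_le_add A1 ((measure_union_le _ _).trans
      (add_le_add A2 A3)))))).trans (le_of_eq ?_), fun S hS => ?_⟩
  · rw [zero_add, ← ENNReal.ofReal_add (by positivity) (by positivity),
      ← ENNReal.ofReal_add (by positivity) (by positivity)]
    congr 1; ring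
  simp only [Set.mem_union, Set.mem_ofPred_eq, not_or, not_not, not_exists, not_and, not_lt] at hS
  obtain ⟨h0, h1, h2, h3⟩ := hS
  refine ⟨h0, fun w hw => ?_, fun w hw => ?_, ?_⟩
  · have := h1 w hw
    simp only [← inner_add_left] at this
    linarith
  · have h4 := h2 w hw
    have h5 : ∫ p, (p.2 - f p.1) * inner ℝ w (feature d p.1) ∂D = 0 := by
      rw [← integral_mul_sub_regression_eq_zero D (hsupp.mono fun p hp => hp.2) hf1 hfm hreg
        (φ := fun x => inner ℝ w (feature d x)) (measurable_const.inner (measurable_feature d))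
        (M := ‖w‖) (by
          filter_upwards [hψ1] with p hp
          exact (abs_real_inner_le_norm _ _).trans (mul_le_of_le_one_right (norm_nonneg _) hp))]
      exact integral_congr_ae (ae_of_all _ fun p => mul_comm _ _)
    rw [h5, mul_one] at h4
    linarith
  · have h4 := integral_abs_le_sqrt D (hξ.comp measurable_fst) (M := ζ)
      (fun p => abs_le.2 (hξζ p.1)) hξε
    simp only [Function.comp_apply] at h4
    rw [integral_div, ← Finset.sum_div, mul_div_assoc', mul_div_assoc', div_le_iff₀ hζ] at h3
    have e : (2 * (∫ p, |ξ p.1| ∂D) / ζ + Real.log (1 / (δ / 3)) / m) * ζ =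
      2 * (∫ p, |ξ p.1| ∂D) + ζ * (Real.log (1 / (δ / 3)) / m) := by field_simp
    rw [e] at h3
    linarith

theorem genError_le_two_mul_add {n d : ℕ} (D : Measure (Vec n × ℝ)) [IsProbabilityMeasure D]
    {u : ℝ → ℝ} {L ζ ε : ℝ} (hL : 0 < L)
    (hu : ∀ s, u s ∈ Set.Icc (0 : ℝ) 1) (hlip : LipschitzWith L.toNNReal u)
    {v : Feat n d} {ξ : Vec n → ℝ} (hξ : Measurable ξ) (hξζ : ∀ x, ξ x ∈ Set.Icc (-ζ) ζ)
    (hξε : ∫ p, ξ p.1 ^ 2 ∂D ≤ ε) {f : Vec n → ℝ}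
    (hf : ∀ x, f x = u (inner ℝ v (feature d x) + ξ x))
    (hreg : regression D =ᵐ[D] fun p => f p.1) (w : Feat n d) :
    genError D (fun x => u (inner ℝ w (feature d x))) ≤
      2 * ∫ p, (u (inner ℝ w (feature d p.1)) - u (inner ℝ v (feature d p.1))) ^ 2 ∂D +
        2 * (L * √ε) := by
  have hum : Measurable u := hlip.continuous.measurable
  have hψ : Measurable fun p : Vec n × ℝ => feature d p.1 :=
    (measurable_feature d).comp measurable_fst
  have hmu : ∀ w : Feat n d, Measurable fun p : Vec n × ℝ => u (inner ℝ w (feature d p.1)) :=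
    fun w => hum.comp (measurable_const.inner hψ)
  rw [genError_eq D hreg]
  have i1 : Integrable (fun p : Vec n × ℝ =>
      (u (inner ℝ w (feature d p.1)) - u (inner ℝ v (feature d p.1))) ^ 2) D := by
    refine Integrable.of_bound (((hmu w).sub (hmu v)).pow_const 2).aestronglyMeasurable 1
      (ae_of_all _ fun p => ?_)
    rw [Real.norm_of_nonneg (sq_nonneg _)]
    exact sq_sub_le_one_of_mem (hu _) (hu _)
  have i2 : Integrable (fun p : Vec n × ℝ => |ξ p.1|) D :=
    Integrable.of_bound (hξ.comp measurable_fst).abs.aestronglyMeasurable ζ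
      (ae_of_all _ fun p => by simpa using abs_le.2 (hξζ p.1))
  have h1 : ∫ p, (u (inner ℝ w (feature d p.1)) - f p.1) ^ 2 ∂D ≤
      ∫ p, (2 * (u (inner ℝ w (feature d p.1)) - u (inner ℝ v (feature d p.1))) ^ 2 +
        2 * L * |ξ p.1|) ∂D := by
    refine integral_mono_of_nonneg (ae_of_all _ fun _ => sq_nonneg _)
      ((i1.const_mul 2).add (i2.const_mul (2 * L))) (ae_of_all _ fun p => ?_)
    -- The difference is at most `1`, so its square is bounded by its first power; the error is
    -- therefore linear in `L |ξ|`.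
    have h2 : (u (inner ℝ v (feature d p.1)) - f p.1) ^ 2 ≤ L * |ξ p.1| := by
      rw [hf]
      refine sq_le_mul_of_abs_le_one (abs_sub_le_one_of_mem (hu _) (hu _)) ?_
      refine (abs_sub_le_of_lipschitz hL hlip _ _).trans (le_of_eq ?_)
      rw [sub_add_cancel_left, abs_neg]
    simp only
    nlinarith [sq_nonneg ((u (inner ℝ w (feature d p.1)) - u (inner ℝ v (feature d p.1))) -
      (u (inner ℝ v (feature d p.1)) - f p.1))]
  have h3 := integral_add (i1.const_mul 2) (i2.const_mul (2 * L))
  rw [integral_const_mul, integral_const_mul] at h3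
  rw [h3] at h1
  have h4 := integral_abs_le_sqrt D (hξ.comp measurable_fst) (M := ζ)
    (fun p => abs_le.2 (hξζ p.1)) hξε
  simp only [Function.comp_apply] at h4
  have := mul_le_mul_of_nonneg_left h4 hL.le
  linarith

/-! ### A good iterate, and its selection by validation -/

theorem hypothesis_eq {n m d : ℕ} (u : ℝ → ℝ) (x : Fin m → Vec n) (α : Fin m → ℝ) :
    hypothesis d u x α = fun a => u (inner ℝ (weight d x α) (feature d a)) := by
  funext a
  rw [inner_weight, hypothesis]

theorem abs_eval_sub_hypothesis_le {n m : ℕ} {d : ℕ} (hm : 1 ≤ m) {u : ℝ → ℝ} {L : ℝ} (hL : 0 < L)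
    (hu : ∀ s, u s ∈ Set.Icc (0 : ℝ) 1) (hlip : LipschitzWith L.toNNReal u)
    {y : Fin m → ℝ} (hy : ∀ i, y i ∈ Set.Icc (0 : ℝ) 1) (x : Fin m → Vec n)
    (K : Fin m → Fin m → ℝ) {t T : ℕ} (ht : t < T) {κ : Fin m → ℝ} {a : Vec n} {εK : ℝ}
    (hε : 0 ≤ εK) (hκ : ∀ j, |κ j - mkernel d a (x j)| ≤ εK) :
    |u (∑ j, iterate u (1 / L) y K t j * κ j) -
      hypothesis d u x (iterate u (1 / L) y K t) a| ≤ εK * T := by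
  rw [hypothesis_eq]
  refine (abs_sub_le_of_lipschitz hL hlip _ _).trans ?_
  have h1 := mul_le_mul_of_nonneg_left (abs_sum_iterate_sub_inner_le hm hu
    (by positivity : 0 ≤ 1 / L) hy x K t hκ) hL.le
  have e : L * (1 / L * (t * εK)) = εK * t := by field_simp
  have h2 : εK * t ≤ εK * T := mul_le_mul_of_nonneg_left (by exact_mod_cast ht.le) hε
  linarith

/-- The good iterate is within `B` of `v`, so the uniform bound `hgen` applies to it. The passage
from its empirical to its population error costs `τ₁` and `ξ`. -/
theorem exists_genError_le {n m d : ℕ} (D : Measure (Vec n × ℝ)) [IsProbabilityMeasure D]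
    (hm : 1 ≤ m) {u : ℝ → ℝ} {L B τ τ₁ εK ζ ε : ℝ}
    (hL : 0 < L) (hB : 0 < B) (hεK : 0 ≤ εK) (hu : ∀ s, u s ∈ Set.Icc (0 : ℝ) 1)
    (hmono : Monotone u) (hlip : LipschitzWith L.toNNReal u) {v : Feat n d} (hv : ‖v‖ ≤ B)
    {ξ : Vec n → ℝ} (hξ : Measurable ξ) (hξζ : ∀ x, ξ x ∈ Set.Icc (-ζ) ζ)
    (hξε : ∫ p, ξ p.1 ^ 2 ∂D ≤ ε) {f : Vec n → ℝ}
    (hf : ∀ x, f x = u (inner ℝ v (feature d x) + ξ x))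
    (hreg : regression D =ᵐ[D] fun p => f p.1) {S : Fin m → Vec n × ℝ}
    (hS : ∀ i, ‖(S i).1‖ ≤ 1 ∧ (S i).2 ∈ Set.Icc (0 : ℝ) 1)
    (hgen : ∀ w : Feat n d, ‖w‖ ≤ B →
      ∫ p, (u (inner ℝ (v + w) (feature d p.1)) - u (inner ℝ v (feature d p.1))) ^ 2 ∂D ≤
      (1 / (m : ℝ)) * ∑ i, (u (inner ℝ (v + w) (feature d (S i).1)) -
        u (inner ℝ v (feature d (S i).1))) ^ 2 + τ₁)
    (hτ : ∀ w : Feat n d, ‖w‖ ≤ B → -τ ≤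
      (1 / (m : ℝ)) * ∑ i, ((S i).2 - f (S i).1) * inner ℝ w (feature d (S i).1))
    {K : Fin m → Fin m → ℝ} (hK : ∀ i j, |K i j - mkernel d (S i).1 (S j).1| ≤ εK)
    {T : ℕ} (hT : 1 ≤ T) :
    ∃ t < T, genError D (hypothesis d u (fun i => (S i).1)
        (iterate u (1 / L) (fun i => (S i).2) K t)) ≤
      30 * L * ((1 / (m : ℝ)) * ∑ i, |ξ (S i).1|) + 24 * (εK * T) + 24 * L * τ +
        36 * (τ / B) ^ 2 + 12 * L ^ 2 * B ^ 2 / T + 6 * (εK * T) ^ 2 + 2 * τ₁ +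
        2 * (L * √ε) := by
  have hm0 : (0 : ℝ) < m := by exact_mod_cast hm
  obtain ⟨t, ht, hW, herr⟩ := exists_iterate_small_error hm hL hB hεK hu hmono hlip hv
    (fun i => (hS i).1) (ξ := fun i => ξ (S i).1) (fun i => (hS i).2) (fun i => hf (S i).1) hK hτ hT
  refine ⟨t, ht, ?_⟩
  have happ := fun i => abs_eval_sub_hypothesis_le hm hL hu hlip (fun i => (hS i).2)
    (fun i => (S i).1) K ht hεK (hK i)
  rw [hypothesis_eq] at happ ⊢
  set W := weight d (fun i => (S i).1) (iterate u (1 / L) (fun i => (S i).2) K t)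
  set g : Fin m → ℝ := fun i => u (∑ j, iterate u (1 / L) (fun i => (S i).2) K t j * K i j)
  have h1 := genError_le_two_mul_add D hL hu hlip hξ hξζ hξε hf hreg W
  have h2 := hgen (W - v) hW
  rw [add_sub_cancel] at h2
  -- From the exact-kernel prediction to the noiseless target through the computed prediction `g`
  -- and `f`: three differences, hence the factor `3`.
  have hpt : ∀ i ∈ Finset.univ, (u (inner ℝ W (feature d (S i).1)) -
      u (inner ℝ v (feature d (S i).1))) ^ 2 ≤
      3 * ((εK * T) ^ 2 + (f (S i).1 - g i) ^ 2 + L * |ξ (S i).1|) := by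
    intro i _
    have a1 : (g i - u (inner ℝ W (feature d (S i).1))) ^ 2 ≤ (εK * T) ^ 2 := by
      rw [← sq_abs]
      exact pow_le_pow_left₀ (abs_nonneg _) (happ i) 2
    have a2 : (f (S i).1 - u (inner ℝ v (feature d (S i).1))) ^ 2 ≤ L * |ξ (S i).1| := by
      rw [hf]
      refine sq_le_mul_of_abs_le_one (abs_sub_le_one_of_mem (hu _) (hu _)) ?_
      refine (abs_sub_le_of_lipschitz hL hlip _ _).trans (le_of_eq ?_)
      rw [add_sub_cancel_left]
    set a := u (inner ℝ W (feature d (S i).1))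
    set b := u (inner ℝ v (feature d (S i).1))
    set c := f (S i).1
    nlinarith [sq_nonneg ((a - g i) - (g i - c)), sq_nonneg ((a - g i) - (c - b)),
      sq_nonneg ((g i - c) - (c - b))]
  have h3 := mul_le_mul_of_nonneg_left (Finset.sum_le_sum hpt) (by positivity : 0 ≤ 1 / (m : ℝ))
  rw [← Finset.mul_sum, Finset.sum_add_distrib, Finset.sum_add_distrib, ← Finset.mul_sum] at h3
  simp only [Finset.sum_const, Finset.card_univ, Fintype.card_fin, nsmul_eq_mul] at h3
  have e : 1 / (m : ℝ) * (3 * (m * (εK * T) ^ 2 + ∑ i, (f (S i).1 - g i) ^ 2 +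
      L * ∑ i, |ξ (S i).1|)) = 3 * ((εK * T) ^ 2 + 1 / (m : ℝ) * ∑ i, (f (S i).1 - g i) ^ 2 +
      L * (1 / (m : ℝ) * ∑ i, |ξ (S i).1|)) := by field_simp
  rw [e] at h3
  have e2 : 12 * L ^ 2 * B ^ 2 / T = 6 * (2 * L ^ 2 * B ^ 2 / T) := by ring
  rw [e2]
  linarith

theorem abs_avg_sq_sub_avg_sq_le {m : ℕ} (hm : 1 ≤ m) {g h b : Fin m → ℝ} {κ : ℝ}
    (hg : ∀ i, g i ∈ Set.Icc (0 : ℝ) 1) (hh : ∀ i, h i ∈ Set.Icc (0 : ℝ) 1)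
    (hb : ∀ i, b i ∈ Set.Icc (0 : ℝ) 1) (hκ : ∀ i, |g i - h i| ≤ κ) :
    |(1 / (m : ℝ)) * ∑ i, (g i - b i) ^ 2 - (1 / (m : ℝ)) * ∑ i, (h i - b i) ^ 2| ≤ 2 * κ := by
  have hm0 : (0 : ℝ) < m := by exact_mod_cast hm
  rw [← mul_sub, ← Finset.sum_sub_distrib, abs_mul, abs_of_pos (by positivity), one_div,
    inv_mul_le_iff₀ hm0]
  have hpt : ∀ i ∈ Finset.univ, |(g i - b i) ^ 2 - (h i - b i) ^ 2| ≤ 2 * κ := by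
    intro i _
    have e : (g i - b i) ^ 2 - (h i - b i) ^ 2 = ((g i - b i) + (h i - b i)) * (g i - h i) := by
      ring
    rw [e, abs_mul]
    have h1 := abs_sub_le_one_of_mem (hg i) (hb i)
    have h2 := abs_sub_le_one_of_mem (hh i) (hb i)
    have h3 := abs_add_le (g i - b i) (h i - b i)
    exact mul_le_mul (by linarith) (hκ i) (abs_nonneg _) (by norm_num)
  refine (Finset.abs_sum_le_sum_abs _ _).trans ((Finset.sum_le_sum hpt).trans (le_of_eq ?_))
  simp

/-- The validation sample `V` estimates the error of `h` well. -/
def ValidationAccurate {n m₂ : ℕ} (D : Measure (Vec n × ℝ)) (f : Vec n → ℝ) (η : ℝ)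
    (V : Fin m₂ → Vec n × ℝ) (h : Vec n → ℝ) : Prop :=
  ¬ (2 * ((1 / (m₂ : ℝ)) * ∑ i, ((h (V i).1 - (V i).2) ^ 2 - (f (V i).1 - (V i).2) ^ 2)) +
        16 * η < ∫ p, (h p.1 - f p.1) ^ 2 ∂D ∨
      2 * ∫ p, (h p.1 - f p.1) ^ 2 ∂D + 8 * η <
        (1 / (m₂ : ℝ)) * ∑ i, ((h (V i).1 - (V i).2) ^ 2 - (f (V i).1 - (V i).2) ^ 2))

/-- The loss of `f` is common to all candidates, so minimizing the validation loss minimizes the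
excess loss up to `4 εK T`; the two relative deviation bounds convert excess losses to errors and
back. -/
theorem genError_output_le {n d m m₂ : ℕ} (D : Measure (Vec n × ℝ)) (hm : 1 ≤ m) (hm₂ : 1 ≤ m₂)
    {u : ℝ → ℝ} {L εK η : ℝ} (hL : 0 < L) (hεK : 0 ≤ εK) (hu : ∀ s, u s ∈ Set.Icc (0 : ℝ) 1)
    (hlip : LipschitzWith L.toNNReal u) {f : Vec n → ℝ}
    (hreg : regression D =ᵐ[D] fun p => f p.1) {S : Fin m → Vec n × ℝ}
    (hS : ∀ i, ‖(S i).1‖ ≤ 1 ∧ (S i).2 ∈ Set.Icc (0 : ℝ) 1) {V : Fin m₂ → Vec n × ℝ}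
    (hV : ∀ i, ‖(V i).1‖ ≤ 1 ∧ (V i).2 ∈ Set.Icc (0 : ℝ) 1) (K : Fin m → Fin m → ℝ)
    {K' : Fin m₂ → Fin m → ℝ} (hK' : ∀ i j, |K' i j - mkernel d (V i).1 (S j).1| ≤ εK) {T : ℕ}
    (hval : ∀ t < T, ValidationAccurate D f η V (hypothesis d u (fun i => (S i).1)
      (iterate u (1 / L) (fun i => (S i).2) K t)))
    {s t : ℕ} (hs : s < T)
    (ht : IsOutputIndex u (1 / L) T (fun i => (S i).2) (fun i => (V i).2) K K' t) :
    genError D (hypothesis d u (fun i => (S i).1) (iterate u (1 / L) (fun i => (S i).2) K t)) ≤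
      4 * genError D (hypothesis d u (fun i => (S i).1)
        (iterate u (1 / L) (fun i => (S i).2) K s)) + 8 * (εK * T) + 32 * η := by
  have hcmp : ∀ t < T, |valLoss u (fun i => (V i).2) K' (iterate u (1 / L) (fun i => (S i).2) K t) -
      (1 / (m₂ : ℝ)) * ∑ i, (hypothesis d u (fun i => (S i).1)
        (iterate u (1 / L) (fun i => (S i).2) K t) (V i).1 - (V i).2) ^ 2| ≤ 2 * (εK * T) :=
    fun t ht => abs_avg_sq_sub_avg_sq_le hm₂ (fun i => hu _) (fun i => hu _) (fun i => (hV i).2)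
      fun i => abs_eval_sub_hypothesis_le hm hL hu hlip (fun i => (hS i).2)
        (fun i => (S i).1) K ht hεK (hK' i)
  have c1 := abs_le.1 (hcmp t ht.1)
  have c2 := abs_le.1 (hcmp s hs)
  have hmin := ht.2 s hs
  have v1 := hval t ht.1
  have v2 := hval s hs
  rw [genError_eq D hreg, genError_eq D hreg]
  simp only [ValidationAccurate, Finset.sum_sub_distrib, mul_sub, not_or, not_lt] at v1 v2
  linarith [v1.1, v2.2]

/-- Fubini: for fixed `z` the hypotheses do not depend on `V`, so the single-hypothesis bound can be
summed over `t < T`. Each `t` has two tails of probability `δ / (2T)`. -/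
theorem lintegral_validation_failure_le {n m₂ : ℕ} {Z : Type*} [MeasurableSpace Z] (ρ : Measure Z)
    [IsProbabilityMeasure ρ] (D : Measure (Vec n × ℝ)) [IsProbabilityMeasure D] (hm₂ : 1 ≤ m₂)
    (hy : ∀ᵐ p ∂D, p.2 ∈ Set.Icc (0 : ℝ) 1) {f : Vec n → ℝ}
    (hf1 : ∀ x, f x ∈ Set.Icc (0 : ℝ) 1) (hf : Measurable f)
    (hreg : regression D =ᵐ[D] fun p => f p.1) {h : ℕ → Z → Vec n → ℝ}
    (hh : ∀ t, Measurable fun q : Z × Vec n => h t q.1 q.2)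
    (hh1 : ∀ t z x, h t z x ∈ Set.Icc (0 : ℝ) 1) {T : ℕ} (hT : 1 ≤ T) {δ : ℝ} (hδ : 0 < δ) :
    ∫⁻ V, ρ {z | ∃ t < T, ¬ ValidationAccurate D f (Real.log (1 / (δ / (2 * T))) / m₂) V (h t z)}
      ∂(Measure.pi fun _ : Fin m₂ => D) ≤ ENNReal.ofReal δ := by
  have hT0 : (0 : ℝ) < T := by exact_mod_cast hT
  set P := Measure.pi fun _ : Fin m₂ => D
  set η := Real.log (1 / (δ / (2 * T))) / (m₂ : ℝ) with hη
  set bad : Set ((Fin m₂ → Vec n × ℝ) × Z) :=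
    {q | ∃ t < T, ¬ ValidationAccurate D f η q.1 (h t q.2)} with hbad
  have hmeas : MeasurableSet bad := by
    have e : bad = ⋃ t ∈ Finset.range T, {q | ¬ ValidationAccurate D f η q.1 (h t q.2)} := by
      ext q; simp [hbad]
    rw [e]
    refine Finset.measurableSet_biUnion _ fun t _ => ?_
    simp only [ValidationAccurate, not_not]
    have m1 : Measurable fun q : (Fin m₂ → Vec n × ℝ) × Z =>
        ∫ p, (h t q.2 p.1 - f p.1) ^ 2 ∂D := by
      have m2 : Measurable fun r : Z × (Vec n × ℝ) => (h t r.1 r.2.1 - f r.2.1) ^ 2 :=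
        (((hh t).comp (measurable_fst.prodMk (measurable_fst.comp measurable_snd))).sub
          (hf.comp (measurable_fst.comp measurable_snd))).pow_const 2
      have m3 := (m2.stronglyMeasurable.integral_prod_right' (ν := D)).measurable
      exact m3.comp measurable_snd
    have m4 : Measurable fun q : (Fin m₂ → Vec n × ℝ) × Z =>
        (1 / (m₂ : ℝ)) * ∑ i, ((h t q.2 (q.1 i).1 - (q.1 i).2) ^ 2 -
          (f (q.1 i).1 - (q.1 i).2) ^ 2) := by
      refine (Finset.measurable_sum _ fun i _ => ?_).const_mul _
      have mi : Measurable fun q : (Fin m₂ → Vec n × ℝ) × Z => q.1 i :=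
        (measurable_pi_apply i).comp measurable_fst
      exact ((((hh t).comp (measurable_snd.prodMk (measurable_fst.comp mi))).sub
        (measurable_snd.comp mi)).pow_const 2).sub
        (((hf.comp (measurable_fst.comp mi)).sub (measurable_snd.comp mi)).pow_const 2)
    exact (measurableSet_lt ((m4.const_mul 2).add_const _) m1).union
      (measurableSet_lt ((m1.const_mul 2).add_const _) m4)
  have hslice : ∀ z, P {V | (V, z) ∈ bad} ≤ ENNReal.ofReal δ := by
    intro z
    have e : {V | (V, z) ∈ bad} =
        ⋃ t ∈ Finset.range T, {V | ¬ ValidationAccurate D f η V (h t z)} := by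
      ext V; simp [hbad]
    rw [e]
    refine (measure_biUnion_finset_le _ _).trans ?_
    have h1 : ∀ t ∈ Finset.range T, P {V | ¬ ValidationAccurate D f η V (h t z)} ≤
        ENNReal.ofReal (2 * (δ / (2 * T))) := by
      intro t _
      have mh : Measurable (h t z) := (hh t).comp measurable_prodMk_left
      have horth := integral_mul_sub_regression_eq_zero D hy hf1 hf hreg
        (φ := fun x => h t z x - f x) (mh.sub hf) (M := 1)
        (ae_of_all _ fun p => abs_sub_le_one_of_mem (hh1 t z p.1) (hf1 p.1))
      have h2 := measure_excess_loss_deviation_le D (h := fun p => h t z p.1)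
        (f := fun p => f p.1) (y := fun p => p.2) (mh.comp measurable_fst)
        (hf.comp measurable_fst) measurable_snd (ae_of_all _ fun p => hh1 t z p.1)
        (ae_of_all _ fun p => hf1 p.1) hy horth (δ := δ / (2 * T)) (by positivity) hm₂
      simp only [ValidationAccurate, not_not, hη]
      simp only [mul_div_assoc] at h2 ⊢
      exact h2
    refine (Finset.sum_le_sum h1).trans (le_of_eq ?_)
    rw [Finset.sum_const, Finset.card_range, nsmul_eq_mul, ← ENNReal.ofReal_natCast,
      ← ENNReal.ofReal_mul (Nat.cast_nonneg _)]
    congr 1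
    field_simp
  have h1 : ∫⁻ V, ρ {z | (V, z) ∈ bad} ∂P = (P.prod ρ) bad := (Measure.prod_apply hmeas).symm
  change ∫⁻ V, ρ {z | (V, z) ∈ bad} ∂P ≤ _
  rw [h1, Measure.prod_apply_symm hmeas]
  refine (lintegral_mono hslice).trans ?_
  simp

/-! ### The probability of a bad run -/

theorem pi_exists_inaccurate_le {n : ℕ} {ι : Type*} [Fintype ι] {est : Vec n → Vec n → Measure ℝ}
    [∀ x y, IsProbabilityMeasure (est x y)] {e p : ℝ}
    (hacc : ∀ x y, ‖x‖ ≤ 1 → ‖y‖ ≤ 1 → est x y {z | e < |z - inner ℝ x y|} ≤ ENNReal.ofReal p)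
    {a b : ι → Vec n} (ha : ∀ q, ‖a q‖ ≤ 1) (hb : ∀ q, ‖b q‖ ≤ 1) :
    (Measure.pi fun q => est (a q) (b q)) {z | ∃ q, e < |z q - inner ℝ (a q) (b q)|} ≤
      ENNReal.ofReal (Fintype.card ι * p) := by
  have h0 : {z : ι → ℝ | ∃ q, e < |z q - inner ℝ (a q) (b q)|} =
      ⋃ q ∈ Finset.univ, {z | e < |z q - inner ℝ (a q) (b q)|} := by
    ext z; simp
  rw [h0]
  refine (measure_biUnion_finset_le _ _).trans ?_
  have h1 : ∀ q ∈ Finset.univ, (Measure.pi fun q => est (a q) (b q))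
      {z | e < |z q - inner ℝ (a q) (b q)|} ≤ ENNReal.ofReal p := by
    intro q _
    have hm : MeasurableSet {z : ℝ | e < |z - inner ℝ (a q) (b q)|} :=
      measurableSet_lt measurable_const (measurable_id.sub_const _).abs
    have h2 := (measurePreserving_eval (fun q => est (a q) (b q)) q).measure_preimage
      hm.nullMeasurableSet
    exact h2.le.trans (hacc _ _ (ha q) (hb q))
  refine (Finset.sum_le_sum h1).trans (le_of_eq ?_)
  rw [Finset.sum_const, Finset.card_univ, nsmul_eq_mul, ← ENNReal.ofReal_natCast,
    ← ENNReal.ofReal_mul (Nat.cast_nonneg _)]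

theorem runProb_le_one {n : ℕ} (D : Measure (Vec n × ℝ)) [IsProbabilityMeasure D] (m₁ m₂ : ℕ)
    (est : Vec n → Vec n → Measure ℝ) [∀ x y, IsProbabilityMeasure (est x y)]
    (bad : (Fin m₁ → Vec n × ℝ) → (Fin m₂ → Vec n × ℝ) →
      (Fin m₁ × Fin m₁ → ℝ) → (Fin m₂ × Fin m₁ → ℝ) → Prop) : runProb D m₁ m₂ est bad ≤ 1 := by
  unfold runProb
  refine (lintegral_mono fun S => lintegral_mono fun V => prob_le_one).trans ?_
  simp

/-- Union bound over the training sample, validation and the estimates. `badVal` does not involve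
`z'`, whose law depends on `V`; this keeps Fubini available for `hbadVal`. Only upper bounds for
integrals and measures are used, so `bad` and `A` need not be measurable. -/
theorem runProb_le {n : ℕ} (D : Measure (Vec n × ℝ)) [IsProbabilityMeasure D]
    (hsupp : ∀ᵐ p ∂D, ‖p.1‖ ≤ 1 ∧ p.2 ∈ Set.Icc (0 : ℝ) 1) (m₁ m₂ : ℕ)
    (est : Vec n → Vec n → Measure ℝ) [∀ x y, IsProbabilityMeasure (est x y)] {e p : ℝ}
    (hp : 0 ≤ p)
    (hacc : ∀ x y, ‖x‖ ≤ 1 → ‖y‖ ≤ 1 → est x y {z | e < |z - inner ℝ x y|} ≤ ENNReal.ofReal p)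
    (bad : (Fin m₁ → Vec n × ℝ) → (Fin m₂ → Vec n × ℝ) →
      (Fin m₁ × Fin m₁ → ℝ) → (Fin m₂ × Fin m₁ → ℝ) → Prop)
    {A : Set (Fin m₁ → Vec n × ℝ)} {a b : ℝ≥0∞} (hA : (Measure.pi fun _ : Fin m₁ => D) A ≤ a)
    (hAs : ∀ S ∉ A, ∀ i, ‖(S i).1‖ ≤ 1)
    (badVal : (Fin m₁ → Vec n × ℝ) → (Fin m₂ → Vec n × ℝ) → (Fin m₁ × Fin m₁ → ℝ) → Prop)
    (hbadVal : ∀ S ∉ A, ∫⁻ V, (Measure.pi fun q : Fin m₁ × Fin m₁ => est (S q.1).1 (S q.2).1)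
      {z | badVal S V z} ∂(Measure.pi fun _ : Fin m₂ => D) ≤ b)
    (himp : ∀ S ∉ A, ∀ V : Fin m₂ → Vec n × ℝ,
      (∀ i, ‖(V i).1‖ ≤ 1 ∧ (V i).2 ∈ Set.Icc (0 : ℝ) 1) → ∀ z z',
      (∀ q, |z q - inner ℝ (S q.1).1 (S q.2).1| ≤ e) →
      (∀ q, |z' q - inner ℝ (V q.1).1 (S q.2).1| ≤ e) → bad S V z z' → badVal S V z) :
    runProb D m₁ m₂ est bad ≤
      a + (b + ENNReal.ofReal (((m₁ : ℝ) ^ 2 + (m₁ : ℝ) * m₂) * p)) := by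
  unfold runProb
  set c := ENNReal.ofReal (((m₁ : ℝ) ^ 2 + (m₁ : ℝ) * m₂) * p) with hc
  have hgood : ∀ S ∉ A, ∫⁻ V,
      ((Measure.pi fun q : Fin m₁ × Fin m₁ => est (S q.1).1 (S q.2).1).prod
        (Measure.pi fun q : Fin m₂ × Fin m₁ => est (V q.1).1 (S q.2).1))
        {w | bad S V w.1 w.2} ∂(Measure.pi fun _ : Fin m₂ => D) ≤ b + c := by
    intro S hS
    set μ := Measure.pi fun q : Fin m₁ × Fin m₁ => est (S q.1).1 (S q.2).1
    have h1 : ∫⁻ V, (μ.prod (Measure.pi fun q : Fin m₂ × Fin m₁ => est (V q.1).1 (S q.2).1))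
        {w | bad S V w.1 w.2} ∂(Measure.pi fun _ : Fin m₂ => D) ≤
        ∫⁻ V, (μ {z | badVal S V z} + c) ∂(Measure.pi fun _ : Fin m₂ => D) := by
      refine lintegral_mono_ae ?_
      filter_upwards [ae_pi_forall (ι := Fin m₂) D hsupp] with V hV
      set ν := Measure.pi fun q : Fin m₂ × Fin m₁ => est (V q.1).1 (S q.2).1
      have hsub : {w : (Fin m₁ × Fin m₁ → ℝ) × (Fin m₂ × Fin m₁ → ℝ) | bad S V w.1 w.2} ⊆
          ({z | badVal S V z} ×ˢ Set.univ) ∪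
          (({z | ∃ q : Fin m₁ × Fin m₁, e < |z q - inner ℝ (S q.1).1 (S q.2).1|} ×ˢ Set.univ) ∪
            (Set.univ ×ˢ
              {z | ∃ q : Fin m₂ × Fin m₁, e < |z q - inner ℝ (V q.1).1 (S q.2).1|})) := by
        rintro ⟨z, z'⟩ hw
        by_contra hcon
        simp only [Set.mem_union, Set.mem_prod, Set.mem_ofPred_eq, Set.mem_univ, and_true,
          true_and, not_or, not_exists, not_lt] at hcon
        exact hcon.1 (himp S hS V hV z z' hcon.2.1 hcon.2.2 hw)
      refine (measure_mono hsub).trans ((measure_union_le _ _).trans ?_)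
      rw [Measure.prod_prod, measure_univ, mul_one]
      refine add_le_add le_rfl ((measure_union_le _ _).trans ?_)
      rw [Measure.prod_prod, Measure.prod_prod, measure_univ, measure_univ, mul_one, one_mul]
      have k1 := pi_exists_inaccurate_le hacc (a := fun q : Fin m₁ × Fin m₁ => (S q.1).1)
        (b := fun q => (S q.2).1) (fun q => hAs S hS q.1) fun q => hAs S hS q.2
      have k2 := pi_exists_inaccurate_le hacc (a := fun q : Fin m₂ × Fin m₁ => (V q.1).1)
        (b := fun q => (S q.2).1) (fun q => (hV q.1).1) fun q => hAs S hS q.2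
      refine (add_le_add k1 k2).trans (le_of_eq ?_)
      rw [← ENNReal.ofReal_add (by positivity) (by positivity), hc]
      congr 1
      simp only [Fintype.card_prod, Fintype.card_fin]
      push_cast
      ring
    refine h1.trans ?_
    rw [lintegral_add_right _ measurable_const, lintegral_const, measure_univ, mul_one]
    exact add_le_add (hbadVal S hS) le_rfl
  calc _ ≤ ∫⁻ S, (A.indicator (fun _ => (1 : ℝ≥0∞)) S + (b + c))
        ∂(Measure.pi fun _ : Fin m₁ => D) := by
        refine lintegral_mono fun S => ?_
        by_cases hS : S ∈ A
        · rw [Set.indicator_of_mem hS]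
          refine le_trans ?_ le_self_add
          refine (lintegral_mono fun V => prob_le_one).trans ?_
          simp
        · rw [Set.indicator_of_notMem hS, zero_add]
          exact hgood S hS
    _ ≤ a + (b + c) := by
        rw [lintegral_add_right _ measurable_const, lintegral_const, measure_univ, mul_one]
        refine add_le_add ((lintegral_indicator_const_le _ _).trans ?_) le_rfl
        rwa [one_mul]

theorem measurable_iterate {m : ℕ} {u : ℝ → ℝ} (hu : Measurable u) (lam : ℝ) (y : Fin m → ℝ)
    {Z : Type*} [MeasurableSpace Z] {K : Z → Fin m → Fin m → ℝ}
    (hK : ∀ i j, Measurable fun z => K z i j) (t : ℕ) (i : Fin m) :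
    Measurable fun z => iterate u lam y (K z) t i := by
  induction t generalizing i with
  | zero => exact measurable_const
  | succ t ih =>
    simp only [iterate]
    refine (ih i).add ((Measurable.const_sub (hu.comp ?_) _).const_mul _)
    exact Finset.measurable_sum _ fun j _ => (ih j).mul (hK i j)

theorem measurable_kernelPoly (d : ℕ) : Measurable (kernelPoly d) := by
  have : Continuous (kernelPoly d) := by
    unfold kernelPoly
    fun_prop
  exact this.measurable

theorem measurable_hypothesis_iterate {n m d : ℕ} {u : ℝ → ℝ} (hu : Measurable u) (lam : ℝ)
    (y : Fin m → ℝ) (x : Fin m → Vec n) (t : ℕ) :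
    Measurable fun q : (Fin m × Fin m → ℝ) × Vec n =>
      hypothesis d u x (iterate u lam y (fun i j => kernelPoly d (q.1 (i, j))) t) q.2 := by
  unfold hypothesis
  refine hu.comp (Finset.measurable_sum _ fun i _ => Measurable.mul ?_ ?_)
  · exact (measurable_iterate hu lam y (K := fun (z : Fin m × Fin m → ℝ) i j =>
      kernelPoly d (z (i, j))) (fun i j => (measurable_kernelPoly d).comp
        (measurable_pi_apply (i, j))) t i).comp measurable_fst
  · exact ((measurable_feature d).comp measurable_snd).inner measurable_const

/-! ### Parameters -/

/-- For `δ ≤ 1/3` a constant is at most a power of `1/δ`, so constants inside logarithms become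
factors outside. -/
theorem log_div_le_mul_log {δ : ℝ} (hδ : 0 < δ) (hδ3 : δ ≤ 1 / 3) {c : ℝ} (hc : 0 < c) {k : ℕ}
    (hck : c ≤ 3 ^ k) : Real.log (c / δ) ≤ (k + 1) * Real.log (1 / δ) := by
  have h3 : 3 ≤ 1 / δ := by rw [le_div_iff₀ hδ]; linarith
  have h1 : c / δ ≤ (1 / δ) ^ (k + 1) := by
    have : c / δ = c * (1 / δ) := by ring
    rw [this, pow_succ]
    exact mul_le_mul_of_nonneg_right (hck.trans (pow_le_pow_left₀ (by norm_num) h3 k))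
      (by positivity)
  have h2 := Real.log_le_log (by positivity) h1
  rw [Real.log_pow] at h2
  push_cast at h2
  exact h2

theorem total_error_le {C C' B L ζ ε δ κ a τ τ₁ : ℝ} {m T : ℕ} (hC : 1 ≤ C) (hC' : 1 ≤ C')
    (hm : 1 ≤ m) (hB : 0 < B) (hL : 0 < L) (hζ : 0 < ζ) (hδ : 0 < δ) (hδ3 : δ ≤ 1 / 3)
    (hκ : 0 ≤ κ) (hT : C * B * L * √((m : ℝ) / Real.log (1 / δ)) ≤ T)
    (hlarge : 1 ≤ C * B * L * √((m : ℝ) / Real.log (1 / δ)))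
    (hsmall : Real.log (1 / δ) / m ≤ 1)
    (ha : a ≤ 2 * √ε + ζ * (Real.log (1 / (δ / 3)) / m))
    (hτ : τ = B * √(8 * Real.log (2 / (δ / 3)) / m))
    (hτ₁ : τ₁ = B * (2 * L) * √(8 * Real.log (2 / (δ / 3)) / m)) :
    4 * (30 * L * a + 24 * κ + 24 * L * τ + 36 * (τ / B) ^ 2 + 12 * L ^ 2 * B ^ 2 / T +
      6 * κ ^ 2 + 2 * τ₁ + 2 * (L * √ε)) + 8 * κ + 32 * (2 / (C' * m)) ≤
      5000 * C * (errA2 B L ζ ε δ m + κ ^ 2 + κ) := by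
  have hm0 : (0 : ℝ) < m := by exact_mod_cast hm
  set ℓ := Real.log (1 / δ) with hℓ
  have hℓ1 : 1 ≤ ℓ := by
    rw [hℓ, Real.le_log_iff_exp_le (by positivity), le_div_iff₀ hδ]
    have := Real.exp_one_lt_d9
    nlinarith [Real.exp_pos 1]
  have hℓ0 : 0 < ℓ := by linarith
  set q := √(ℓ / m) with hq
  have hq0 : 0 < q := by positivity
  have hq2 : q ^ 2 = ℓ / m := Real.sq_sqrt (by positivity)
  have hqinv : √((m : ℝ) / ℓ) * q ^ 2 = q := by
    have : √((m : ℝ) / ℓ) * q = 1 := by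
      rw [hq, ← Real.sqrt_mul (by positivity)]
      have : (m : ℝ) / ℓ * (ℓ / m) = 1 := by field_simp
      rw [this, Real.sqrt_one]
    calc _ = (√((m : ℝ) / ℓ) * q) * q := by ring
      _ = q := by rw [this, one_mul]
  set b := B * L * q with hb
  have hb0 : 0 < b := by positivity
  -- Where `C B L √(m/ℓ) ≥ 1`, terms of order `ℓ/m` are dominated by `C B L √(ℓ/m)`. This absorbs
  -- `(τ/B)²` and the validation error.
  have hq2b : q ^ 2 ≤ C * b := by
    have := mul_le_mul_of_nonneg_right hlarge (sq_nonneg q)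
    rw [one_mul, mul_assoc, hqinv] at this
    rw [hb]; linarith
  set ρ := (ℓ / m) ^ (1 / 4 : ℝ) with hρ
  have hρ0 : 0 ≤ ρ := by positivity
  -- The analysis gives `ζ ℓ/m`; the fourth root in `errA2` is weaker because `ℓ/m ≤ 1`.
  have hρq : ℓ / m ≤ ρ := by
    have := Real.rpow_le_rpow_of_exponent_ge (x := ℓ / m) (by positivity) hsmall
      (y := 1) (z := 1 / 4) (by norm_num)
    rwa [Real.rpow_one] at this
  have hA : errA2 B L ζ ε δ m = L * √ε + L * ζ * ρ + b := rfl
  have hlog3 : Real.log (1 / (δ / 3)) ≤ 2 * ℓ := by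
    have h := log_div_le_mul_log hδ hδ3 (c := 3) (by norm_num) (k := 1) (by norm_num)
    have e : 1 / (δ / 3) = 3 / δ := by field_simp
    rw [e]; push_cast at h; linarith
  have hlog6 : Real.log (2 / (δ / 3)) ≤ 3 * ℓ := by
    have h := log_div_le_mul_log hδ hδ3 (c := 6) (by norm_num) (k := 2) (by norm_num)
    have e : 2 / (δ / 3) = 6 / δ := by field_simp; norm_num
    rw [e]; push_cast at h; linarith
  set r := √(8 * Real.log (2 / (δ / 3)) / m) with hr
  have hr0 : 0 ≤ r := Real.sqrt_nonneg _
  have hr5 : r ≤ 5 * q := by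
    rw [hr, Real.sqrt_le_left (by positivity), mul_pow, hq2, mul_div_assoc']
    exact div_le_div_of_nonneg_right (by linarith) hm0.le
  have hr25 : r ^ 2 ≤ 25 * (C * b) := by
    have := pow_le_pow_left₀ hr0 hr5 2
    nlinarith
  have h1 : L * a ≤ 2 * (L * √ε) + 2 * (L * ζ * ρ) := by
    have h2 : Real.log (1 / (δ / 3)) / m ≤ 2 * ρ := by
      have : Real.log (1 / (δ / 3)) / m ≤ 2 * ℓ / m := div_le_div_of_nonneg_right hlog3 hm0.le
      rw [mul_div_assoc] at this
      linarith
    have h3 := mul_le_mul_of_nonneg_left h2 hζ.le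
    have h4 := mul_le_mul_of_nonneg_left (ha.trans (add_le_add le_rfl h3)) hL.le
    linarith
  have h2 : L * τ ≤ 5 * b := by
    rw [hτ, hb]
    have := mul_le_mul_of_nonneg_left hr5 (mul_pos hB hL).le
    linarith
  have h3 : (τ / B) ^ 2 ≤ 25 * (C * b) := by
    rw [hτ, mul_div_cancel_left₀ _ hB.ne']; exact hr25
  have h4 : 12 * L ^ 2 * B ^ 2 / T ≤ 12 * b := by
    have hT0 : (0 : ℝ) < T := lt_of_lt_of_le one_pos (hlarge.trans hT)
    rw [div_le_iff₀ hT0]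
    have h5 : L * B * √((m : ℝ) / ℓ) ≤ T := by
      refine le_trans ?_ hT
      have : 0 ≤ L * B * √((m : ℝ) / ℓ) := by positivity
      exact (le_mul_of_one_le_left this hC).trans (le_of_eq (by ring))
    have h6 := mul_le_mul_of_nonneg_left h5 (by positivity : 0 ≤ 12 * b)
    refine le_trans (le_of_eq ?_) h6
    have h7 : √((m : ℝ) / ℓ) * q = 1 := by
      have := mul_right_cancel₀ hq0.ne' (show (√((m : ℝ) / ℓ) * q) * q = 1 * q by
        rw [mul_assoc, ← sq, hqinv, one_mul])
      exact this
    calc 12 * L ^ 2 * B ^ 2 = 12 * L ^ 2 * B ^ 2 * (√((m : ℝ) / ℓ) * q) := by rw [h7, mul_one]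
      _ = _ := by rw [hb]; ring
  have h5 : τ₁ ≤ 10 * b := by
    rw [hτ₁, hb]
    have := mul_le_mul_of_nonneg_left hr5 (by positivity : 0 ≤ B * (2 * L))
    linarith
  have h6 : 32 * (2 / (C' * m)) ≤ 64 * (C * b) := by
    have : 2 / (C' * m) ≤ 2 * (ℓ / m) := by
      rw [mul_div_assoc', div_le_div_iff₀ (by positivity) hm0]
      have h7 := mul_le_mul_of_nonneg_right (one_le_mul_of_one_le_of_one_le hC' hℓ1) hm0.le
      linarith
    rw [hq2] at hq2b
    linarith
  rw [hA]
  have hCle : ∀ x : ℝ, 0 ≤ x → x ≤ C * x := fun x hx => le_mul_of_one_le_left hx hC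
  have hCb : b ≤ C * b := hCle b hb0.le
  have z1 : 0 ≤ L * √ε := by positivity
  have z2 : 0 ≤ L * ζ * ρ := by positivity
  have g1 := hCle _ z1
  have g2 := hCle _ z2
  have g3 := hCle _ hκ
  have g4 := hCle _ (sq_nonneg κ)
  have z4 := sq_nonneg κ
  have e : 5000 * C * (L * √ε + L * ζ * ρ + b + κ ^ 2 + κ) = 5000 * (C * (L * √ε)) +
    5000 * (C * (L * ζ * ρ)) + 5000 * (C * b) + 5000 * (C * κ ^ 2) + 5000 * (C * κ) := by ring
  rw [e]
  linarith

/-! ### Degenerate parameter ranges and assembly of the bound -/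

theorem runProb_eq_zero {n : ℕ} (D : Measure (Vec n × ℝ)) (m₁ m₂ : ℕ)
    (est : Vec n → Vec n → Measure ℝ)
    {bad : (Fin m₁ → Vec n × ℝ) → (Fin m₂ → Vec n × ℝ) →
      (Fin m₁ × Fin m₁ → ℝ) → (Fin m₂ × Fin m₁ → ℝ) → Prop}
    (h : ∀ S V z z', ¬ bad S V z z') : runProb D m₁ m₂ est bad = 0 := by
  simp [runProb, h]

theorem log_div_le_of_one_le {C B L ℓ m : ℝ} (hℓ : 0 < ℓ) (hm : 0 < m)
    (h : 1 ≤ C * B * L * √(m / ℓ)) : ℓ / m ≤ C * (B * L * √(ℓ / m)) := by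
  have h1 : √(m / ℓ) * √(ℓ / m) = 1 := by
    rw [← Real.sqrt_mul (by positivity)]
    have : m / ℓ * (ℓ / m) = 1 := by field_simp
    rw [this, Real.sqrt_one]
  have h2 : √(ℓ / m) * √(ℓ / m) = ℓ / m := Real.mul_self_sqrt (by positivity)
  have h3 := mul_le_mul_of_nonneg_right h (by positivity : 0 ≤ ℓ / m)
  rw [one_mul] at h3
  refine h3.trans (le_of_eq ?_)
  calc _ = C * B * L * √(m / ℓ) * (√(ℓ / m) * √(ℓ / m)) := by rw [h2]
    _ = C * B * L * (√(m / ℓ) * √(ℓ / m)) * √(ℓ / m) := by ring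
    _ = _ := by rw [h1]; ring

theorem genError_hypothesis_zero_le {n m d : ℕ} (D : Measure (Vec n × ℝ))
    [IsProbabilityMeasure D] (hsupp : ∀ᵐ p ∂D, ‖p.1‖ ≤ 1 ∧ p.2 ∈ Set.Icc (0 : ℝ) 1)
    {u : ℝ → ℝ} {L B ζ ε : ℝ} (hL : 0 < L)
    (hu : ∀ s, u s ∈ Set.Icc (0 : ℝ) 1) (hlip : LipschitzWith L.toNNReal u)
    {v : Feat n d} (hv : ‖v‖ ≤ B) {ξ : Vec n → ℝ} (hξ : Measurable ξ)
    (hξζ : ∀ x, ξ x ∈ Set.Icc (-ζ) ζ) (hξε : ∫ p, ξ p.1 ^ 2 ∂D ≤ ε) {f : Vec n → ℝ}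
    (hf : ∀ x, f x = u (inner ℝ v (feature d x) + ξ x))
    (hreg : regression D =ᵐ[D] fun p => f p.1) (x : Fin m → Vec n) :
    genError D (hypothesis d u x 0) ≤ 2 * (L * B) ^ 2 + 2 * (L * √ε) := by
  have h0 : weight d x 0 = 0 := by simp [weight]
  rw [hypothesis_eq, h0]
  refine (genError_le_two_mul_add D hL hu hlip hξ hξζ hξε hf hreg 0).trans ?_
  refine add_le_add (mul_le_mul_of_nonneg_left ?_ zero_le_two) le_rfl
  have h1 : ∫ p, (u (inner ℝ 0 (feature d p.1)) - u (inner ℝ v (feature d p.1))) ^ 2 ∂D ≤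
      ∫ _, (L * B) ^ 2 ∂D := by
    refine integral_mono_of_nonneg (ae_of_all _ fun _ => sq_nonneg _) (integrable_const _) ?_
    filter_upwards [hsupp] with p hp
    rw [← sq_abs]
    refine pow_le_pow_left₀ (abs_nonneg _) ?_ 2
    refine (abs_sub_le_of_lipschitz hL hlip _ _).trans (mul_le_mul_of_nonneg_left ?_ hL.le)
    rw [inner_zero_left, zero_sub, abs_neg]
    exact (abs_real_inner_le_norm _ _).trans
      ((mul_le_of_le_one_right (norm_nonneg _) (norm_feature_le d hp.1)).trans hv)
  simpa using h1

/-- For some iterate, the validation sample `V` does not estimate the error of its hypothesis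
well. -/
def ValidationFailure {n m m₂ : ℕ} (D : Measure (Vec n × ℝ)) (f : Vec n → ℝ) (η : ℝ) (d : ℕ)
    (u : ℝ → ℝ) (lam : ℝ) (T : ℕ) (S : Fin m → Vec n × ℝ) (V : Fin m₂ → Vec n × ℝ)
    (z : Fin m × Fin m → ℝ) : Prop :=
  ∃ t < T, ¬ ValidationAccurate D f η V (hypothesis d u (fun i => (S i).1)
    (iterate u lam (fun i => (S i).2) (fun i j => kernelPoly d (z (i, j))) t))

theorem lintegral_validationFailure_le {n m m₂ : ℕ} (ρ : Measure (Fin m × Fin m → ℝ))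
    [IsProbabilityMeasure ρ] (D : Measure (Vec n × ℝ)) [IsProbabilityMeasure D] (hm₂ : 1 ≤ m₂)
    (hy : ∀ᵐ p ∂D, p.2 ∈ Set.Icc (0 : ℝ) 1) {f : Vec n → ℝ}
    (hf1 : ∀ x, f x ∈ Set.Icc (0 : ℝ) 1) (hf : Measurable f)
    (hreg : regression D =ᵐ[D] fun p => f p.1) {u : ℝ → ℝ} (hum : Measurable u)
    (hu : ∀ s, u s ∈ Set.Icc (0 : ℝ) 1) (d : ℕ) (lam : ℝ) (S : Fin m → Vec n × ℝ)
    {T : ℕ} (hT : 1 ≤ T) {δ : ℝ} (hδ : 0 < δ) :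
    ∫⁻ V, ρ {z | ValidationFailure D f (Real.log (1 / (δ / (2 * T))) / m₂) d u lam T S V z}
      ∂(Measure.pi fun _ : Fin m₂ => D) ≤ ENNReal.ofReal δ :=
  lintegral_validation_failure_le ρ D hm₂ hy hf1 hf hreg
    (h := fun t z => hypothesis d u (fun i => (S i).1)
      (iterate u lam (fun i => (S i).2) (fun i j => kernelPoly d (z (i, j))) t))
    (fun t => measurable_hypothesis_iterate hum _ _ _ t) (fun _ _ _ => hu _) hT hδ

theorem runProb_badRun_le {n d m₁ : ℕ} {C C' B L ζ ε δ εK : ℝ} {u : ℝ → ℝ}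
    {D : Measure (Vec n × ℝ)} (hC : 1 ≤ C) (hC' : 1 ≤ C') (hd : 1 ≤ d) (hm : 1 ≤ m₁)
    (hB : 0 < B) (hL : 0 < L) (hζ : 0 < ζ) (hδ : 0 < δ) (hδ1 : δ < 1)
    (hεK : 0 < εK) (hset : LearningSetting d B L ζ ε u D) {T m₂ : ℕ}
    (hT : T = numIter C B L δ m₁) (hm₂ : m₂ = numVal C' δ m₁ T) {bound e p : ℝ}
    (hbound : bound = 5000 * C * (errA2 B L ζ ε δ m₁ + εK ^ 2 * (T : ℝ) ^ 2 + εK * (T : ℝ)))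
    (he : e = εK / (3 * (d : ℝ))) (hp : p = δ / ((m₁ : ℝ) ^ 2 + (m₁ : ℝ) * (m₂ : ℝ)))
    (est : Vec n → Vec n → Measure ℝ) [∀ x y, IsProbabilityMeasure (est x y)]
    (hacc : ∀ x y, ‖x‖ ≤ 1 → ‖y‖ ≤ 1 → est x y {z | e < |z - inner ℝ x y|} ≤ ENNReal.ofReal p) :
    runProb D m₁ m₂ est (BadRun D d u (1 / L) T bound) ≤ ENNReal.ofReal (3 * δ) := by
  obtain ⟨hD, hsupp, hu, hmono, hlip, v, ξ, hv, hξ, hξζ, hξε, hreg⟩ := hset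
  have hm0 : (0 : ℝ) < m₁ := by exact_mod_cast hm
  rcases le_or_gt (1 / 3) δ with hδ3 | hδ3
  · refine (runProb_le_one D m₁ m₂ est _).trans ?_
    rw [← ENNReal.ofReal_one]
    exact ENNReal.ofReal_le_ofReal (by linarith)
  have hum : Measurable u := hlip.continuous.measurable
  set f : Vec n → ℝ := fun x => u (inner ℝ v (feature d x) + ξ x) with hfdef
  have hf : ∀ x, f x = u (inner ℝ v (feature d x) + ξ x) := fun x => rfl
  have hf1 : ∀ x, f x ∈ Set.Icc (0 : ℝ) 1 := fun x => hu _
  have hfm : Measurable f :=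
    hum.comp ((measurable_const.inner (measurable_feature d)).add hξ)
  set ℓ := Real.log (1 / δ) with hℓ
  have hℓ0 : 0 < ℓ := Real.log_pos (by rw [lt_div_iff₀ hδ]; linarith)
  set X := C * B * L * √((m₁ : ℝ) / ℓ) with hX
  have hX0 : 0 < X := by positivity
  have hTX : T = ⌈X⌉₊ := hT
  have hT1 : 1 ≤ T := by rw [hTX]; exact Nat.ceil_pos.2 hX0
  have hXT : X ≤ T := by rw [hTX]; exact Nat.le_ceil X
  set κ := εK * (T : ℝ) with hκ
  have hκ0 : 0 ≤ κ := by positivity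
  set b := B * L * √(ℓ / m₁) with hb
  have hb0 : 0 ≤ b := by positivity
  have hbound' : bound = 5000 * C * ((L * √ε + L * ζ * (ℓ / m₁) ^ (1 / 4 : ℝ) + b) + κ ^ 2 + κ) := by
    rw [hbound, hκ, mul_pow]; rfl
  have hn1 : 0 ≤ L * √ε := by positivity
  have hn2 : 0 ≤ L * ζ * (ℓ / m₁) ^ (1 / 4 : ℝ) := by positivity
  have hlow : 5000 * C * (L * √ε) + 5000 * C * b + 5000 * C * κ ≤ bound := by
    have h1 : 0 ≤ 5000 * C * (L * ζ * (ℓ / m₁) ^ (1 / 4 : ℝ)) := by positivity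
    have h2 : 0 ≤ 5000 * C * κ ^ 2 := by positivity
    rw [hbound']
    linarith
  have hCle : ∀ x : ℝ, 0 ≤ x → x ≤ C * x := fun x hx => le_mul_of_one_le_left hx hC
  -- Errors never exceed `1`. Assuming `bound < 1` henceforth makes `ℓ/m₁`, `κ` and `εK` at most
  -- `1`, as the later estimates require.
  have hlarge : bound < 1 ∨ runProb D m₁ m₂ est (BadRun D d u (1 / L) T bound) = 0 := by
    refine or_iff_not_imp_left.2 fun h => runProb_eq_zero D m₁ m₂ est ?_
    rintro S V z z' ⟨t, -, ht⟩
    have := genError_le_one D hf1 hreg (h := hypothesis d u (fun i => (S i).1)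
      (iterate u (1 / L) (fun i => (S i).2) (fun i j => kernelPoly d (z (i, j))) t))
      fun x => hu _
    linarith
  rcases hlarge with hbd1 | h0
  swap
  · rw [h0]; exact bot_le
  have hC1 := hCle _ hn1
  have hC2 := hCle _ hb0
  have hC3 := hCle _ hκ0
  -- Here `T = 1` and only the zero iterate is available. Its error is of order `(LB)² + L√ε`, and
  -- `X ≤ 1` forces `(LB)² ≤ b`; validation plays no role.
  rcases le_or_gt X 1 with hX1 | hX1
  · have hTone : T = 1 := by
      refine le_antisymm ?_ hT1
      rw [hTX]; exact Nat.ceil_le.2 (by simpa using hX1)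
    rw [runProb_eq_zero D m₁ m₂ est]
    · exact bot_le
    rintro S V z z' ⟨t, ⟨ht, -⟩, hbad⟩
    obtain rfl : t = 0 := by omega
    have h1 := genError_hypothesis_zero_le D hsupp hL hu hlip hv hξ hξζ hξε hf hreg
      fun i => (S i).1
    have h2 : (L * B) ^ 2 ≤ b := by
      have h3 : √((m₁ : ℝ) / ℓ) * √(ℓ / m₁) = 1 := by
        rw [← Real.sqrt_mul (by positivity)]
        have : (m₁ : ℝ) / ℓ * (ℓ / m₁) = 1 := by field_simp
        rw [this, Real.sqrt_one]
      have h4 : L * B * √((m₁ : ℝ) / ℓ) ≤ 1 := by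
        refine le_trans ?_ hX1
        exact (hCle _ (by positivity)).trans (le_of_eq (by rw [hX]; ring))
      calc (L * B) ^ 2 = b * (L * B * √((m₁ : ℝ) / ℓ)) := by
            rw [hb, ← mul_one ((L * B) ^ 2), ← h3]; ring
        _ ≤ b := mul_le_of_le_one_right hb0 h4
    have h3 : genError D (hypothesis d u (fun i => (S i).1) (iterate u (1 / L)
      (fun i => (S i).2) (fun i j => kernelPoly d (z (i, j))) 0)) ≤
      2 * (L * B) ^ 2 + 2 * (L * √ε) := h1
    linarith
  have hsmall : ℓ / m₁ ≤ 1 := by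
    have := log_div_le_of_one_le hℓ0 hm0 hX1.le
    linarith
  have hκ1 : κ ≤ 1 := by linarith
  have hT1' : (1 : ℝ) ≤ T := by exact_mod_cast hT1
  have hεK1 : εK ≤ 1 := (le_mul_of_one_le_right hεK.le hT1').trans hκ1
  have hTδ : 2 ≤ (T : ℝ) / δ := by rw [le_div_iff₀ hδ]; linarith
  have hlogT : 0 < Real.log ((T : ℝ) / δ) := Real.log_pos (by linarith)
  have hm₂le : C' * (m₁ : ℝ) * Real.log ((T : ℝ) / δ) ≤ m₂ := by
    rw [hm₂]; exact Nat.le_ceil _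
  have hm₂0 : (0 : ℝ) < m₂ := lt_of_lt_of_le (by positivity) hm₂le
  have hm₂1 : 1 ≤ m₂ := by exact_mod_cast hm₂0
  set η := Real.log (1 / (δ / (2 * T))) / (m₂ : ℝ) with hη
  -- The logarithm of `2T/δ` is at most twice that of `T/δ` because `T/δ ≥ 2`, and the choice of
  -- `m₂` cancels the logarithm of `T/δ`.
  have hηle : η ≤ 2 / (C' * m₁) := by
    have h1 : Real.log (1 / (δ / (2 * T))) ≤ 2 * Real.log ((T : ℝ) / δ) := by
      have e1 : 1 / (δ / (2 * T)) = 2 * ((T : ℝ) / δ) := by field_simp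
      rw [e1, Real.log_mul (by norm_num) (by positivity)]
      have := Real.log_le_log (by norm_num) hTδ
      linarith
    rw [hη, div_le_div_iff₀ hm₂0 (by positivity)]
    have h2 := mul_le_mul_of_nonneg_right h1 (by positivity : 0 ≤ C' * (m₁ : ℝ))
    linarith
  have hp0 : 0 ≤ p := by rw [hp]; positivity
  have hpsum : ((m₁ : ℝ) ^ 2 + (m₁ : ℝ) * m₂) * p = δ := by
    rw [hp]; field_simp
  obtain ⟨A, hA, hgood⟩ := exists_training_event D hsupp hL hB hζ hδ hδ1.le hu hlip hξ hξζ hξε hf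
    hreg hm
  have hker : ∀ {x y : Vec n} {z : ℝ}, ‖x‖ ≤ 1 → ‖y‖ ≤ 1 → |z - inner ℝ x y| ≤ e →
      |kernelPoly d z - mkernel d x y| ≤ εK := by
    intro x y z hx hy hz
    rw [mkernel_eq]
    refine abs_kernelPoly_sub_le hd hεK hεK1 ?_ (by rwa [← he])
    exact (abs_real_inner_le_norm _ _).trans (mul_le_one₀ hx (norm_nonneg _) hy)
  have himp : ∀ S ∉ A, ∀ V : Fin m₂ → Vec n × ℝ,
      (∀ i, ‖(V i).1‖ ≤ 1 ∧ (V i).2 ∈ Set.Icc (0 : ℝ) 1) → ∀ z z',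
      (∀ q, |z q - inner ℝ (S q.1).1 (S q.2).1| ≤ e) →
      (∀ q, |z' q - inner ℝ (V q.1).1 (S q.2).1| ≤ e) → BadRun D d u (1 / L) T bound S V z z' →
      ValidationFailure D f η d u (1 / L) T S V z := by
    intro S hS V hV z z' hz hz' hbad
    obtain ⟨hS1, hgen, hτ, ha⟩ := hgood S hS
    by_contra hval
    simp only [ValidationFailure, not_exists, not_and, not_not] at hval
    obtain ⟨t, ht, hlt⟩ := hbad
    obtain ⟨s, hs, hsle⟩ := exists_genError_le D hm hL hB hεK.le hu hmono hlip hv hξ hξζ hξε hf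
      hreg hS1 hgen hτ (K := fun i j => kernelPoly d (z (i, j)))
      (fun i j => hker (hS1 i).1 (hS1 j).1 (hz (i, j))) hT1
    have hout := genError_output_le D hm hm₂1 hL hεK.le hu hlip hreg hS1 hV
      (fun i j => kernelPoly d (z (i, j))) (K' := fun i j => kernelPoly d (z' (i, j)))
      (fun i j => hker (hV i).1 (hS1 j).1 (hz' (i, j))) hval hs ht
    have htot := total_error_le (C' := C') (ε := ε) hC hC' hm hB hL hζ hδ hδ3.le hκ0 hXT hX1.le
      hsmall ha rfl rfl
    have hb2 : bound = 5000 * C * (errA2 B L ζ ε δ m₁ + κ ^ 2 + κ) := hbound'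
    linarith
  have hrun := runProb_le D hsupp m₁ m₂ est hp0 hacc (BadRun D d u (1 / L) T bound) hA
    (fun S hS i => ((hgood S hS).1 i).1) (ValidationFailure D f η d u (1 / L) T)
    (fun S _ => lintegral_validationFailure_le _ D hm₂1 (hsupp.mono fun p hp => hp.2) hf1 hfm hreg
      hum hu d (1 / L) S hT1 hδ) himp
  refine hrun.trans (le_of_eq ?_)
  rw [hpsum, ← ENNReal.ofReal_add hδ.le hδ.le, ← ENNReal.ofReal_add hδ.le (by positivity)]
  congr 1; ring

end Alphatron

theorem mainTheorem3 :
    ∃ C₀ > (0 : ℝ), ∃ C₀' > (0 : ℝ), ∀ C ≥ C₀, ∀ C' ≥ C₀', ∃ C'' > (0 : ℝ),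
      ∀ (n d m₁ : ℕ) (B L ζ ε δ εK : ℝ) (u : ℝ → ℝ)
        (D : MeasureTheory.Measure (Alphatron.Vec n × ℝ)),
        1 ≤ d → 1 ≤ m₁ → 0 < B → 0 < L → 0 < ζ → 0 < ε → 0 < δ → δ < 1 → 0 < εK →
        Alphatron.LearningSetting d B L ζ ε u D →
        ∀ T m₂ : ℕ, T = Alphatron.numIter C B L δ m₁ → m₂ = Alphatron.numVal C' δ m₁ T →
        ∀ bound e p : ℝ,
          bound = C'' * (Alphatron.errA2 B L ζ ε δ m₁ + εK ^ 2 * (T : ℝ) ^ 2 + εK * (T : ℝ)) →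
          e = εK / (3 * (d : ℝ)) →
          p = δ / ((m₁ : ℝ) ^ 2 + (m₁ : ℝ) * (m₂ : ℝ)) →
          -- inner products estimated by sampling
          Alphatron.runProb D m₁ m₂ (Alphatron.l2Estimate e p)
              (Alphatron.BadRun D d u (1 / L) T bound) ≤ ENNReal.ofReal (3 * δ) ∧
          -- inner products estimated by any other subroutine with the same guarantee
          ∀ est : Alphatron.Vec n → Alphatron.Vec n → MeasureTheory.Measure ℝ,
            Alphatron.IsInnerProductEstimator e p est →
            Alphatron.runProb D m₁ m₂ est
              (Alphatron.BadRun D d u (1 / L) T bound) ≤ ENNReal.ofReal (3 * δ) := by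
  refine ⟨1, one_pos, 1, one_pos, fun C hC C' hC' => ⟨5000 * C, by linarith, ?_⟩⟩
  intro n d m₁ B L ζ ε δ εK u D hd hm hB hL hζ _ hδ hδ1 hεK hset T m₂ hT hm₂ bound e p hbound he hp
  have hm1 : (1 : ℝ) ≤ m₁ := by exact_mod_cast hm
  have hd1 : (1 : ℝ) ≤ d := by exact_mod_cast hd
  have he0 : 0 < e := by rw [he]; positivity
  have hden : 1 ≤ (m₁ : ℝ) ^ 2 + (m₁ : ℝ) * (m₂ : ℝ) := by
    have : 0 ≤ (m₁ : ℝ) * (m₂ : ℝ) := by positivity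
    nlinarith
  have hp0 : 0 < p := by rw [hp]; positivity
  -- Needed so that `log (1/p) > 0` and the median is taken over at least one mean.
  have hp1 : p < 1 := by
    rw [hp, div_lt_one (by linarith)]
    linarith
  refine ⟨?_, fun est hest => ?_⟩
  · exact Alphatron.runProb_badRun_le hC hC' hd hm hB hL hζ hδ hδ1 hεK hset hT hm₂ hbound he hp _
      fun x y _ _ => Alphatron.l2Estimate_accurate he0 hp0 hp1 x y
  · have := hest.isProbability
    exact Alphatron.runProb_badRun_le hC hC' hd hm hB hL hζ hδ hδ1 hεK hset hT hm₂ hbound he hp est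
      hest.accurate
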